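/- **Proposition 2.3.** Let $k$ be a field of characteristic $0$, let $S=\operatorname{Spec} k[[t]]$ and $S_n=\operatorname{Spec} k[t]/(t^n)$, and let $X\to S$ be a smooth, separated scheme of finite type. Write $X_n=X\times_S S_n$. For a scheme $Y$ let $\Omega^r_Y$ be the Zariski sheaf of absolute Kähler $r$-forms (with $\Omega^{-1}_Y=0$), let $Z^r_Y=\ker(d:\Omega^r_Y\to\Omega^{r+1}_Y)$ be the subsheaf of closed forms, and let $\mathcal K^{\rm M}_{r,Y}$ be the Milnor $K$-sheaf, i.e. the Zariski sheaf associated with $U\mapsto K^{\rm M}_r(\mathcal O_Y(U))$, where $K^{\rm M}_*(A)$ is the tensor algebra of the abelian group $A^\times$ over $\mathbb Z$ modulo the two-sided ideal generated by the $u\otimes(1-u)$ with $u,1-u\in A^\times$. Let $d\log:\mathcal K^{\rm M}_{r,Y}\to Z^r_Y$ be given by $\{y_1,\dots,y_r\}\mapsto d\log y_1\wedge\cdots\wedge d\log y_r$. For $n\ge 1$ all $X_n$ have the same underlying topological space, and sheaves on them are regarded as sheaves on this space. 1. For all $r\ge 0$ and $n\ge 1$ the square of sheaves of abelian groups $$\begin{array}{ccc}\mathcal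 K^{\rm M}_{r,X_n}&\longrightarrow&\mathcal K^{\rm M}_{r,X_1}\\ {\scriptstyle d\log}\downarrow&&\downarrow{\scriptstyle d\log}\\ Z^r_{X_n}&\longrightarrow& Z^r_{X_1}\end{array}$$ with horizontal restriction maps is cartesian. 2. For all $r\ge 0$ and $n\ge 2$ there is a morphism of short exact sequences $$\begin{array}{ccccccccc}0&\to&\Omega^{r-1}_{X_1}&\xrightarrow{\ b\ }&\mathcal K^{\rm M}_{r,X_n}&\to&\mathcal K^{\rm M}_{r,X_{n-1}}&\to&0\\ &&{\scriptstyle =}\downarrow&&{\scriptstyle d\log}\downarrow&&{\scriptstyle d\log}\downarrow&&\\ 0&\to&\Omega^{r-1}_{X_1}&\xrightarrow{\ a\ }&Z^r_{X_n}&\to&Z^r_{X_{n-1}}&\to&0\end{array}$$ in which the maps to $X_{n-1}$ are the restrictions and, for $r\ge 1$, $a$ and $b$ are well-defined homomorphisms given by $$a(\eta)=t^{n-1}\,d\eta+(n-1)\,t^{n-2}\,dt\wedge\eta,\qquad b(x\,d\log y_1\wedge\cdots\wedge d\log y_{r-1})=\{1+x\,t^{n-1},y_1,\dots,y_{r-1}\},$$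 where $\eta$, $x$ and the units $y_i$ on the right-hand sides are replaced by arbitrary local lifts from $X_1$ to $X_n$. -/

import Mathlib

open CategoryTheory Limits TopologicalSpace Opposite AlgebraicGeometry
open scoped KaehlerDifferential

universe u

namespace MilnorDlog

noncomputable section

/-- The algebra of absolute Kähler differential forms `⨁_r Ω^r_A` of a ring `A`: the exterior algebra
over `A` of the module `Ω¹_A = Ω_{A/ℤ}`. The group `Ω^r_A` is its degree `r` part
`⋀[A]^r Ω[A⁄ℤ]`. -/
abbrev Forms (A : Type u) [CommRing A] : Type u := ExteriorAlgebra A Ω[A⁄ℤ]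

/-- The exact one-form `da`, as an element of the algebra of forms. -/
def dElem (A : Type u) [CommRing A] : A →+ Forms A :=
  (ExteriorAlgebra.ι A).toAddMonoidHom.comp (KaehlerDifferential.D ℤ A : A →ₗ[ℤ] Ω[A⁄ℤ]).toAddMonoidHom

section deRham

variable (A : Type u) [CommRing A]

theorem dElem_apply (a : A) : dElem A a = ExteriorAlgebra.ι A (KaehlerDifferential.D ℤ A a) := rfl

theorem dElem_mul (a b : A) : dElem A (a * b) = a • dElem A b + b • dElem A a := by
  simp [dElem_apply]

theorem dElem_one : dElem A 1 = 0 := by simp [dElem_apply]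

theorem dElem_sq (a : A) : dElem A a * dElem A a = 0 := ExteriorAlgebra.ι_sq_zero _

theorem dElem_swap (a b : A) : dElem A a * dElem A b = - (dElem A b * dElem A a) :=
  eq_neg_of_add_eq_zero_left (ExteriorAlgebra.ι_add_mul_swap _ _)

/-- The algebra of forms is generated by `A` and the exact one-forms `da`. -/
theorem forms_induction {P : Forms A → Prop} (hc : ∀ a, P (algebraMap A _ a))
    (hd : ∀ a, P (dElem A a)) (hadd : ∀ x y, P x → P y → P (x + y))
    (hmul : ∀ x y, P x → P y → P (x * y)) (ω : Forms A) : P ω := by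
  induction ω using ExteriorAlgebra.induction with
  | algebraMap r => exact hc r
  | mul a b ha hb => exact hmul a b ha hb
  | add a b ha hb => exact hadd a b ha hb
  | ι x =>
    have hx : x ∈ Submodule.span A (Set.range (KaehlerDifferential.D ℤ A)) := by
      rw [KaehlerDifferential.span_range_derivation]; trivial
    induction hx using Submodule.span_induction with
    | mem y hy => obtain ⟨a, rfl⟩ := hy; exact hd a
    | zero => simpa using hc 0
    | add y z _ _ hy hz => rw [map_add]; exact hadd _ _ hy hz
    | smul a y _ hy => rw [map_smul, Algebra.smul_def]; exact hmul _ _ (hc a) hy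

/-- The ring homomorphism `a ↦ (a, da; 0, a)` into matrices of forms, used to build the exterior
derivative. -/
def jet : A →+* Matrix (Fin 2) (Fin 2) (Forms A) where
  toFun a := !![algebraMap A _ a, dElem A a; 0, algebraMap A _ a]
  map_one' := by
    simp [dElem_one, Matrix.one_fin_two]
  map_zero' := by
    ext i j; fin_cases i <;> fin_cases j <;> simp
  map_add' a b := by
    ext i j; fin_cases i <;> fin_cases j <;> simp
  map_mul' a b := by
    rw [Matrix.mul_fin_two, dElem_mul, map_mul, Algebra.smul_def, Algebra.smul_def,
      Algebra.commutes b (dElem A a)]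
    simp only [mul_zero, zero_mul, add_zero, zero_add]

theorem jet_apply (a : A) : jet A a = !![algebraMap A _ a, dElem A a; 0, algebraMap A _ a] := rfl

/-- The centralizer of the image of `jet`, which is an `A`-algebra through `jet`. -/
def JetAlg : Type u := ↥(Subring.centralizer (Set.range (jet A)))

instance : Ring (JetAlg A) :=
  inferInstanceAs (Ring ↥(Subring.centralizer (Set.range (jet A))))

instance : Algebra A (JetAlg A) :=
  RingHom.toAlgebra'
    ((jet A).codRestrict (Subring.centralizer (Set.range (jet A))) (fun a => by
      rw [Subring.mem_centralizer_iff]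
      rintro _ ⟨b, rfl⟩
      rw [← map_mul, ← map_mul, mul_comm]))
    (fun a x => Subtype.ext (Subring.mem_centralizer_iff.1 x.2 _ ⟨a, rfl⟩))

/-- The inclusion of `JetAlg A` in the matrix ring. -/
def JetAlg.mat : JetAlg A →+* Matrix (Fin 2) (Fin 2) (Forms A) :=
  (Subring.centralizer (Set.range (jet A))).subtype

theorem JetAlg.mat_injective : Function.Injective (JetAlg.mat A) := Subtype.val_injective

theorem JetAlg.mat_algebraMap (a : A) : JetAlg.mat A (algebraMap A _ a) = jet A a := rfl

theorem JetAlg.mat_smul (a : A) (x : JetAlg A) : JetAlg.mat A (a • x) = jet A a * JetAlg.mat A x := by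
  rw [Algebra.smul_def, map_mul]; rfl

/-- The diagonal matrix `(-db, 0; 0, db)`. -/
def jetDFun (b : A) : JetAlg A := ⟨!![-dElem A b, 0; 0, dElem A b], by
    rw [Subring.mem_centralizer_iff]
    rintro _ ⟨a, rfl⟩
    rw [jet_apply, Matrix.mul_fin_two, Matrix.mul_fin_two]
    rw [dElem_swap A a b]
    simp only [mul_zero, zero_mul, add_zero, zero_add, mul_neg, neg_mul, neg_zero, Algebra.commutes]⟩

theorem JetAlg.mat_jetDFun (b : A) :
    JetAlg.mat A (jetDFun A b) = !![-dElem A b, 0; 0, dElem A b] := rfl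

theorem jetDFun_mul (a b : A) : jetDFun A (a * b) = a • jetDFun A b + b • jetDFun A a := by
  apply JetAlg.mat_injective A
  rw [map_add, JetAlg.mat_smul, JetAlg.mat_smul]
  simp only [JetAlg.mat_jetDFun, jet_apply, Matrix.mul_fin_two, dElem_mul, dElem_swap A a b,
    Algebra.smul_def]
  ext i j; fin_cases i <;> fin_cases j <;> simp [add_comm]

theorem jetDFun_add (a b : A) : jetDFun A (a + b) = jetDFun A a + jetDFun A b := by
  apply JetAlg.mat_injective A
  rw [map_add]
  simp only [JetAlg.mat_jetDFun, map_add]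
  ext i j; fin_cases i <;> fin_cases j <;> simp [add_comm]

/-- `b ↦ (-db, 0; 0, db)` as a derivation of `A` with values in `JetAlg A`. -/
def jetD : Derivation ℤ A (JetAlg A) :=
  Derivation.mk' (AddMonoidHom.mk' (jetDFun A) (jetDFun_add A)).toIntLinearMap (jetDFun_mul A)

theorem jetD_apply (a : A) : jetD A a = jetDFun A a := rfl

theorem jetD_mul (a b : A) : jetD A a * jetD A b = - (jetD A b * jetD A a) := by
  apply JetAlg.mat_injective A
  rw [map_neg, map_mul, map_mul]
  simp only [jetD_apply, JetAlg.mat_jetDFun, Matrix.mul_fin_two, dElem_swap A a b]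
  ext i j; fin_cases i <;> fin_cases j <;> simp [dElem_swap A a b]

theorem jetD_sq (a : A) : jetD A a * jetD A a = 0 := by
  apply JetAlg.mat_injective A
  rw [map_zero, map_mul]
  simp only [jetD_apply, JetAlg.mat_jetDFun, Matrix.mul_fin_two]
  ext i j; fin_cases i <;> fin_cases j <;> simp [dElem_sq A a]

theorem kaehler_induction {P : Ω[A⁄ℤ] → Prop} (hd : ∀ a, P (KaehlerDifferential.D ℤ A a))
    (h0 : P 0) (hadd : ∀ x y, P x → P y → P (x + y)) (hs : ∀ (a : A) x, P x → P (a • x))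
    (x : Ω[A⁄ℤ]) : P x := by
  have hx : x ∈ Submodule.span A (Set.range (KaehlerDifferential.D ℤ A)) := by
    rw [KaehlerDifferential.span_range_derivation]; trivial
  induction hx using Submodule.span_induction with
  | mem y hy => obtain ⟨a, rfl⟩ := hy; exact hd a
  | zero => exact h0
  | add y z _ _ hy hz => exact hadd _ _ hy hz
  | smul a y _ hy => exact hs _ _ hy

theorem jetL_anti (x y : Ω[A⁄ℤ]) :
    (jetD A).liftKaehlerDifferential x * (jetD A).liftKaehlerDifferential y =
     -((jetD A).liftKaehlerDifferential y * (jetD A).liftKaehlerDifferential x) := by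
  induction x using kaehler_induction with
  | h0 => simp
  | hadd x x' h h' => rw [map_add, add_mul, mul_add, h, h', neg_add]
  | hs a x h => rw [map_smul, smul_mul_assoc, mul_smul_comm, h, smul_neg]
  | hd a =>
    induction y using kaehler_induction with
    | h0 => simp
    | hadd x x' h h' => rw [map_add, add_mul, mul_add, h, h', neg_add]
    | hs a x h => rw [map_smul, smul_mul_assoc, mul_smul_comm, h, smul_neg]
    | hd b => simpa using jetD_mul A a b

theorem jetL_sq (x : Ω[A⁄ℤ]) :
    (jetD A).liftKaehlerDifferential x * (jetD A).liftKaehlerDifferential x = 0 := by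
  induction x using kaehler_induction with
  | h0 => simp
  | hadd x y h h' => rw [map_add, add_mul, mul_add, mul_add, h, h', jetL_anti A x y]; simp
  | hs a x h => rw [map_smul, smul_mul_assoc, mul_smul_comm, h, smul_zero, smul_zero]
  | hd a => simpa using jetD_sq A a

/-- The ring homomorphism `ω ↦ ((-1)^{deg ω} ω, dω; 0, ω)`, which extends `a ↦ (a, da; 0, a)` and
`da ↦ (-da, 0; 0, da)`. -/
def jetForms : Forms A →+* Matrix (Fin 2) (Fin 2) (Forms A) :=
  (JetAlg.mat A).comp
    (ExteriorAlgebra.lift A ⟨(jetD A).liftKaehlerDifferential, jetL_sq A⟩).toRingHom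

theorem jetForms_algebraMap (a : A) : jetForms A (algebraMap A _ a) = jet A a := by
  simp [jetForms, JetAlg.mat_algebraMap]

theorem jetForms_dElem (a : A) :
    jetForms A (dElem A a) = !![-dElem A a, 0; 0, dElem A a] := by
  simp [jetForms, dElem_apply, jetD_apply, JetAlg.mat_jetDFun]

/-- The exterior derivative of absolute forms: the unique additive map with
`d(a db₁ ∧ ⋯ ∧ db_r) = da ∧ db₁ ∧ ⋯ ∧ db_r`, see `extD_algebraMap`, `extD_smul` and
`extD_dElem_mul`. -/
def extD : Forms A →+ Forms A where
  toFun ω := jetForms A ω 0 1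
  map_zero' := by simp
  map_add' x y := by simp

theorem jetForms_col (ω : Forms A) : jetForms A ω 1 0 = 0 ∧ jetForms A ω 1 1 = ω := by
  induction ω using forms_induction with
  | hc a => simp [jetForms_algebraMap, jet]
  | hd a => simp [jetForms_dElem]
  | hadd x y hx hy => simp [hx, hy]
  | hmul x y hx hy => simp [Matrix.mul_apply, hx, hy]

theorem extD_algebraMap (a : A) : extD A (algebraMap A _ a) = dElem A a := by
  simp [extD, jetForms_algebraMap, jet]

theorem extD_dElem_mul (a : A) (ω : Forms A) : extD A (dElem A a * ω) = -(dElem A a * extD A ω) := by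
  simp [extD, jetForms_dElem, Matrix.mul_apply]

theorem extD_smul (a : A) (ω : Forms A) : extD A (a • ω) = dElem A a * ω + a • extD A ω := by
  simp [extD, Algebra.smul_def, jetForms_algebraMap, jet, Matrix.mul_apply, (jetForms_col A ω).2,
    add_comm]


theorem jetForms_ι (x : Ω[A⁄ℤ]) : jetForms A (ExteriorAlgebra.ι A x) 0 0 = -ExteriorAlgebra.ι A x := by
  induction x using kaehler_induction with
  | hd a => rw [← dElem_apply, jetForms_dElem]; simp
  | h0 => simp
  | hadd x y hx hy => simp [hx, hy, add_comm]
  | hs a x hx => simp [Algebra.smul_def, jetForms_algebraMap, jet_apply, Matrix.mul_apply, hx,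
      (jetForms_col A _).1]

theorem extD_ι_mul (x : Ω[A⁄ℤ]) (ω : Forms A) :
    extD A (ExteriorAlgebra.ι A x * ω) =
      extD A (ExteriorAlgebra.ι A x) * ω - ExteriorAlgebra.ι A x * extD A ω := by
  simp [extD, Matrix.mul_apply, jetForms_ι, (jetForms_col A ω).2]
  abel

theorem ι_mem (x : Ω[A⁄ℤ]) : ExteriorAlgebra.ι A x ∈ ⋀[A]^1 Ω[A⁄ℤ] := by
  rw [ExteriorAlgebra.exteriorPower, pow_one]; exact ⟨x, rfl⟩

theorem mul_mem_forms {r s t : ℕ} (h : r + s = t) {x y : Forms A} (hx : x ∈ ⋀[A]^r Ω[A⁄ℤ])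
    (hy : y ∈ ⋀[A]^s Ω[A⁄ℤ]) : x * y ∈ ⋀[A]^t Ω[A⁄ℤ] := by
  subst h
  rw [ExteriorAlgebra.exteriorPower, pow_add]; exact Submodule.mul_mem_mul hx hy

theorem extD_ι_mem (x : Ω[A⁄ℤ]) : extD A (ExteriorAlgebra.ι A x) ∈ ⋀[A]^2 Ω[A⁄ℤ] := by
  induction x using kaehler_induction with
  | hd a =>
    rw [← dElem_apply]
    simp [extD, jetForms_dElem]
  | h0 => simp
  | hadd x y hx hy => rw [map_add, map_add]; exact add_mem hx hy
  | hs a x hx =>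
    rw [map_smul, extD_smul]
    exact add_mem (mul_mem_forms A (by rfl) (ι_mem A _) (ι_mem A _)) (Submodule.smul_mem _ _ hx)

theorem extD_mem {r : ℕ} {ω : Forms A} (h : ω ∈ ⋀[A]^r Ω[A⁄ℤ]) :
    extD A ω ∈ ⋀[A]^(r + 1) Ω[A⁄ℤ] := by
  induction r generalizing ω with
  | zero =>
    rw [ExteriorAlgebra.exteriorPower, pow_zero, Submodule.mem_one] at h
    obtain ⟨a, rfl⟩ := h
    rw [extD_algebraMap]
    exact ι_mem A _
  | succ r ih =>
    rw [ExteriorAlgebra.exteriorPower, pow_succ'] at h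
    refine Submodule.mul_induction_on h (fun m hm n hn => ?_) (fun x y hx hy => ?_)
    · obtain ⟨x, rfl⟩ := hm
      rw [extD_ι_mul]
      exact sub_mem (mul_mem_forms A (by omega) (extD_ι_mem A x) hn)
        (mul_mem_forms A (by omega) (ι_mem A x) (ih hn))
    · rw [map_add]; exact add_mem hx hy

/-- The exterior derivative `d : Ω^r_A → Ω^{r+1}_A`. -/
def extDeriv (r : ℕ) : ⋀[A]^r Ω[A⁄ℤ] →+ ⋀[A]^(r + 1) Ω[A⁄ℤ] :=
  AddMonoidHom.mk' (fun ω => ⟨extD A ω, extD_mem A ω.2⟩) (fun x y => Subtype.ext (by simp))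

/-- The map `η ↦ dx ∧ η` from `Ω^r_A` to `Ω^{r+1}_A`. -/
def wedgeD (r : ℕ) (x : A) : ⋀[A]^r Ω[A⁄ℤ] →+ ⋀[A]^(r + 1) Ω[A⁄ℤ] :=
  AddMonoidHom.mk' (fun ω => ⟨dElem A x * ω, mul_mem_forms A (by omega) (ι_mem A _) ω.2⟩)
    (fun x y => Subtype.ext (by simp [mul_add]))

/-- The group `Z^r_A` of closed absolute `r`-forms, the kernel of `d : Ω^r_A → Ω^{r+1}_A`. -/
def closedSubgroup (r : ℕ) : AddSubgroup (⋀[A]^r Ω[A⁄ℤ]) := (extDeriv A r).ker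

end deRham

section functoriality

variable {A B C : Type u} [CommRing A] [CommRing B] [CommRing C]

/-- The map of algebras of forms `a db₁ ∧ ⋯ ∧ db_r ↦ f(a) df(b₁) ∧ ⋯ ∧ df(b_r)` induced by a ring
homomorphism `f`. -/
def mapForms (f : A →+* B) : Forms A →+* Forms B :=
  letI := f.toAlgebra
  (ExteriorAlgebra.lift A
    ⟨((ExteriorAlgebra.ι B).restrictScalars A).comp (KaehlerDifferential.map ℤ ℤ A B),
      fun _ => ExteriorAlgebra.ι_sq_zero _⟩ : Forms A →ₐ[A] Forms B).toRingHom

theorem mapForms_algebraMap (f : A →+* B) (a : A) :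
    mapForms f (algebraMap A _ a) = algebraMap B _ (f a) := by
  let _ := f.toAlgebra
  simp only [mapForms, AlgHom.toRingHom_eq_coe, RingHom.coe_coe, AlgHom.commutes]
  exact IsScalarTower.algebraMap_apply A B (Forms B) a

theorem mapForms_ι (f : A →+* B) (x : Ω[A⁄ℤ]) :
    let _ := f.toAlgebra
    mapForms f (ExteriorAlgebra.ι A x) =
      ExteriorAlgebra.ι B (KaehlerDifferential.map ℤ ℤ A B x) := by
  let _ := f.toAlgebra
  exact ExteriorAlgebra.lift_ι_apply A
    (((ExteriorAlgebra.ι B).restrictScalars A).comp (KaehlerDifferential.map ℤ ℤ A B)) _ x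

theorem mapForms_dElem (f : A →+* B) (a : A) : mapForms f (dElem A a) = dElem B (f a) := by
  let _ := f.toAlgebra
  rw [dElem_apply, mapForms_ι, KaehlerDifferential.map_D]
  rfl

theorem mapForms_ι_mem (f : A →+* B) (x : Ω[A⁄ℤ]) :
    mapForms f (ExteriorAlgebra.ι A x) ∈ ⋀[B]^1 Ω[B⁄ℤ] := by
  rw [mapForms_ι]
  exact ι_mem B _

theorem mapForms_mem (f : A →+* B) {r : ℕ} {ω : Forms A} (h : ω ∈ ⋀[A]^r Ω[A⁄ℤ]) :
    mapForms f ω ∈ ⋀[B]^r Ω[B⁄ℤ] := by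
  induction r generalizing ω with
  | zero =>
    rw [ExteriorAlgebra.exteriorPower, pow_zero, Submodule.mem_one] at h ⊢
    obtain ⟨a, rfl⟩ := h
    exact ⟨f a, (mapForms_algebraMap f a).symm⟩
  | succ r ih =>
    rw [ExteriorAlgebra.exteriorPower, pow_succ'] at h
    refine Submodule.mul_induction_on h (fun m hm n hn => ?_) (fun x y hx hy => ?_)
    · obtain ⟨x, rfl⟩ := hm
      rw [map_mul]
      exact mul_mem_forms B (by omega) (mapForms_ι_mem f x) (ih hn)
    · rw [map_add]; exact add_mem hx hy

theorem mapForms_id (ω : Forms A) : mapForms (RingHom.id A) ω = ω := by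
  induction ω using forms_induction with
  | hc a => simp [mapForms_algebraMap]
  | hd a => simp [mapForms_dElem]
  | hadd x y hx hy => simp [hx, hy]
  | hmul x y hx hy => simp [hx, hy]

theorem mapForms_comp (g : B →+* C) (f : A →+* B) (ω : Forms A) :
    mapForms (g.comp f) ω = mapForms g (mapForms f ω) := by
  induction ω using forms_induction with
  | hc a => simp [mapForms_algebraMap]
  | hd a => simp [mapForms_dElem]
  | hadd x y hx hy => simp [hx, hy]
  | hmul x y hx hy => simp [hx, hy]

theorem jetForms_mapForms (f : A →+* B) (ω : Forms A) :
    jetForms B (mapForms f ω) = (mapForms f).mapMatrix (jetForms A ω) := by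
  induction ω using forms_induction with
  | hc a =>
    rw [mapForms_algebraMap, jetForms_algebraMap, jetForms_algebraMap, jet_apply, jet_apply]
    ext i j; fin_cases i <;> fin_cases j <;> simp [mapForms_algebraMap, mapForms_dElem]
  | hd a =>
    rw [mapForms_dElem, jetForms_dElem, jetForms_dElem]
    ext i j; fin_cases i <;> fin_cases j <;> simp [mapForms_dElem]
  | hadd x y hx hy => simp only [map_add, hx, hy]
  | hmul x y hx hy => simp only [map_mul, hx, hy]

theorem extD_mapForms (f : A →+* B) (ω : Forms A) :
    extD B (mapForms f ω) = mapForms f (extD A ω) := by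
  simp [extD, jetForms_mapForms]

/-- The map `Ω^r_A → Ω^r_B` induced by a ring homomorphism `f : A → B`. -/
def mapDeg (r : ℕ) (f : A →+* B) : ⋀[A]^r Ω[A⁄ℤ] →+ ⋀[B]^r Ω[B⁄ℤ] :=
  AddMonoidHom.mk' (fun ω => ⟨mapForms f ω, mapForms_mem f ω.2⟩) (fun x y => Subtype.ext (by simp))

theorem extDeriv_mapDeg (r : ℕ) (f : A →+* B) (ω : ⋀[A]^r Ω[A⁄ℤ]) :
    extDeriv B r (mapDeg r f ω) = mapDeg (r + 1) f (extDeriv A r ω) :=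
  Subtype.ext (extD_mapForms f ω)

end functoriality

section Milnor

variable (r : ℕ) (A : Type u) [CommRing A]

open scoped TensorProduct

/-- The subgroup of `(Aˣ)^{⊗ r}` generated by the `a₁ ⊗ ⋯ ⊗ a_r` with `a_i + a_{i+1} = 1` for some
`i`, i.e. the degree `r` part of the two-sided ideal generated by the `a ⊗ (1 - a)`. -/
def steinberg : AddSubgroup (⨂[ℤ] _ : Fin r, Additive Aˣ) :=
  AddSubgroup.closure {x | ∃ (a : Fin r → Aˣ) (i j : Fin r), (j : ℕ) = i + 1 ∧
    (a i : A) + a j = 1 ∧ x = PiTensorProduct.tprod ℤ (fun l => Additive.ofMul (a l))}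

/-- The Milnor `K`-group `K^M_r(A)`: the degree `r` part of the tensor algebra of the abelian group
`Aˣ` modulo the two-sided ideal generated by the `a ⊗ (1 - a)` with `a` and `1 - a` units. -/
def MilnorK : Type u := (⨂[ℤ] _ : Fin r, Additive Aˣ) ⧸ steinberg r A

instance : AddCommGroup (MilnorK r A) :=
  inferInstanceAs (AddCommGroup ((⨂[ℤ] _ : Fin r, Additive Aˣ) ⧸ steinberg r A))

variable {A}

/-- The symbol `{a_1, …, a_r}`. -/
def symbol (a : Fin r → Aˣ) : MilnorK r A :=
  QuotientAddGroup.mk (PiTensorProduct.tprod ℤ (fun l => Additive.ofMul (a l)))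

variable {r}

theorem milnor_hom_ext {G : Type*} [AddCommGroup G] {f g : MilnorK r A →+ G}
    (h : ∀ a, f (symbol r a) = g (symbol r a)) : f = g := by
  refine QuotientAddGroup.addMonoidHom_ext _ ?_
  have : (f.comp (QuotientAddGroup.mk' (steinberg r A))).toIntLinearMap =
      (g.comp (QuotientAddGroup.mk' (steinberg r A))).toIntLinearMap :=
    PiTensorProduct.ext (MultilinearMap.ext fun a => h (fun l => (a l).toMul))
  exact AddMonoidHom.ext fun x => LinearMap.congr_fun this x

variable (r)
/-- A multilinear map on `Aˣ` which kills the Steinberg relations factors over `K^M_r(A)`. -/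
def milnorLift {G : Type*} [AddCommGroup G]
    (φ : MultilinearMap ℤ (fun _ : Fin r => Additive Aˣ) G)
    (h : ∀ (a : Fin r → Aˣ) (i j : Fin r), (j : ℕ) = i + 1 → (a i : A) + a j = 1 →
      φ (fun l => Additive.ofMul (a l)) = 0) : MilnorK r A →+ G :=
  QuotientAddGroup.lift _ (PiTensorProduct.lift φ).toAddMonoidHom (by
    rw [steinberg, AddSubgroup.closure_le]
    rintro _ ⟨a, i, j, hij, ha, rfl⟩
    simpa using h a i j hij ha)

theorem milnorLift_symbol {G : Type*} [AddCommGroup G]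
    (φ : MultilinearMap ℤ (fun _ : Fin r => Additive Aˣ) G) (h) (a : Fin r → Aˣ) :
    milnorLift r φ h (symbol r a) = φ (fun l => Additive.ofMul (a l)) := by
  exact PiTensorProduct.lift.tprod _

variable {B : Type u} [CommRing B]

/-- The map `{a₁, …, a_r} ↦ {f(a₁), …, f(a_r)}`. -/
def mapMilnor (f : A →+* B) : MilnorK r A →+ MilnorK r B :=
  milnorLift r (((QuotientAddGroup.mk' (steinberg r B)).toIntLinearMap.compMultilinearMap
    (PiTensorProduct.tprod ℤ)).compLinearMap
      fun _ => (MonoidHom.toAdditive (Units.map (f : A →* B))).toIntLinearMap) (by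
    intro a i j hij ha
    refine (QuotientAddGroup.eq_zero_iff _).2 (AddSubgroup.subset_closure ?_)
    exact ⟨fun l => Units.map (f : A →* B) (a l), i, j, hij, by simpa using congrArg f ha, rfl⟩)

theorem mapMilnor_symbol (f : A →+* B) (a : Fin r → Aˣ) :
    mapMilnor r f (symbol r a) = symbol r (fun l => Units.map (f : A →* B) (a l)) :=
  milnorLift_symbol r _ _ _

variable (A) in
/-- The logarithmic derivative `dlog u = u⁻¹ du`. -/
def dlogOne : Additive Aˣ →+ Ω[A⁄ℤ] :=
  AddMonoidHom.mk' (fun u => ((u.toMul⁻¹ : Aˣ) : A) • KaehlerDifferential.D ℤ A (u.toMul : A)) (by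
    intro u v
    simp only [toMul_add, Units.val_mul, Derivation.leibniz, mul_inv, smul_add, smul_smul]
    rw [add_comm]
    congr 2
    · rw [mul_assoc, Units.inv_mul, mul_one]
    · rw [mul_right_comm, Units.inv_mul, one_mul])

theorem dlogOne_apply (u : Aˣ) : dlogOne A (Additive.ofMul u) =
    ((u⁻¹ : Aˣ) : A) • KaehlerDifferential.D ℤ A (u : A) := rfl

theorem dlog_steinberg (a : Fin r → Aˣ) (i j : Fin r) (hij : (j : ℕ) = i + 1)
    (h : (a i : A) + a j = 1) :
    exteriorPower.ιMulti A r (fun l => dlogOne A (Additive.ofMul (a l))) = 0 := by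
  have hne : i ≠ j := by rintro rfl; omega
  set v : Fin r → Ω[A⁄ℤ] := fun l => dlogOne A (Additive.ofMul (a l)) with hv
  have hD : KaehlerDifferential.D ℤ A (a j : A) = - KaehlerDifferential.D ℤ A (a i : A) := by
    have := congrArg (KaehlerDifferential.D ℤ A) h
    rw [map_add, Derivation.map_one_eq_zero] at this
    exact eq_neg_of_add_eq_zero_right this
  have hj : v j = (-((a j)⁻¹ : Aˣ) * (a i : A) : A) • v i := by
    simp only [hv, dlogOne_apply, hD, smul_smul, mul_assoc, Units.mul_inv, mul_one, smul_neg,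
      neg_smul, neg_mul]
  rw [← Function.update_eq_self j v, hj, AlternatingMap.map_update_smul,
    AlternatingMap.map_update_self _ _ hne.symm, smul_zero]

variable (A) in
/-- The map `{a₁, …, a_r} ↦ dlog a₁ ∧ ⋯ ∧ dlog a_r` from `K^M_r(A)` to `Ω^r_A`. -/
def dlogForms : MilnorK r A →+ ⋀[A]^r Ω[A⁄ℤ] :=
  milnorLift r (((exteriorPower.ιMulti A r (M := Ω[A⁄ℤ])).toMultilinearMap.restrictScalars ℤ).compLinearMap
      fun _ => (dlogOne A).toIntLinearMap) (dlog_steinberg r)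

theorem dlogForms_symbol (a : Fin r → Aˣ) : dlogForms r A (symbol r a) =
    exteriorPower.ιMulti A r (fun l => dlogOne A (Additive.ofMul (a l))) :=
  milnorLift_symbol r _ _ _

theorem extD_dlogOne (u : Aˣ) : extD A (ExteriorAlgebra.ι A (dlogOne A (Additive.ofMul u))) = 0 := by
  have h : KaehlerDifferential.D ℤ A ((u⁻¹ : Aˣ) : A) =
      -((u⁻¹ : Aˣ) * (u⁻¹ : Aˣ) : A) • KaehlerDifferential.D ℤ A (u : A) := by
    have := congrArg (fun x => ((u⁻¹ : Aˣ) : A) • KaehlerDifferential.D ℤ A x) (Units.mul_inv u)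
    simp only [Derivation.leibniz, Derivation.map_one_eq_zero, smul_add, smul_smul,
      Units.inv_mul, one_smul, smul_zero] at this
    rw [eq_neg_of_add_eq_zero_left this, neg_smul]
  rw [dlogOne_apply, map_smul, extD_smul, ← dElem_apply, dElem_apply A ((u⁻¹ : Aˣ) : A), h, map_smul,
    ← dElem_apply, smul_mul_assoc, dElem_sq]
  simp [extD, jetForms_dElem]

theorem extD_ιMulti_dlogOne (a : Fin r → Aˣ) :
    extD A (ExteriorAlgebra.ιMulti A r (fun l => dlogOne A (Additive.ofMul (a l)))) = 0 := by
  induction r with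
  | zero =>
    rw [ExteriorAlgebra.ιMulti_zero_apply, ← map_one (algebraMap A _), extD_algebraMap, dElem_one]
  | succ r ih =>
    rw [ExteriorAlgebra.ιMulti_succ_apply, extD_ι_mul, extD_dlogOne, zero_mul, zero_sub, neg_eq_zero]
    exact (congrArg _ (ih (Matrix.vecTail a))).trans (mul_zero _)

variable (A) in
/-- The map `dlog : K^M_r(A) → Z^r_A`, `{a₁, …, a_r} ↦ dlog a₁ ∧ ⋯ ∧ dlog a_r`. -/
def dlogClosed : MilnorK r A →+ closedSubgroup A r :=
  (dlogForms r A).codRestrict (closedSubgroup A r) (by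
    have : (extDeriv A r).comp (dlogForms r A) = 0 := milnor_hom_ext fun a => by
      rw [AddMonoidHom.comp_apply, dlogForms_symbol]
      exact Subtype.ext (extD_ιMulti_dlogOne r a)
    exact fun x => DFunLike.congr_fun this x)

end Milnor

section sheaves

/-- `A ↦ K^M_r(A)` as a functor. -/
def milnorFunctor (r : ℕ) : CommRingCat.{u} ⥤ AddCommGrpCat.{u} where
  obj A := AddCommGrpCat.of (MilnorK r A)
  map f := AddCommGrpCat.ofHom (mapMilnor r f.hom)
  map_id A := by
    ext1
    exact milnor_hom_ext fun a => mapMilnor_symbol r _ a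
  map_comp f g := by
    ext1
    refine milnor_hom_ext fun a => ?_
    change mapMilnor r _ (symbol r a) = mapMilnor r g.hom (mapMilnor r f.hom (symbol r a))
    rw [mapMilnor_symbol, mapMilnor_symbol, mapMilnor_symbol]
    rfl

/-- `A ↦ Ω^r_A` as a functor. -/
def formsFunctor (r : ℕ) : CommRingCat.{u} ⥤ AddCommGrpCat.{u} where
  obj A := AddCommGrpCat.of (⋀[A]^r Ω[A⁄ℤ])
  map f := AddCommGrpCat.ofHom (mapDeg r f.hom)
  map_id A := by
    exact ConcreteCategory.hom_ext _ _ fun x => Subtype.ext (mapForms_id _)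
  map_comp f g := by
    exact ConcreteCategory.hom_ext _ _ fun x => Subtype.ext (mapForms_comp g.hom f.hom _)

/-- The exterior derivative as a natural transformation. -/
def extDerivNat (r : ℕ) : formsFunctor.{u} r ⟶ formsFunctor.{u} (r + 1) where
  app A := AddCommGrpCat.ofHom (extDeriv A r)
  naturality A B f := by
    ext x
    exact extDeriv_mapDeg r f.hom x

/-- `A ↦ Z^r_A` as a functor. -/
def closedFunctor (r : ℕ) : CommRingCat.{u} ⥤ AddCommGrpCat.{u} where
  obj A := AddCommGrpCat.of (closedSubgroup A r)
  map {A B} f := AddCommGrpCat.ofHom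
    (((mapDeg r f.hom).comp (closedSubgroup A r).subtype).codRestrict (closedSubgroup B r)
      (fun x => by
        change extDeriv B r (mapDeg r f.hom x) = 0
        rw [extDeriv_mapDeg, show extDeriv A r x = 0 from x.2, map_zero]))
  map_id A := by
    exact ConcreteCategory.hom_ext _ _ fun x => Subtype.ext (Subtype.ext (mapForms_id _))
  map_comp f g := by
    exact ConcreteCategory.hom_ext _ _ fun x =>
      Subtype.ext (Subtype.ext (mapForms_comp g.hom f.hom _))

/-- The inclusion `Z^r ⊆ Ω^r`. -/
def closedIncl (r : ℕ) : closedFunctor.{u} r ⟶ formsFunctor.{u} r where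
  app A := AddCommGrpCat.ofHom (closedSubgroup A r).subtype

/-- The natural transformation `dlog : K^M_r → Z^r`. -/
def dlogNat (r : ℕ) : milnorFunctor.{u} r ⟶ closedFunctor.{u} r where
  app A := AddCommGrpCat.ofHom (dlogClosed r A)
  naturality A B f := by
    ext1
    refine milnor_hom_ext fun a => Subtype.ext (Subtype.ext ?_)
    change ((dlogForms r B (mapMilnor r f.hom (symbol r a)) : ⋀[B]^r Ω[B⁄ℤ]) : Forms B) =
      mapForms f.hom (dlogForms r A (symbol r a) : ⋀[A]^r Ω[A⁄ℤ])
    rw [mapMilnor_symbol, dlogForms_symbol, dlogForms_symbol, exteriorPower.ιMulti_apply_coe,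
      exteriorPower.ιMulti_apply_coe, ExteriorAlgebra.ιMulti_apply, ExteriorAlgebra.ιMulti_apply,
      map_list_prod, List.map_ofFn]
    congr 2
    funext l
    change _ = mapForms f.hom (ExteriorAlgebra.ι A (dlogOne A (Additive.ofMul (a l))))
    rw [dlogOne_apply, dlogOne_apply, map_smul, map_smul, Algebra.smul_def, Algebra.smul_def,
      map_mul, ← dElem_apply, ← dElem_apply, mapForms_dElem, mapForms_algebraMap]
    rfl

/-- For a functor `F` from rings to abelian groups and a scheme `X`, the Zariski sheaf associated
with `U ↦ F(O_X(U))`. -/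
def sheafOf (F : CommRingCat.{u} ⥤ AddCommGrpCat.{u}) (X : Scheme.{u}) :
    TopCat.Sheaf AddCommGrpCat.{u} X :=
  (presheafToSheaf (Opens.grothendieckTopology X) AddCommGrpCat.{u}).obj (X.presheaf ⋙ F)

/-- The sheaf homomorphism induced by a natural transformation. -/
def sheafOfMap {F G : CommRingCat.{u} ⥤ AddCommGrpCat.{u}} (α : F ⟶ G) (X : Scheme.{u}) :
    sheafOf F X ⟶ sheafOf G X :=
  (presheafToSheaf (Opens.grothendieckTopology X) AddCommGrpCat.{u}).map
    (Functor.whiskerLeft X.presheaf α)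

/-- The section of `sheafOf F X` over `U` defined by an element of `F(O_X(U))`. -/
def toSection (F : CommRingCat.{u} ⥤ AddCommGrpCat.{u}) (X : Scheme.{u}) (U : X.Opens) :
    F.obj Γ(X, U) ⟶ (sheafOf F X).obj.obj (op U) :=
  (toSheafify (Opens.grothendieckTopology X) (X.presheaf ⋙ F)).app (op U)

/-- Direct image `f_*` of sheaves of abelian groups. -/
abbrev pushSheaf {X Y : Scheme.{u}} (f : Y ⟶ X) :
    TopCat.Sheaf AddCommGrpCat.{u} Y ⥤ TopCat.Sheaf AddCommGrpCat.{u} X :=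
  TopCat.Sheaf.pushforward AddCommGrpCat.{u} f.base

/-- For `f : Y ⟶ X`, the natural map `F_X → f_* F_Y` which restricts along `f`: it is induced by
`F(O_X(U)) → F(O_Y(f⁻¹ U))`. -/
def sheafRestrict (F : CommRingCat.{u} ⥤ AddCommGrpCat.{u}) {X Y : Scheme.{u}} (f : Y ⟶ X) :
    sheafOf F X ⟶ (pushSheaf f).obj (sheafOf F Y) :=
  ⟨sheafifyLift (Opens.grothendieckTopology X)
    (Functor.whiskerRight f.c F ≫ Functor.whiskerLeft (Opens.map f.base).op
        (toSheafify (Opens.grothendieckTopology Y) (Y.presheaf ⋙ F)))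
    ((pushSheaf f).obj (sheafOf F Y)).property⟩

theorem sheafRestrict_toSection (F : CommRingCat.{u} ⥤ AddCommGrpCat.{u}) {X Y : Scheme.{u}} (f : Y ⟶ X)
    (U : X.Opens) (s : F.obj Γ(X, U)) :
    (sheafRestrict F f).hom.app (op U) (toSection F X U s) =
      toSection F Y (f ⁻¹ᵁ U) (F.map (f.app U) s) := by
  have := toSheafify_sheafifyLift (Opens.grothendieckTopology X)
    (Functor.whiskerRight f.c F ≫ Functor.whiskerLeft (Opens.map f.base).op
        (toSheafify (Opens.grothendieckTopology Y) (Y.presheaf ⋙ F)))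
    ((pushSheaf f).obj (sheafOf F Y)).property
  have h2 := congrArg (fun α => α.app (op U)) this
  exact ConcreteCategory.congr_hom h2 s

theorem closedIncl_extDerivNat (r : ℕ) : closedIncl.{u} r ≫ extDerivNat r = 0 := by
  refine NatTrans.ext (funext fun A => ConcreteCategory.hom_ext _ _ fun x => ?_)
  exact x.2

theorem whisker_closedIncl_extDerivNat (r : ℕ) (X : Scheme.{u}) :
    Functor.whiskerLeft X.presheaf (closedIncl.{u} r) ≫
      Functor.whiskerLeft X.presheaf (extDerivNat r) = 0 :=
  NatTrans.ext (funext fun U => NatTrans.congr_app (closedIncl_extDerivNat r) (X.presheaf.obj U))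

theorem sheafOfMap_comp_eq_zero (r : ℕ) (X : Scheme.{u}) :
    sheafOfMap (closedIncl r) X ≫ sheafOfMap (extDerivNat r) X = 0 :=
  ((presheafToSheaf (Opens.grothendieckTopology X) AddCommGrpCat.{u}).map_comp _ _).symm.trans
    ((congrArg _ (whisker_closedIncl_extDerivNat r X)).trans (Functor.map_zero _ _ _))

/-- The sheaf of closed forms is the kernel of `d : Ω^r_X → Ω^{r+1}_X`. -/
theorem closedSheaf_isKernel (r : ℕ) (X : Scheme.{u}) :
    Nonempty (IsLimit (KernelFork.ofι _ (sheafOfMap_comp_eq_zero r X))) := by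
  have w := whisker_closedIncl_extDerivNat.{u} r X
  have hl : IsLimit (KernelFork.ofι _ w) := by
    refine KernelFork.IsLimit.ofι _ _
      (fun {W} g hg =>
        { app := fun U => AddCommGrpCat.ofHom ((g.app U).hom.codRestrict (closedSubgroup _ r)
            (fun x => ConcreteCategory.congr_hom (NatTrans.congr_app hg U) x))
          naturality := fun U V i => ConcreteCategory.hom_ext _ _ fun x => Subtype.ext
            (ConcreteCategory.congr_hom (g.naturality i) x) })
      (fun g hg => NatTrans.ext (funext fun U => ConcreteCategory.hom_ext _ _ fun x => rfl))
      (fun g hg m hm => NatTrans.ext (funext fun U => ConcreteCategory.hom_ext _ _ fun x =>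
        Subtype.ext (ConcreteCategory.congr_hom (NatTrans.congr_app hm U) x)))
  exact ⟨KernelFork.mapIsLimit _ hl
    (presheafToSheaf (Opens.grothendieckTopology X) AddCommGrpCat.{u})⟩

/-- The Milnor `K`-sheaf `𝒦^M_{r,X}` for the Zariski topology. -/
abbrev milnorSheaf (r : ℕ) (X : Scheme.{u}) : TopCat.Sheaf AddCommGrpCat.{u} X :=
  sheafOf (milnorFunctor r) X

/-- The Zariski sheaf `Ω^r_X` of absolute `r`-forms. -/
abbrev formsSheaf (r : ℕ) (X : Scheme.{u}) : TopCat.Sheaf AddCommGrpCat.{u} X :=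
  sheafOf (formsFunctor r) X

/-- The Zariski sheaf `Z^r_X` of closed absolute `r`-forms. It is the kernel of
`d : Ω^r_X → Ω^{r+1}_X`, see `closedSheaf_isKernel`. -/
abbrev closedSheaf (r : ℕ) (X : Scheme.{u}) : TopCat.Sheaf AddCommGrpCat.{u} X :=
  sheafOf (closedFunctor r) X

/-- The inclusion `Z^r_X ⟶ Ω^r_X`. -/
abbrev closedToForms (r : ℕ) (X : Scheme.{u}) : closedSheaf r X ⟶ formsSheaf r X :=
  sheafOfMap (closedIncl r) X

/-- The homomorphism of sheaves `dlog : 𝒦^M_{r,X} ⟶ Z^r_X`. -/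
abbrev dlogSheaf (r : ℕ) (X : Scheme.{u}) : milnorSheaf r X ⟶ closedSheaf r X :=
  sheafOfMap (dlogNat r) X

end sheaves

section thickenings

open scoped PowerSeries Polynomial

variable (k : Type u) [Field k]

/-- The ring `k[t]/(t^n)`. -/
abbrev TruncRing (n : ℕ) : Type u := k[X] ⧸ Ideal.span {(Polynomial.X : k[X]) ^ n}

theorem truncRing_eq {n : ℕ} {p q : k[X]} (h : ∀ d < n, p.coeff d = q.coeff d) :
    (Ideal.Quotient.mk _ p : TruncRing k n) = Ideal.Quotient.mk _ q := by
  rw [Ideal.Quotient.eq, Ideal.mem_span_singleton, Polynomial.X_pow_dvd_iff]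
  intro d hd
  rw [Polynomial.coeff_sub, h d hd, sub_self]

/-- The truncation homomorphism `k[[t]] → k[t]/(t^n)`. -/
def truncHom (n : ℕ) : k⟦X⟧ →+* TruncRing k n where
  toFun f := Ideal.Quotient.mk _ (PowerSeries.trunc n f)
  map_one' := by
    rw [← map_one (Ideal.Quotient.mk _)]
    refine truncRing_eq k fun d hd => ?_
    rw [PowerSeries.coeff_trunc, if_pos hd, PowerSeries.coeff_one, Polynomial.coeff_one]
  map_zero' := by simp
  map_add' f g := by simp
  map_mul' f g := by
    rw [← map_mul]
    refine truncRing_eq k fun d hd => ?_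
    rw [← PowerSeries.trunc_trunc_mul_trunc, PowerSeries.coeff_trunc, if_pos hd,
      ← Polynomial.coe_mul, Polynomial.coeff_coe]

/-- The projection `k[t]/(t^n) → k[t]/(t^m)` for `m ≤ n`. -/
def truncProj {m n : ℕ} (h : m ≤ n) : TruncRing k n →+* TruncRing k m :=
  Ideal.Quotient.factor (Ideal.span_singleton_le_span_singleton.2 (pow_dvd_pow _ h))

theorem truncProj_truncHom {m n : ℕ} (h : m ≤ n) :
    (truncProj k h).comp (truncHom k n) = truncHom k m := by
  ext f
  refine truncRing_eq k fun d hd => ?_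
  rw [PowerSeries.coeff_trunc, PowerSeries.coeff_trunc, if_pos hd, if_pos (hd.trans_le h)]

/-- `S = Spec k[[t]]`. -/
abbrev BaseS : Scheme.{u} := Spec (CommRingCat.of k⟦X⟧)

/-- `S_n = Spec k[t]/(t^n)`. -/
abbrev BaseSn (n : ℕ) : Scheme.{u} := Spec (CommRingCat.of (TruncRing k n))

/-- The closed immersion `S_n ⟶ S`. -/
def baseSnToS (n : ℕ) : BaseSn k n ⟶ BaseS k := Spec.map (CommRingCat.ofHom (truncHom k n))

/-- The closed immersion `S_m ⟶ S_n` for `m ≤ n`. -/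
def baseSnToSn {m n : ℕ} (h : m ≤ n) : BaseSn k m ⟶ BaseSn k n := Spec.map (CommRingCat.ofHom (truncProj k h))

theorem baseSnToSn_comp {m n : ℕ} (h : m ≤ n) : baseSnToSn k h ≫ baseSnToS k n = baseSnToS k m := by
  rw [baseSnToSn, baseSnToS, baseSnToS, ← Spec.map_comp, ← CommRingCat.ofHom_comp, truncProj_truncHom]

variable {k}
variable {X : Scheme.{u}} (π : X ⟶ BaseS k)

/-- The scheme `X_n = X ×_S S_n`. -/
abbrev thick (n : ℕ) : Scheme.{u} := pullback π (baseSnToS k n)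

/-- The closed immersion `X_m ⟶ X_n` for `m ≤ n`; it is a homeomorphism if `1 ≤ m`. -/
def thickMap {m n : ℕ} (h : m ≤ n) : thick π m ⟶ thick π n :=
  pullback.lift (pullback.fst _ _) (pullback.snd _ _ ≫ baseSnToSn k h) (by
    rw [Category.assoc, baseSnToSn_comp, pullback.condition])

/-- The function `t`, restricted to an open subset `U` of `X_n`. -/
def tFun (n : ℕ) (U : (thick π n).Opens) : Γ(thick π n, U) :=
  (thick π n).presheaf.map (homOfLE le_top).op
    ((pullback.snd π (baseSnToS k n)).appTop
      ((Scheme.ΓSpecIso (CommRingCat.of (TruncRing k n))).inv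
        (Ideal.Quotient.mk _ Polynomial.X : TruncRing k n)))

/-- The restriction of sheaves `𝒦^M_{r,X_n} ⟶ 𝒦^M_{r,X_m}`; sheaves on `X_m` are viewed on `X_n`. -/
abbrev milnorRes (r : ℕ) {m n : ℕ} (h : m ≤ n) : milnorSheaf r (thick π n) ⟶
    (pushSheaf (thickMap π h)).obj (milnorSheaf r (thick π m)) :=
  sheafRestrict (milnorFunctor r) (thickMap π h)

/-- The restriction of sheaves `Ω^r_{X_n} ⟶ Ω^r_{X_m}`; sheaves on `X_m` are viewed on `X_n`. -/
abbrev formsRes (r : ℕ) {m n : ℕ} (h : m ≤ n) : formsSheaf r (thick π n) ⟶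
    (pushSheaf (thickMap π h)).obj (formsSheaf r (thick π m)) :=
  sheafRestrict (formsFunctor r) (thickMap π h)

/-- The restriction of sheaves `Z^r_{X_n} ⟶ Z^r_{X_m}`; sheaves on `X_m` are viewed on `X_n`. -/
abbrev closedRes (r : ℕ) {m n : ℕ} (h : m ≤ n) : closedSheaf r (thick π n) ⟶
    (pushSheaf (thickMap π h)).obj (closedSheaf r (thick π m)) :=
  sheafRestrict (closedFunctor r) (thickMap π h)

/-- The homomorphism `dlog : 𝒦^M_{r,X_m} ⟶ Z^r_{X_m}`, viewed on `X_n`. -/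
abbrev dlogPush (r : ℕ) {m n : ℕ} (h : m ≤ n) :
    (pushSheaf (thickMap π h)).obj (milnorSheaf r (thick π m)) ⟶
      (pushSheaf (thickMap π h)).obj (closedSheaf r (thick π m)) :=
  (pushSheaf (thickMap π h)).map (dlogSheaf r (thick π m))

/-- `b` is given by `b(x dlog y₁ ∧ ⋯ ∧ dlog y_r) = {1 + x t^{n-1}, y₁, …, y_r}`. Here `x` and the units
`y_i` are functions on an open subset of `X_n`, the form on the left is restricted to `X_1`, and `z`
is the unit `1 + x t^{n-1}`. -/
def IsSymbolMap {r n : ℕ} (h : 1 ≤ n)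
    (b : (pushSheaf (thickMap π h)).obj (formsSheaf r (thick π 1)) ⟶
      milnorSheaf (r + 1) (thick π n)) : Prop :=
  ∀ (U : (thick π n).Opens) (x : Γ(thick π n, U)) (y : Fin r → Γ(thick π n, U)ˣ)
    (z : Γ(thick π n, U)ˣ), (z : Γ(thick π n, U)) = 1 + x * tFun π n U ^ (n - 1) →
      b.hom.app (op U) ((formsRes π r h).hom.app (op U)
        (toSection (formsFunctor r) (thick π n) U
          (x • dlogForms r Γ(thick π n, U) (symbol r y)))) =
      toSection (milnorFunctor (r + 1)) (thick π n) U (symbol (r + 1) (Fin.cons z y))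

/-- `a` is given by `a(η) = t^{n-1} dη + (n-1) t^{n-2} dt ∧ η`. Here `η` is an `r`-form on an open
subset of `X_n`, restricted to `X_1` on the left, and the identity holds in `Ω^{r+1}_{X_n}`. -/
def IsFormMap {r n : ℕ} (h : 1 ≤ n)
    (a : (pushSheaf (thickMap π h)).obj (formsSheaf r (thick π 1)) ⟶
      closedSheaf (r + 1) (thick π n)) : Prop :=
  ∀ (U : (thick π n).Opens) (η : ⋀[Γ(thick π n, U)]^r Ω[Γ(thick π n, U)⁄ℤ]),
    (closedToForms (r + 1) (thick π n)).hom.app (op U) (a.hom.app (op U)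
      ((formsRes π r h).hom.app (op U) (toSection (formsFunctor r) (thick π n) U η))) =
    toSection (formsFunctor (r + 1)) (thick π n) U
      (tFun π n U ^ (n - 1) • extDeriv _ r η +
        (((n - 1 : ℕ) : Γ(thick π n, U)) * tFun π n U ^ (n - 2)) • wedgeD _ r (tFun π n U) η)

end thickenings

end

end MilnorDlog

open MilnorDlog

/-! Let A be a local ring of X_n and R = A/t. Smoothness makes A isomorphic to R[t]/(t^n)
(`exists_truncData`), and the theorem becomes a comparison of symbols with closed forms along A →
A/t^m.

Lifting. The Euler field t∂/∂t and Cartan's formula give a Poincaré lemma: a closed form that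
vanishes modulo t^m is d(t^m η) (`TruncData.poincare`, `TruncData.exists_eq_extD_smul`). Here η is a
sum of forms a du_1∧⋯∧du_p with units u_i, and d(t^m a du_1∧⋯∧du_p) = dlog{exp(t^m a u_1⋯u_p), u_1,
…, u_p}, a symbol whose first entry is 1 modulo t^m (`exists_dlogForms_eq_extD`). Hence a symbol on
X_m and a closed form on X_n that agree on X_m come locally from a symbol on X_n.

Injectivity. A symbol over A that dies in A/t^m and under dlog is zero
(`TruncData.eq_zero_of_mapMilnor`). By induction on n one may take m = n-1. The kernel of K^M_r(A) →
K^M_r(A/t^{n-1}) is generated by the symbols with an entry 1 + x t^{n-1}, that is, by the image of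
b. Now dlog b(η) = d(t^{n-1}η), which vanishes only if η lies in the ideal (t, dt)
(`TruncData.mem_formsIdeal_of_extD_eq_zero`), and b kills that ideal.

The heart is that b is well defined (`exists_symbolHom`). The module Ω¹_A is generated by the dlog u
with the relations u dlog u + v dlog v = w dlog w for u + v = w (`exists_linearMap_dlogOne`); the
matching relation for symbols is `IsSteinberg.add_relation`. Both this and the vanishing of b on dt
rest on {1 + x t^i, 1 + z t^j} = 0 for i + j ≥ n (`IsSteinberg.one_add_one_add`). That is proved by
descending induction on N = i + j: to leading order the symbol is biadditive and depends only on j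
and xz, a three-term relation makes it additive in j, antisymmetry then shows that N times it
vanishes, and A contains ℚ.

Sheaves. Injectivity at stalks spreads to neighbourhoods, because Milnor K-groups commute with the
colimit defining the stalk. This gives cartesian squares for all 1 ≤ m ≤ n (`isPullback_milnor`).
The map a is η ↦ d(t^{n-1}η) descended to X_1, the map b has components 0 and a in the cartesian
square for m = n-1, and the upper row inherits exactness from the lower one. In degree 0 there are
no forms of degree -1, so both restrictions are isomorphisms. -/

namespace MilnorDlog

/-! ### Steinberg pairings on a local ring containing ℚ -/

section pairings

/-- A pairing on the units of `A` which is bimultiplicative and satisfies the Steinberg relation.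
It is a function on `A × A` whose values at non-units are irrelevant. -/
structure IsSteinberg {A G : Type*} [CommRing A] [AddCommGroup G] (ψ : A → A → G) : Prop where
  mul_left : ∀ {a a' b : A}, IsUnit a → IsUnit a' → IsUnit b → ψ (a * a') b = ψ a b + ψ a' b
  mul_right : ∀ {a b b' : A}, IsUnit a → IsUnit b → IsUnit b' → ψ a (b * b') = ψ a b + ψ a b'
  steinberg : ∀ {a b : A}, IsUnit a → IsUnit b → a + b = 1 → ψ a b = 0

variable {A : Type*} [CommRing A] {G : Type*} [AddCommGroup G]

/-- Every positive integer is invertible in `A`. -/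
def NatUnits (A : Type*) [CommRing A] : Prop := ∀ m : ℕ, m ≠ 0 → IsUnit (m : A)

theorem NatUnits.two (hQ : NatUnits A) : IsUnit (2 : A) := by exact_mod_cast hQ 2 (by norm_num)

theorem NatUnits.map {B : Type*} [CommRing B] (hQ : NatUnits A) (f : A →+* B) : NatUnits B :=
  fun m hm => by simpa using (hQ m hm).map f

/-- Two non-units would differ by a unit m' - m inside the maximal ideal. So at most one natural
translate of a fails to be a unit; this is the source of all auxiliary units below. -/
theorem isUnit_add_or [IsLocalRing A] (hQ : NatUnits A) (a : A) {m m' : ℕ} (h : m < m') :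
    IsUnit (a + m) ∨ IsUnit (a + m') := by
  by_contra! hc
  have h1 : a + m ∈ nonunits A := hc.1
  have h2 : a + m' ∈ nonunits A := hc.2
  have h3 : ((m' - m : ℕ) : A) ∈ IsLocalRing.maximalIdeal A := by
    have := (IsLocalRing.maximalIdeal A).sub_mem h2 h1
    rw [Nat.cast_sub h.le]
    simpa using this
  exact h3 (hQ _ (by omega))

theorem exists_isUnit_add [IsLocalRing A] (hQ : NatUnits A) (a : A) : ∃ m : ℕ, IsUnit (a + m) := by
  rcases isUnit_add_or hQ a zero_lt_one with h | h
  exacts [⟨_, h⟩, ⟨_, h⟩]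

theorem exists_isUnit_add_sub [IsLocalRing A] (hQ : NatUnits A) (a : A) :
    ∃ m : ℕ, IsUnit (a + m) ∧ IsUnit (1 - (a + m)) := by
  have key : ∀ m : ℕ, IsUnit (a + m) → IsUnit (1 - (a + (m + 1 : ℕ))) := fun m h => by
    have := h.neg
    convert this using 1
    push_cast
    ring
  by_cases h0 : IsUnit (a + (0 : ℕ)) ∧ IsUnit (a + (1 : ℕ))
  · exact ⟨1, h0.2, key 0 h0.1⟩
  · have h2 : IsUnit (a + (2 : ℕ)) ∧ IsUnit (a + (3 : ℕ)) := by
      have := isUnit_add_or hQ a (m := 0) (m' := 2) (by norm_num)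
      have := isUnit_add_or hQ a (m := 0) (m' := 3) (by norm_num)
      have := isUnit_add_or hQ a (m := 1) (m' := 2) (by norm_num)
      have := isUnit_add_or hQ a (m := 1) (m' := 3) (by norm_num)
      tauto
    exact ⟨3, h2.2, key 2 h2.1⟩

namespace IsSteinberg

variable {ψ : A → A → G} (H : IsSteinberg ψ)
include H

theorem one_left {b : A} (hb : IsUnit b) : ψ 1 b = 0 := by
  have := H.mul_left isUnit_one isUnit_one hb
  simpa using this

theorem one_right {a : A} (ha : IsUnit a) : ψ a 1 = 0 := by
  have := H.mul_right ha isUnit_one isUnit_one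
  simpa using this

theorem left_of_mul_eq_one {a a' b : A} (h : a * a' = 1) (hb : IsUnit b) : ψ a' b = -ψ a b := by
  have ha := IsUnit.of_mul_eq_one _ h
  have ha' := IsUnit.of_mul_eq_one _ ((mul_comm _ _).trans h)
  have := H.mul_left ha ha' hb
  rw [h, H.one_left hb] at this
  exact (neg_eq_of_add_eq_zero_right this.symm).symm

theorem right_of_mul_eq_one {a b b' : A} (h : b * b' = 1) (ha : IsUnit a) : ψ a b' = -ψ a b := by
  have hb := IsUnit.of_mul_eq_one _ h
  have hb' := IsUnit.of_mul_eq_one _ ((mul_comm _ _).trans h)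
  have := H.mul_right ha hb hb'
  rw [h, H.one_right ha] at this
  exact (neg_eq_of_add_eq_zero_right this.symm).symm

/-- The classical argument: with b = a⁻¹ one has -a = (1 - a)/(1 - b), and {a, 1 - b} = -{b, 1 - b}
= 0. -/
theorem neg_self_of_isUnit_sub {a : A} (ha : IsUnit a) (h : IsUnit (1 - a)) : ψ a (-a) = 0 := by
  obtain ⟨b, hb⟩ := ha.exists_right_inv
  have hb' : IsUnit b := IsUnit.of_mul_eq_one a ((mul_comm _ _).trans hb)
  have e : (-a) * (1 - b) = 1 - a := by linear_combination hb
  have h1 : IsUnit (1 - b) := by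
    rw [← e] at h
    exact isUnit_of_mul_isUnit_right h
  have h2 := H.mul_right ha ha.neg h1
  rw [e, H.steinberg ha h (by ring)] at h2
  have h3 : ψ b (1 - b) = 0 := H.steinberg hb' h1 (by ring)
  rw [H.left_of_mul_eq_one hb h1, neg_eq_zero] at h3
  rw [h3, add_zero] at h2
  exact h2.symm

/-- The failure of a ↦ {a, -a} to be multiplicative is the symmetrized symbol, so antisymmetry
follows once {a, -a} = 0. -/
theorem mul_neg_mul {a b : A} (ha : IsUnit a) (hb : IsUnit b) :
    ψ (a * b) (-(a * b)) = ψ a (-a) + ψ b (-b) + (ψ a b + ψ b a) := by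
  rw [H.mul_left ha hb (ha.mul hb).neg]
  have h1 : ψ a (-(a * b)) = ψ a (-a) + ψ a b := by
    rw [← H.mul_right ha ha.neg hb]; ring_nf
  have h2 : ψ b (-(a * b)) = ψ b (-b) + ψ b a := by
    rw [← H.mul_right hb hb.neg ha]; ring_nf
  rw [h1, h2]; abel

theorem neg_self [IsLocalRing A] (hQ : NatUnits A) {a : A} (ha : IsUnit a) : ψ a (-a) = 0 := by
  obtain ⟨a', ha'⟩ := ha.exists_right_inv
  have nat_aux : ∀ q : ℕ, 2 ≤ q → IsUnit (1 - (q : A)) := fun q hq => by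
    have := (hQ (q - 1) (by omega)).neg
    rw [Nat.cast_sub (by omega)] at this
    simpa using this
  -- When 1 - a is not a unit, a is replaced by aq. The right-hand side is additive in q under
  -- multiplication.
  have aux : ∀ q : ℕ, 2 ≤ q → IsUnit (1 - a * q) →
      ψ a (-a) = -(ψ a q + ψ q a) := fun q hq hu => by
    have hq' := hQ q (by omega)
    have h1 := H.mul_neg_mul ha hq'
    rw [H.neg_self_of_isUnit_sub (ha.mul hq') hu,
      H.neg_self_of_isUnit_sub hq' (nat_aux q hq), add_zero] at h1
    exact eq_neg_of_add_eq_zero_left h1.symm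
  -- Passing from q to q² doubles the right-hand side of `aux` but not the left, so both vanish.
  have fin : ∀ q : ℕ, 2 ≤ q → IsUnit (1 - a * q) → IsUnit (1 - a * (q * q : ℕ)) → ψ a (-a) = 0 := by
    intro q hq h1 h2
    have hq' := hQ q (by omega)
    have e1 := aux q hq h1
    have e2 := aux (q * q) (by nlinarith) h2
    push_cast at e2
    rw [H.mul_left hq' hq' ha, H.mul_right ha hq' hq'] at e2
    rw [← sub_eq_zero] at e1 e2 ⊢
    have : ψ a (-a) - 0 = (2 : ℤ) • (ψ a (-a) - -(ψ a q + ψ q a)) -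
      (ψ a (-a) - -(ψ a ↑q + ψ a ↑q + (ψ ↑q a + ψ ↑q a))) := by abel
    rw [this, e1, e2]; simp
  have key : ∀ q : ℕ, IsUnit (-a' + q) → IsUnit (1 - a * q) := fun q h => by
    have := (ha.mul h).neg
    convert this using 1
    linear_combination -ha'
  -- At most one of the translates by 2, 3, 4, 9 is a non-unit, so one of the pairs (2, 4), (3, 9)
  -- is available.
  by_cases h0 : IsUnit (-a' + (2 : ℕ)) ∧ IsUnit (-a' + (4 : ℕ))
  · exact fin 2 le_rfl (key _ h0.1) (key _ h0.2)
  · have h3 : IsUnit (-a' + (3 : ℕ)) ∧ IsUnit (-a' + (9 : ℕ)) := by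
      have := isUnit_add_or hQ (-a') (m := 2) (m' := 3) (by norm_num)
      have := isUnit_add_or hQ (-a') (m := 2) (m' := 9) (by norm_num)
      have := isUnit_add_or hQ (-a') (m := 3) (m' := 4) (by norm_num)
      have := isUnit_add_or hQ (-a') (m := 4) (m' := 9) (by norm_num)
      tauto
    exact fin 3 (by norm_num) (key _ h3.1) (key _ h3.2)

theorem antisymm [IsLocalRing A] (hQ : NatUnits A) {a b : A} (ha : IsUnit a) (hb : IsUnit b) :
    ψ a b = -ψ b a := by
  have := H.mul_neg_mul ha hb
  rw [H.neg_self hQ ha, H.neg_self hQ hb, H.neg_self hQ (ha.mul hb), zero_add, zero_add] at this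
  exact eq_neg_of_add_eq_zero_left this.symm

/-- The Steinberg relation for `u (1 + w c)` and `w (1 - u c)`, where `u + w = 1`. -/
theorem perturbed {u w c : A} (hu : IsUnit u) (hw : IsUnit w) (h : u + w = 1)
    (h1 : IsUnit (1 + w * c)) (h2 : IsUnit (1 - u * c)) :
    ψ u (1 - u * c) + ψ (1 + w * c) w + ψ (1 + w * c) (1 - u * c) = 0 := by
  have e := H.steinberg (hu.mul h1) (hw.mul h2) (by linear_combination h)
  rw [H.mul_left hu h1 (hw.mul h2), H.mul_right hu hw h2, H.mul_right h1 hw h2,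
    H.steinberg hu hw h] at e
  rw [← e]; abel

/-- The polarized form of `IsSteinberg.perturbed`. -/
theorem polarized {u w α β : A} (hu : IsUnit u) (hw : IsUnit w) (h : u + w = 1) (hαβ : α * β = 0)
    (h1 : IsUnit (1 + w * α)) (h2 : IsUnit (1 - u * α)) (h3 : IsUnit (1 + w * β))
    (h4 : IsUnit (1 - u * β)) :
    ψ (1 + w * α) (1 - u * β) + ψ (1 + w * β) (1 - u * α) = 0 := by
  -- Since αβ = 0, both 1 + wc and 1 - uc are multiplicative at c = α + β. The relation `perturbed`
  -- for α + β minus those for α and β leaves only the mixed terms.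
  have e1 : 1 + w * (α + β) = (1 + w * α) * (1 + w * β) := by linear_combination -w ^ 2 * hαβ
  have e2 : 1 - u * (α + β) = (1 - u * α) * (1 - u * β) := by linear_combination -u ^ 2 * hαβ
  have p1 := H.perturbed hu hw h h1 h2
  have p2 := H.perturbed hu hw h h3 h4
  have p3 := H.perturbed hu hw h (c := α + β) (e1 ▸ h1.mul h3) (e2 ▸ h2.mul h4)
  rw [e1, e2, H.mul_right hu h2 h4, H.mul_left h1 h3 hw, H.mul_left h1 h3 (h2.mul h4),
    H.mul_right h1 h2 h4, H.mul_right h3 h2 h4] at p3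
  linear_combination (norm := module) p3 - p1 - p2

/-- The relation obtained from the Steinberg relations for the units
`1 + ∏_{σ ∈ S} (1 + σ)`, `S ⊆ {α, β, γ}`. -/
theorem threeTerm [IsLocalRing A] (h2 : IsUnit (2 : A)) {α β γ a b c : A}
    (hα : IsNilpotent α) (hβ : IsNilpotent β) (hγ : IsNilpotent γ)
    (h0 : α * β * γ = 0) (ha : (2 + β) * (2 + γ) * a = 1) (hb : (2 + α) * (2 + γ) * b = 1)
    (hc : (2 + α) * (2 + β) * c = 1) :
    ψ (1 + α * β * c) (1 + γ) + ψ (1 + β * γ * a) (1 + α) + ψ (1 + α * γ * b) (1 + β) = 0 := by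
  have nu : ∀ {x : A}, IsNilpotent x → IsUnit (1 + x) := fun hx => hx.isUnit_one_add
  have nu2 : ∀ {x : A}, IsNilpotent x → IsUnit (2 + x) := fun {x} hx => by
    have := hx.isUnit_add_left_of_commute h2 (Commute.all _ _)
    exact this
  have nm : ∀ {x : A} (y : A), IsNilpotent x → IsNilpotent (x * y) := fun y hx =>
    (Commute.all _ _).isNilpotent_mul_right hx
  have na : ∀ {x y : A}, IsNilpotent x → IsNilpotent y → IsNilpotent (x + y) := fun hx hy =>
    (Commute.all _ _).isNilpotent_add hx hy
  -- products of two or three of the units `1 + σ`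
  have E1 : ∀ {x : A}, IsNilpotent x → ψ (2 + x) (-1) + ψ (2 + x) (1 + x) = 0 := fun {x} hx => by
    rw [← H.mul_right (nu2 hx) isUnit_one.neg (nu hx)]
    exact H.steinberg (nu2 hx) (isUnit_one.neg.mul (nu hx)) (by ring)
  have E2 : ∀ {x y : A}, IsNilpotent x → IsNilpotent y →
      ψ (2 + (x + y + x * y)) (-1) + ψ (2 + (x + y + x * y)) (1 + x) +
        ψ (2 + (x + y + x * y)) (1 + y) = 0 := fun {x y} hx hy => by
    have hz := na (na hx hy) (nm y hx)
    have := E1 hz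
    rw [show 1 + (x + y + x * y) = (1 + x) * (1 + y) by ring,
      H.mul_right (nu2 hz) (nu hx) (nu hy)] at this
    rw [← this]; abel
  set pα := 2 + α with hpα
  set pβ := 2 + β with hpβ
  set pγ := 2 + γ with hpγ
  set pαβ := 2 + (α + β + α * β) with hpαβ
  set pαγ := 2 + (α + γ + α * γ) with hpαγ
  set pβγ := 2 + (β + γ + β * γ) with hpβγ
  set p := 2 + (α + β + γ + α * β + α * γ + β * γ) with hp
  have uα : IsUnit pα := nu2 hα
  have uβ : IsUnit pβ := nu2 hβ
  have uγ : IsUnit pγ := nu2 hγ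
  have uαβ : IsUnit pαβ := nu2 (na (na hα hβ) (nm _ hα))
  have uαγ : IsUnit pαγ := nu2 (na (na hα hγ) (nm _ hα))
  have uβγ : IsUnit pβγ := nu2 (na (na hβ hγ) (nm _ hβ))
  have hn : IsNilpotent (α + β + γ + α * β + α * γ + β * γ) :=
    na (na (na (na (na hα hβ) hγ) (nm _ hα)) (nm _ hα)) (nm _ hβ)
  have up : IsUnit p := nu2 hn
  have uc : IsUnit (1 + α * β * c) := nu (by rw [mul_assoc]; exact nm _ hα)
  have ua : IsUnit (1 + β * γ * a) := nu (by rw [mul_assoc]; exact nm _ hβ)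
  have ub : IsUnit (1 + α * γ * b) := nu (by rw [mul_assoc]; exact nm _ hα)
  have e1 := E1 hα
  have e2 := E1 hβ
  have e3 := E1 hγ
  have e4 := E2 hα hβ
  have e5 := E2 hα hγ
  have e6 := E2 hβ hγ
  -- Because αβγ = 0, the element p - 1 is the product of all three units 1 + σ.
  have e7 : ψ p (-1) + ψ p (1 + α) + ψ p (1 + β) + ψ p (1 + γ) = 0 := by
    have := E1 hn
    rw [show 1 + (α + β + γ + α * β + α * γ + β * γ) = (1 + α) * (1 + β) * (1 + γ) by
      linear_combination -h0, H.mul_right up ((nu hα).mul (nu hβ)) (nu hγ),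
      H.mul_right up (nu hα) (nu hβ)] at this
    rw [← this]; abel
  -- The alternating product of the p's is trivial up to second order; the correction factors in
  -- `q1`, `q2`, `q3`, `q4` are the first entries of the desired relation.
  have q1 : p * pγ = pαγ * pβγ * (1 + α * β * c) := by
    have hz : α * β * c * (pαγ * pβγ) = α * β := by
      have : α * β * (pαγ * pβγ) = α * β * (pα * pβ) := by
        rw [hpαγ, hpβγ, hpα, hpβ]; linear_combination
          ((1 + α) * (2 + β) + (1 + β) * (2 + α) + γ * (1 + α) * (1 + β)) * h0
      linear_combination c * this + α * β * hc
    rw [hp, hpγ]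
    linear_combination -hz - (1 + γ) * h0
  have q2 : p * pα = pαβ * pαγ * (1 + β * γ * a) := by
    have hz : β * γ * a * (pαβ * pαγ) = β * γ := by
      have : β * γ * (pαβ * pαγ) = β * γ * (pβ * pγ) := by
        rw [hpαβ, hpαγ, hpβ, hpγ]; linear_combination
          ((1 + β) * (2 + γ) + (1 + γ) * (2 + β) + α * (1 + β) * (1 + γ)) * h0
      linear_combination a * this + β * γ * ha
    rw [hp, hpα]
    linear_combination -hz - (1 + α) * h0
  have q3 : p * pβ = pαβ * pβγ * (1 + α * γ * b) := by
    have hz : α * γ * b * (pαβ * pβγ) = α * γ := by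
      have : α * γ * (pαβ * pβγ) = α * γ * (pα * pγ) := by
        rw [hpαβ, hpβγ, hpα, hpγ]; linear_combination
          ((1 + α) * (2 + γ) + (1 + γ) * (2 + α) + β * (1 + α) * (1 + γ)) * h0
      linear_combination b * this + α * γ * hb
    rw [hp, hpβ]
    linear_combination -hz - (1 + β) * h0
  have q4 : pαβ * 2 = pα * pβ * (1 + α * β * c) := by
    rw [hpαβ]; linear_combination -α * β * hc
  have r1 : ∀ {x}, IsUnit x → ψ p x + ψ pγ x = ψ pαγ x + ψ pβγ x + ψ (1 + α * β * c) x :=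
    fun {x} hx => by
      rw [← H.mul_left up uγ hx, q1, H.mul_left (uαγ.mul uβγ) uc hx, H.mul_left uαγ uβγ hx]
  have r2 : ∀ {x}, IsUnit x → ψ p x + ψ pα x = ψ pαβ x + ψ pαγ x + ψ (1 + β * γ * a) x :=
    fun {x} hx => by
      rw [← H.mul_left up uα hx, q2, H.mul_left (uαβ.mul uαγ) ua hx, H.mul_left uαβ uαγ hx]
  have r3 : ∀ {x}, IsUnit x → ψ p x + ψ pβ x = ψ pαβ x + ψ pβγ x + ψ (1 + α * γ * b) x :=
    fun {x} hx => by
      rw [← H.mul_left up uβ hx, q3, H.mul_left (uαβ.mul uβγ) ub hx, H.mul_left uαβ uβγ hx]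
  have r4 : ∀ {x}, IsUnit x → ψ pαβ x + ψ 2 x = ψ pα x + ψ pβ x + ψ (1 + α * β * c) x :=
    fun {x} hx => by
      rw [← H.mul_left uαβ h2 hx, q4, H.mul_left (uα.mul uβ) uc hx, H.mul_left uα uβ hx]
  have s1 := r1 (nu hγ)
  have s2 := r2 (nu hα)
  have s3 := r3 (nu hβ)
  have s4 := r1 (isUnit_one (M := A)).neg
  have s5 := r4 (isUnit_one (M := A)).neg
  have s6 : ψ 2 (-1 : A) = 0 := H.steinberg h2 isUnit_one.neg (by ring)
  -- Alternating sum over the subsets of {α, β, γ}; the empty subset contributes {2, -1} = 0, which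
  -- removes the remaining terms with second entry -1.
  linear_combination (norm := module)
    e7 + e1 + e2 + e3 - e4 - e5 - e6 - s1 - s2 - s3 - s4 + s5 - s6

-- Both sides are additive in a and agree for natural numbers, so a may be replaced by a translate w
-- with w and 1 - w units.
omit H in
theorem balanced_of_isUnit [IsLocalRing A] (hQ : NatUnits A) (g : A →+ A →+ G)
    (h : ∀ w, IsUnit w → IsUnit (1 - w) → ∀ x z, g (w * x) z = g x (w * z)) (a x z : A) :
    g (a * x) z = g x (a * z) := by
  obtain ⟨m, h1, h2⟩ := exists_isUnit_add_sub hQ a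
  have := h _ h1 h2 x z
  simp only [add_mul, map_add, AddMonoidHom.add_apply] at this
  rw [← nsmul_eq_mul, ← nsmul_eq_mul, map_nsmul, map_nsmul, AddMonoidHom.nsmul_apply] at this
  exact add_right_cancel this

/-- Modulo the terms of total degree above N, which `ih` kills, the symbol behaves like xz·t^i
d(t^j). The proof reconstructs d(t^m) = m t^{m-1} dt from the three-term relation, and d(t^N) = 0
from antisymmetry; then N is inverted. -/
theorem nilpotent_step [IsLocalRing A] (hQ : NatUnits A) {t : A} {n N : ℕ} (ht : t ^ n = 0)
    (hN : n ≤ N)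
    (ih : ∀ i j, 1 ≤ i → 1 ≤ j → N + 1 ≤ i + j → ∀ x z, ψ (1 + x * t ^ i) (1 + z * t ^ j) = 0)
    (i j : ℕ) (hi : 1 ≤ i) (hj : 1 ≤ j) (hij : i + j = N) (x z : A) :
    ψ (1 + x * t ^ i) (1 + z * t ^ j) = 0 := by
  have htn : IsNilpotent t := ⟨n, ht⟩
  have htN : t ^ N = 0 := pow_eq_zero_of_le hN ht
  have nil : ∀ {i : ℕ}, 1 ≤ i → ∀ x : A, IsNilpotent (x * t ^ i) := fun hi x =>
    (Commute.all _ _).isNilpotent_mul_left (htn.pow_of_pos (by omega))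
  have hu : ∀ {i : ℕ}, 1 ≤ i → ∀ x : A, IsUnit (1 + x * t ^ i) := fun hi x =>
    (nil hi x).isUnit_one_add
  have addL : ∀ {i j : ℕ}, 1 ≤ i → 1 ≤ j → i + j = N → ∀ x x' z,
      ψ (1 + (x + x') * t ^ i) (1 + z * t ^ j) =
        ψ (1 + x * t ^ i) (1 + z * t ^ j) + ψ (1 + x' * t ^ i) (1 + z * t ^ j) := by
    intro i j hi hj hij x x' z
    -- The product of the two units differs from 1 + (x + x') t^i by a factor 1 + O(t^{2i}), and 2i
    -- + j > N.
    obtain ⟨c, hc⟩ := (hu hi (x + x')).exists_right_inv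
    have e : (1 + x * t ^ i) * (1 + x' * t ^ i) =
        (1 + (x + x') * t ^ i) * (1 + (x * x' * c) * t ^ (2 * i)) := by
      linear_combination (-x * x' * t ^ (2 * i)) * hc
    rw [← H.mul_left (hu hi x) (hu hi x') (hu hj z), e,
      H.mul_left (hu hi _) (hu (by omega) _) (hu hj z), ih (2 * i) j (by omega) hj (by omega),
      add_zero]
  have anti : ∀ {i j : ℕ}, 1 ≤ i → 1 ≤ j → ∀ x z,
      ψ (1 + x * t ^ i) (1 + z * t ^ j) = -ψ (1 + z * t ^ j) (1 + x * t ^ i) := fun hi hj x z =>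
    H.antisymm hQ (hu hi x) (hu hj z)
  have bal : ∀ {i j : ℕ}, 1 ≤ i → 1 ≤ j → i + j = N → ∀ a x z,
      ψ (1 + (a * x) * t ^ i) (1 + z * t ^ j) = ψ (1 + x * t ^ i) (1 + (a * z) * t ^ j) := by
    intro i j hi hj hij
    let g : A →+ A →+ G := AddMonoidHom.mk' (fun x => AddMonoidHom.mk'
      (fun z => ψ (1 + x * t ^ i) (1 + z * t ^ j)) (fun z z' => by
        rw [anti hi hj, addL hj hi (by omega), anti hi hj, anti hi hj x z']; abel))
      (fun x x' => AddMonoidHom.ext fun z => addL hi hj hij x x' z)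
    -- For w and 1 - w units, `polarized` with α = x t^i and β = z t^j gives g(wx, wz - z) = g(wx -
    -- x, wz), which is the balancing identity after expansion.
    refine balanced_of_isUnit hQ g fun w hw hw' x z => ?_
    have hz : (x * t ^ i) * (z * t ^ j) = 0 := by
      rw [mul_mul_mul_comm, ← pow_add, hij, htN, mul_zero]
    have e1 : ∀ (i : ℕ) (y : A), 1 + w * (y * t ^ i) = 1 + (w * y) * t ^ i := fun i y => by ring
    have e2 : ∀ (i : ℕ) (y : A), 1 - (1 - w) * (y * t ^ i) = 1 + (w * y - y) * t ^ i :=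
      fun i y => by ring
    have p := H.polarized hw' hw (by ring) hz (by rw [e1]; exact hu hi _) (by rw [e2]; exact hu hi _)
      (by rw [e1]; exact hu hj _) (by rw [e2]; exact hu hj _)
    rw [e1, e1, e2, e2, anti hj hi] at p
    have p' : g (w * x) (w * z - z) - g (w * x - x) (w * z) = 0 := by
      rw [sub_eq_add_neg]; exact p
    simp only [map_sub, AddMonoidHom.sub_apply] at p'
    linear_combination (norm := module) -p'
  have modt : ∀ {i j : ℕ}, 1 ≤ i → 1 ≤ j → i + j = N → ∀ x r z,
      ψ (1 + (x + t * r) * t ^ i) (1 + z * t ^ j) = ψ (1 + x * t ^ i) (1 + z * t ^ j) := by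
    intro i j hi hj hij x r z
    rw [addL hi hj hij, show t * r * t ^ i = r * t ^ (i + 1) by ring,
      ih (i + 1) j (by omega) hj (by omega), add_zero]
  have h2 : IsUnit (2 : A) := hQ.two
  obtain ⟨c4, hc4⟩ := (h2.mul h2).exists_right_inv
  have nu2 : ∀ {x : A}, IsNilpotent x → IsUnit (2 + x) := fun hx =>
    hx.isUnit_add_left_of_commute h2 (Commute.all _ _)
  -- The inverses a, b, c required by `threeTerm` all equal 1/4 modulo t, and `modt` discards the
  -- rest.
  have inv : ∀ {i j : ℕ}, 1 ≤ i → 1 ≤ j → ∀ x z : A, ∃ r,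
      (2 + x * t ^ i) * (2 + z * t ^ j) * (c4 + t * r) = 1 := by
    intro i j hi hj x z
    obtain ⟨c, hc⟩ := ((nu2 (nil hi x)).mul (nu2 (nil hj z))).exists_right_inv
    obtain ⟨i, rfl⟩ := Nat.exists_eq_add_of_le hi
    obtain ⟨j, rfl⟩ := Nat.exists_eq_add_of_le hj
    refine ⟨-c4 * (2 * x * t ^ i + 2 * z * t ^ j + x * z * t ^ (i + j + 1)) * c, ?_⟩
    have : c = c4 + t * (-c4 * (2 * x * t ^ i + 2 * z * t ^ j + x * z * t ^ (i + j + 1)) * c) := by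
      linear_combination c4 * hc - c * hc4
    rw [← this, hc]
  have three : ∀ {i j k : ℕ}, 1 ≤ i → 1 ≤ j → 1 ≤ k → i + j + k = N → ∀ x,
      ψ (1 + (x * c4) * t ^ (i + j)) (1 + 1 * t ^ k) + ψ (1 + (x * c4) * t ^ (j + k)) (1 + 1 * t ^ i) +
        ψ (1 + (x * c4) * t ^ (i + k)) (1 + 1 * t ^ j) = 0 := by
    intro i j k hi hj hk hijk x
    obtain ⟨a, ha⟩ := inv hj hk 1 1
    obtain ⟨b, hb⟩ := inv hi hk x 1
    obtain ⟨c, hc⟩ := inv hi hj x 1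
    have := H.threeTerm h2 (nil hi x) (nil hj 1) (nil hk 1) (by
      rw [show x * t ^ i * (1 * t ^ j) * (1 * t ^ k) = x * t ^ (i + j + k) by ring, hijk, htN,
        mul_zero]) ha hb hc
    rw [show x * t ^ i * (1 * t ^ j) * (c4 + t * c) = (x * c4 + t * (x * c)) * t ^ (i + j) by ring,
      show 1 * t ^ j * (1 * t ^ k) * (c4 + t * a) = (c4 + t * a) * t ^ (j + k) by ring,
      show x * t ^ i * (1 * t ^ k) * (c4 + t * b) = (x * c4 + t * (x * b)) * t ^ (i + k) by ring,
      modt (by omega) hk (by omega), modt (by omega) hi (by omega), modt (by omega) hj (by omega)]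
      at this
    rw [bal (by omega) hi (by omega), mul_one]
    exact this
  -- `h m x` is the value at `(x, m)` of a map which is additive in both variables
  let h : ℕ → A → G := fun m x => ψ (1 + (x * c4) * t ^ (N - m)) (1 + 1 * t ^ m)
  have hneg : ∀ m x, 1 ≤ m → m + 1 ≤ N → h (N - m) x = -h m x := by
    intro m x h1 h2
    change ψ _ _ = -ψ _ _
    rw [show N - (N - m) = m by omega, anti (by omega) (by omega)]
    congr 1
    have := bal (i := N - m) (j := m) (by omega) h1 (by omega) (x * c4) 1 1
    rw [mul_one] at this
    exact this.symm
  -- The three-term relation for the exponents m, 1, N - (m + 1), with the term at N - (m + 1)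
  -- turned around by antisymmetry.
  have hadd : ∀ m x, 1 ≤ m → m + 2 ≤ N → h (m + 1) x = h m x + h 1 x := by
    intro m x h1 h2
    have e := three (i := m) (j := 1) (k := N - (m + 1)) h1 le_rfl (by omega) (by omega) x
    have e1 := hneg (m + 1) x (by omega) (by omega)
    have e2 : h (N - (m + 1)) x + h m x + h 1 x = 0 := by
      simp only [h]
      rw [show N - (N - (m + 1)) = m + 1 by omega, show N - m = 1 + (N - (m + 1)) by omega,
        show N - 1 = m + (N - (m + 1)) by omega]
      exact e
    rw [e1] at e2
    linear_combination (norm := module) -e2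
  have hmul : ∀ m x, 1 ≤ m → m + 1 ≤ N → h m x = m • h 1 x := by
    intro m x h1
    induction m, h1 using Nat.le_induction with
    | base => simp
    | succ m h1 ih => intro h2; rw [hadd m x h1 (by omega), ih (by omega), succ_nsmul]
  -- Additivity gives h(N-1) = (N-1) h(1), antisymmetry gives h(N-1) = -h(1).
  have htor : ∀ x, N • h 1 x = 0 := by
    intro x
    have e1 := hneg 1 x le_rfl (by omega)
    rw [hmul (N - 1) x (by omega) (by omega)] at e1
    have : N • h 1 x = (N - 1) • h 1 x + h 1 x := by rw [← succ_nsmul]; congr 1; omega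
    rw [this, e1, neg_add_cancel]
  -- As N is invertible in A, every x is N times an element, and `h 1` is additive in x.
  have hzero : ∀ x, h 1 x = 0 := by
    intro x
    obtain ⟨d, hd⟩ := (hQ N (by omega)).exists_right_inv
    let g : A →+ G := AddMonoidHom.mk' (h 1) (fun x x' => by
      change ψ _ _ = ψ _ _ + ψ _ _
      rw [add_mul, addL (by omega) le_rfl (by omega)])
    have : g (N • (d * x)) = N • g (d * x) := map_nsmul _ _ _
    rw [nsmul_eq_mul, ← mul_assoc, hd, one_mul] at this
    exact this.trans (htor _)
  -- The factor 4 cancels the 1/4 built into `h`, and `bal` has moved z to the first entry.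
  have := hmul j (z * x * (2 * 2)) hj (by omega)
  rw [hzero, smul_zero] at this
  rw [← mul_one z, ← bal hi hj hij, ← this]
  simp only [h]
  rw [mul_assoc (z * x), hc4, mul_one, show N - j = i by omega]

/-- If `t ^ n = 0` then `{1 + x t ^ i, 1 + z t ^ j} = 0` for `i + j ≥ n`. -/
theorem one_add_one_add [IsLocalRing A] (hQ : NatUnits A) {t : A} {n : ℕ} (ht : t ^ n = 0)
    {i j : ℕ} (hi : 1 ≤ i) (hj : 1 ≤ j) (hij : n ≤ i + j) (x z : A) :
    ψ (1 + x * t ^ i) (1 + z * t ^ j) = 0 := by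
  have htn : IsNilpotent t := ⟨n, ht⟩
  have hu : ∀ {i : ℕ}, 1 ≤ i → ∀ x : A, IsUnit (1 + x * t ^ i) := fun hi x =>
    ((Commute.all _ _).isNilpotent_mul_left (htn.pow_of_pos (by omega))).isUnit_one_add
  -- Descending induction on the total degree. Once i + j ≥ 2n, one of the exponents is at least n
  -- and its entry is 1.
  have key : ∀ d N : ℕ, n ≤ N → 2 * n ≤ N + d → ∀ i j, 1 ≤ i → 1 ≤ j → N ≤ i + j → ∀ x z,
      ψ (1 + x * t ^ i) (1 + z * t ^ j) = 0 := by
    intro d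
    induction d with
    | zero =>
      intro N _ hd i j hi hj hij x z
      rcases le_total n i with h | h
      · rw [pow_eq_zero_of_le h ht, mul_zero, add_zero, H.one_left (hu hj z)]
      · rw [pow_eq_zero_of_le (show n ≤ j by omega) ht, mul_zero, add_zero, H.one_right (hu hi x)]
    | succ d ih =>
      intro N hN hd i j hi hj hij x z
      have ih' := ih (N + 1) (by omega) (by omega)
      rcases hij.eq_or_lt with h | h
      · exact H.nilpotent_step hQ ht hN ih' i j hi hj h.symm x z
      · exact ih' i j hi hj h x z
  exact key n n le_rfl (by omega) i j hi hj hij x z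

/-- The additivity relation `⟨f u, u⟩ + ⟨f v, v⟩ = ⟨f (u + v), u + v⟩`. -/
theorem add_relation [IsLocalRing A] (hQ : NatUnits A) {f : A} (hf : f ^ 2 = 0) {u v : A}
    (hu : IsUnit u) (hv : IsUnit v) (huv : IsUnit (u + v)) :
    ψ (1 + f * u) u + ψ (1 + f * v) v = ψ (1 + f * (u + v)) (u + v) := by
  have hfn : IsNilpotent f := ⟨2, hf⟩
  have nu : ∀ x : A, IsUnit (1 + f * x) := fun x =>
    ((Commute.all _ _).isNilpotent_mul_right hfn).isUnit_one_add
  obtain ⟨c, hc⟩ := huv.exists_right_inv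
  have hcu : IsUnit c := IsUnit.of_mul_eq_one (u + v) ((mul_comm _ _).trans hc)
  -- the case `u + v = 1`
  have one : ∀ {f u v : A}, f ^ 2 = 0 → IsUnit u → IsUnit v → u + v = 1 →
      ψ (1 + f * u) u + ψ (1 + f * v) v = 0 := by
    intro f u v hf hu hv huv
    have hfn : IsNilpotent f := ⟨2, hf⟩
    have nu : ∀ x : A, IsUnit (1 + f * x) := fun x =>
      ((Commute.all _ _).isNilpotent_mul_right hfn).isUnit_one_add
    have e1 : 1 - u * f = 1 + f * (-u) := by ring
    -- The product term of `perturbed` vanishes by `one_add_one_add` because f² = 0; what remains is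
    -- the claim, after antisymmetry and (1 + fu)(1 - fu) = 1.
    have p := H.perturbed hu hv huv (c := f) (by rw [mul_comm]; exact nu v) (by rw [e1]; exact nu _)
    have q := H.one_add_one_add hQ hf (i := 1) (j := 1) le_rfl le_rfl le_rfl v (-u)
    have r := H.left_of_mul_eq_one (a := 1 + f * u) (a' := 1 + f * (-u)) (b := u)
      (by linear_combination -u ^ 2 * hf) hu
    rw [pow_one] at q
    rw [show 1 - u * f = 1 + -u * f by ring, q, add_zero, show 1 + -u * f = 1 + f * (-u) by ring,
      H.antisymm hQ hu (nu _), r, neg_neg, mul_comm v f] at p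
    exact p
  -- The general case is rescaled: u, v are divided by u + v while f is multiplied by it, so that fu
  -- and fv are unchanged. The extra symbols with entry u + v recombine since f² = 0.
  have h1 : u * c + v * c = 1 := by rw [← add_mul, hc]
  have p := one (f := f * (u + v)) (by rw [mul_pow, hf, zero_mul]) (hu.mul hcu) (hv.mul hcu) h1
  have e : ∀ x, f * (u + v) * (x * c) = f * x := fun x => by linear_combination f * x * hc
  rw [e, e, H.mul_right (nu u) hu hcu, H.mul_right (nu v) hv hcu,
    H.right_of_mul_eq_one hc (nu u), H.right_of_mul_eq_one hc (nu v)] at p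
  have e2 : 1 + f * (u + v) = (1 + f * u) * (1 + f * v) := by linear_combination -u * v * hf
  rw [e2, H.mul_left (nu u) (nu v) huv]
  linear_combination (norm := module) p

end IsSteinberg

end pairings

end MilnorDlog

namespace MilnorDlog

noncomputable section

/-! ### Presentation of Ω¹ by logarithmic differentials of units -/

section dlogGenerators

variable {A : Type u} [CommRing A]

theorem coe_smul_dlogOne (u : Aˣ) :
    (u : A) • dlogOne A (Additive.ofMul u) = KaehlerDifferential.D ℤ A (u : A) := by
  rw [dlogOne_apply, smul_smul, Units.mul_inv, one_smul]

theorem D_natCast (m : ℕ) : KaehlerDifferential.D ℤ A (m : A) = 0 :=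
  (KaehlerDifferential.D ℤ A).map_natCast m

/-- Over a local ring with invertible positive integers, `Ω¹_A` is generated by the `dlog u`. -/
theorem kaehler_dlog_induction [IsLocalRing A] (hQ : NatUnits A) {P : Ω[A⁄ℤ] → Prop}
    (hd : ∀ u : Aˣ, P (dlogOne A (Additive.ofMul u))) (h0 : P 0)
    (hadd : ∀ x y, P x → P y → P (x + y)) (hs : ∀ (a : A) x, P x → P (a • x))
    (x : Ω[A⁄ℤ]) : P x := by
  refine kaehler_induction A (fun a => ?_) h0 hadd hs x
  obtain ⟨m, u, hu⟩ := exists_isUnit_add hQ a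
  have : KaehlerDifferential.D ℤ A a = (u : A) • dlogOne A (Additive.ofMul u) := by
    rw [coe_smul_dlogOne, hu, map_add, D_natCast, add_zero]
  rw [this]
  exact hs _ _ (hd u)

variable {N : Type*} [AddCommGroup N]

open Classical in
/-- The extension by zero of a function on the units. -/
def onUnits (f : Additive Aˣ → N) (a : A) : N :=
  if h : IsUnit a then f (Additive.ofMul h.unit) else 0

theorem onUnits_coe (f : Additive Aˣ → N) (u : Aˣ) : onUnits f (u : A) = f (Additive.ofMul u) := by
  rw [onUnits, dif_pos u.isUnit]
  congr 2
  exact Units.ext rfl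

theorem onUnits_mul (f : Additive Aˣ →+ N) {a b : A} (ha : IsUnit a) (hb : IsUnit b) :
    onUnits f (a * b) = onUnits f a + onUnits f b := by
  obtain ⟨u, rfl⟩ := ha
  obtain ⟨v, rfl⟩ := hb
  rw [← Units.val_mul, onUnits_coe, onUnits_coe, onUnits_coe, ofMul_mul, map_add]

theorem onUnits_one (f : Additive Aˣ →+ N) : onUnits f (1 : A) = 0 := by
  rw [← Units.val_one, onUnits_coe, ofMul_one, map_zero]

variable [Module A N]

/-- The presentation of `Ω¹_A` by the generators `dlog u`, for `A` local with invertible positive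
integers. -/
theorem exists_linearMap_dlogOne [IsLocalRing A] (hQ : NatUnits A) (φ : Additive Aˣ →+ N)
    (h : ∀ u v w : Aˣ, (u : A) + v = w → (u : A) • φ (Additive.ofMul u) +
      (v : A) • φ (Additive.ofMul v) = (w : A) • φ (Additive.ofMul w)) :
    ∃ Φ : Ω[A⁄ℤ] →ₗ[A] N, ∀ u : Aˣ, Φ (dlogOne A (Additive.ofMul u)) = φ (Additive.ofMul u) := by
  -- This is what the derivation must be on units, by du = u dlog u. It is then extended to A
  -- through translates by natural numbers.
  let θ : A → N := fun a => a • onUnits φ a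
  have θadd : ∀ {a b : A}, IsUnit a → IsUnit b → IsUnit (a + b) → θ (a + b) = θ a + θ b := by
    rintro _ _ ⟨u, rfl⟩ ⟨v, rfl⟩ ⟨w, hw⟩
    simp only [θ]
    rw [← hw, onUnits_coe, onUnits_coe, onUnits_coe, h u v w hw.symm]
  have θmul : ∀ {a b : A}, IsUnit a → IsUnit b → θ (a * b) = a • θ b + b • θ a := by
    intro a b ha hb
    simp only [θ]
    rw [onUnits_mul φ ha hb, smul_add, smul_smul, smul_smul, mul_comm b a, add_comm]
  have θnat : ∀ m : ℕ, m ≠ 0 → θ (m : A) = 0 := by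
    have h1 : θ ((1 : ℕ) : A) = 0 := by simp [θ, onUnits_one]
    intro m hm
    induction m, Nat.one_le_iff_ne_zero.2 hm using Nat.le_induction with
    | base => exact h1
    | succ m hm' ih =>
      have := θadd (hQ m (by omega)) (hQ 1 one_ne_zero)
        (by rw [← Nat.cast_add]; exact hQ (m + 1) (by omega))
      rw [← Nat.cast_add, ih (by omega), h1, add_zero] at this
      exact this
  have θle : ∀ (a : A) {m m' : ℕ}, m ≤ m' → IsUnit (a + m) → IsUnit (a + m') →
      θ (a + m') = θ (a + m) := by
    intro a m m' hm h1 h2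
    rcases hm.eq_or_lt with rfl | hm
    · rfl
    · have e : a + m' = a + m + ((m' - m : ℕ) : A) := by rw [Nat.cast_sub hm.le]; ring
      rw [e] at h2 ⊢
      rw [θadd h1 (hQ _ (by omega)) h2, θnat _ (by omega), add_zero]
  choose c hc using exists_isUnit_add hQ
  -- `D_eq` shows that any other translate that is a unit gives the same value.
  let D : A → N := fun a => θ (a + c a)
  have D_eq : ∀ (a : A) (m : ℕ), IsUnit (a + m) → D a = θ (a + m) := fun a m hm => by
    rcases le_total m (c a) with hl | hl
    · exact θle a hl hm (hc a)
    · exact (θle a hl (hc a) hm).symm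
  have D_unit : ∀ {a : A}, IsUnit a → D a = θ a := fun {a} ha => by
    rw [D_eq a 0 (by simpa using ha)]; simp
  have D_add : ∀ a b, D (a + b) = D a + D b := by
    intro a b
    obtain ⟨m, hm⟩ := exists_isUnit_add hQ a
    -- Each of the two conditions excludes at most one m', so one of 0, 1, 2 satisfies both.
    obtain ⟨m', h1, h2⟩ : ∃ m' : ℕ, IsUnit (b + m') ∧ IsUnit ((a + m + b) + m') := by
      by_contra! hc
      have := isUnit_add_or hQ b (m := 0) (m' := 1) (by norm_num)
      have := isUnit_add_or hQ b (m := 0) (m' := 2) (by norm_num)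
      have := isUnit_add_or hQ b (m := 1) (m' := 2) (by norm_num)
      have := isUnit_add_or hQ (a + m + b) (m := 0) (m' := 1) (by norm_num)
      have := isUnit_add_or hQ (a + m + b) (m := 0) (m' := 2) (by norm_num)
      have := isUnit_add_or hQ (a + m + b) (m := 1) (m' := 2) (by norm_num)
      have := hc 0
      have := hc 1
      have := hc 2
      tauto
    have e : a + m + b + m' = (a + m) + (b + m') := by ring
    have e' : a + m + b + m' = (a + b) + (m + m' : ℕ) := by push_cast; ring
    rw [D_eq a m hm, D_eq b m' h1, ← θadd hm h1 (e ▸ h2), ← e, D_eq (a + b) (m + m') (e' ▸ h2), e']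
  let D' : A →+ N := AddMonoidHom.mk' D D_add
  have D_natmul : ∀ (m : ℕ) (b : A), D (m * b) = (m : A) • D b := fun m b => by
    rw [← nsmul_eq_mul, Nat.cast_smul_eq_nsmul]
    exact map_nsmul D' m b
  have D_nat : ∀ (m : ℕ), D (m : A) = 0 := fun m => by
    have := D_natmul m 1
    rw [mul_one, D_unit isUnit_one] at this
    rw [this]
    simp [θ, onUnits_one]
  have D_mul : ∀ a b, D (a * b) = a • D b + b • D a := by
    intro a b
    obtain ⟨m, hm⟩ := exists_isUnit_add hQ a
    obtain ⟨m', hm'⟩ := exists_isUnit_add hQ b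
    have e := θmul hm hm'
    rw [← D_unit (hm.mul hm'), ← D_eq a m hm, ← D_eq b m' hm', show (a + m) * (b + m') =
      a * b + m' * a + m * b + (m * m' : ℕ) by push_cast; ring, D_add, D_add, D_add, D_natmul,
      D_natmul, D_nat, add_smul, add_smul] at e
    linear_combination (norm := module) e
  let der : Derivation ℤ A N := Derivation.mk' D'.toIntLinearMap D_mul
  refine ⟨der.liftKaehlerDifferential, fun u => ?_⟩
  rw [dlogOne_apply, map_smul, Derivation.liftKaehlerDifferential_comp_D]
  change _ • D (u : A) = _
  rw [D_unit u.isUnit]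
  simp only [θ]
  rw [onUnits_coe, smul_smul]
  simp

end dlogGenerators

/-! ### The homomorphism from forms to symbols -/

section symbolHom

/-- The module `Hom_ℤ(A, E)`, on which `A` acts through its action on itself. -/
def Coind (A E : Type*) [CommRing A] [Ring E] : Type _ := A →+ E

variable {A : Type u} [CommRing A] {E : Type*} [Ring E]

instance : AddCommGroup (Coind A E) := inferInstanceAs (AddCommGroup (A →+ E))

instance : FunLike (Coind A E) A E := inferInstanceAs (FunLike (A →+ E) A E)

instance : AddMonoidHomClass (Coind A E) A E := inferInstanceAs (AddMonoidHomClass (A →+ E) A E)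

theorem Coind.ext {f g : Coind A E} (h : ∀ x, f x = g x) : f = g := AddMonoidHom.ext h

theorem Coind.add_apply (f g : Coind A E) (x : A) : (f + g) x = f x + g x := rfl

/-- The ring E carries no A-action. The coefficient x of a form has to enter through the first entry
1 + x t^{n-1}, so scalars act on the argument of a function on A. -/
instance : SMul A (Coind A E) := ⟨fun c f => AddMonoidHom.comp f (AddMonoidHom.mulRight c)⟩

theorem Coind.smul_apply (c : A) (f : Coind A E) (x : A) : (c • f) x = f (x * c) := rfl

instance : Module A (Coind A E) where
  one_smul f := Coind.ext fun x => by rw [Coind.smul_apply, mul_one]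
  mul_smul a b f := Coind.ext fun x => by
    rw [Coind.smul_apply, Coind.smul_apply, Coind.smul_apply, mul_assoc]
  smul_zero a := Coind.ext fun x => rfl
  smul_add a f g := Coind.ext fun x => rfl
  add_smul a b f := Coind.ext fun x => by
    rw [Coind.add_apply, Coind.smul_apply, Coind.smul_apply, Coind.smul_apply, mul_add, map_add]
  zero_smul f := Coind.ext fun x => by rw [Coind.smul_apply, mul_zero, map_zero]; rfl

/-- Right multiplication on the values. -/
def Coind.rmul (e : E) : Coind A E →ₗ[A] Coind A E where
  toFun f := AddMonoidHom.comp (AddMonoidHom.mulRight e) f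
  map_add' _ _ := Coind.ext fun _ => add_mul _ _ _
  map_smul' _ _ := rfl

theorem Coind.rmul_apply (e : E) (f : Coind A E) (x : A) : Coind.rmul e f x = f x * e := rfl

variable (ρ : Additive Aˣ →+ E)

/-- Those `f` for which `f(x u) ρ(u)` is additive in the unit `u`. -/
def dlogAdditive : Submodule A (Coind A E) where
  carrier := {f | ∀ u v w : Aˣ, (u : A) + v = w → ∀ x : A, f (x * u) * ρ (Additive.ofMul u) +
    f (x * v) * ρ (Additive.ofMul v) = f (x * w) * ρ (Additive.ofMul w)}
  add_mem' := fun {f g} hf hg u v w huv x => by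
    simp only [Coind.add_apply, add_mul]
    rw [← hf u v w huv x, ← hg u v w huv x]
    abel
  zero_mem' := fun u v w huv x => by
    change 0 * _ + 0 * _ = 0 * _
    simp
  smul_mem' := fun c f hf u v w huv x => by
    simp only [Coind.smul_apply, mul_right_comm x _ c]
    exact hf u v w huv (x * c)

variable {ρ}
variable (hρ : ∀ u v : Aˣ, (u : A) + v = 1 → ρ (Additive.ofMul u) * ρ (Additive.ofMul v) = 0)
include hρ

theorem isSteinberg_mul : IsSteinberg fun a b : A => onUnits ρ a * onUnits ρ b where
  mul_left ha ha' hb := by rw [onUnits_mul ρ ha ha', add_mul]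
  mul_right ha ha' hb := by rw [onUnits_mul ρ ha' hb, mul_add]
  steinberg := by
    rintro _ _ ⟨u, rfl⟩ ⟨v, rfl⟩ h
    rw [onUnits_coe, onUnits_coe, hρ u v h]

variable [IsLocalRing A] (hQ : NatUnits A)
include hQ

theorem mul_anticomm (u v : Aˣ) : ρ (Additive.ofMul u) * ρ (Additive.ofMul v) =
    -(ρ (Additive.ofMul v) * ρ (Additive.ofMul u)) := by
  simpa only [onUnits_coe] using (isSteinberg_mul hρ).antisymm hQ u.isUnit v.isUnit

/-- Since {u, -u} = 0, the square of ρ(u) equals ρ(u)ρ(-1), which is killed by 2; and every value of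
f is divisible by 2 because 1/2 lies in A. -/
theorem coind_mul_sq (f : Coind A E) (u : Aˣ) (x : A) :
    f x * ρ (Additive.ofMul u) * ρ (Additive.ofMul u) = 0 := by
  have h1 : ρ (Additive.ofMul u) * ρ (Additive.ofMul (-u)) = 0 := by
    have := (isSteinberg_mul hρ).neg_self hQ u.isUnit
    rwa [← Units.val_neg, onUnits_coe, onUnits_coe] at this
  have h2 : ρ (Additive.ofMul u) = ρ (Additive.ofMul (-u)) + ρ (Additive.ofMul (-1)) := by
    rw [← map_add, ← ofMul_mul]; simp
  have h3 : (2 : ℕ) • ρ (Additive.ofMul (-1)) = 0 := by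
    rw [← map_nsmul, ← ofMul_pow]; simp
  obtain ⟨c, hc⟩ := hQ.two.exists_right_inv
  have h4 : f x = (2 : ℕ) • f (c * x) := by
    rw [← map_nsmul, nsmul_eq_mul, ← mul_assoc]
    push_cast
    rw [hc, one_mul]
  rw [mul_assoc]
  nth_rewrite 2 [h2]
  rw [mul_add, h1, zero_add, h4, ← mul_assoc, smul_mul_assoc, smul_mul_assoc, ← mul_smul_comm, h3,
    mul_zero]

/-- Right multiplication by `ρ(u)` on `dlogAdditive ρ`. -/
def rmulUnit (u : Aˣ) : Module.End A (dlogAdditive ρ) :=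
  -- Anticommuting ρ(u) past the other factor only changes the overall sign, so the submodule is
  -- stable.
  (Coind.rmul (ρ (Additive.ofMul u))).restrict (fun f hf a b w hab x => by
    simp only [Coind.rmul_apply]
    rw [mul_assoc, mul_assoc, mul_assoc, mul_anticomm hρ hQ u a, mul_anticomm hρ hQ u b,
      mul_anticomm hρ hQ u w, mul_neg, mul_neg, mul_neg, ← mul_assoc, ← mul_assoc, ← mul_assoc,
      ← hf a b w hab x, add_mul, neg_add])

/-- The action of `Ω¹_A` on `dlogAdditive ρ` in which `dlog u` acts by right multiplication with
`ρ(u)`. -/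
theorem exists_rmulForm : ∃ Φ : Ω[A⁄ℤ] →ₗ[A] (Module.End A (dlogAdditive ρ))ᵐᵒᵖ,
    (∀ u : Aˣ, Φ (dlogOne A (Additive.ofMul u)) = MulOpposite.op (rmulUnit hρ hQ u)) ∧
      ∀ x, Φ x * Φ x = 0 := by
  let φ : Additive Aˣ →+ (Module.End A (dlogAdditive ρ))ᵐᵒᵖ := AddMonoidHom.mk'
    (fun u => MulOpposite.op (rmulUnit hρ hQ u.toMul)) (fun u v => by
      rw [← MulOpposite.op_add]
      refine congrArg _ (LinearMap.ext fun f => Subtype.ext (Coind.ext fun x => ?_))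
      change (f : Coind A E) x * ρ (u + v) = (f : Coind A E) x * ρ u + (f : Coind A E) x * ρ v
      rw [map_add, mul_add])
  -- Membership in `dlogAdditive` is exactly the relation demanded by the presentation of Ω¹. Right
  -- multiplications compose in reverse order, whence the opposite ring.
  obtain ⟨Φ, hΦ⟩ := exists_linearMap_dlogOne hQ φ (fun u v w huv => by
    apply MulOpposite.unop_injective
    exact LinearMap.ext fun f => Subtype.ext (Coind.ext fun x => f.2 u v w huv x))
  replace hΦ : ∀ u : Aˣ, Φ (dlogOne A (Additive.ofMul u)) =
      MulOpposite.op (rmulUnit hρ hQ u) := hΦ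
  have anti : ∀ x y, Φ x * Φ y = -(Φ y * Φ x) := by
    intro x y
    induction x using kaehler_dlog_induction hQ with
    | h0 => simp
    | hadd x x' h h' => rw [map_add, add_mul, mul_add, h, h', neg_add]
    | hs a x h => rw [map_smul, smul_mul_assoc, mul_smul_comm, h, smul_neg]
    | hd u =>
      induction y using kaehler_dlog_induction hQ with
      | h0 => simp
      | hadd x x' h h' => rw [map_add, add_mul, mul_add, h, h', neg_add]
      | hs a x h => rw [map_smul, smul_mul_assoc, mul_smul_comm, h, smul_neg]
      | hd v =>
        rw [hΦ, hΦ]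
        apply MulOpposite.unop_injective
        refine LinearMap.ext fun f => Subtype.ext (Coind.ext fun x => ?_)
        change (f : Coind A E) x * ρ (Additive.ofMul u) * ρ (Additive.ofMul v) =
          -((f : Coind A E) x * ρ (Additive.ofMul v) * ρ (Additive.ofMul u))
        rw [mul_assoc, mul_anticomm hρ hQ, mul_neg, mul_assoc]
  refine ⟨Φ, hΦ, fun x => ?_⟩
  induction x using kaehler_dlog_induction hQ with
  | h0 => simp
  | hadd x y h h' => rw [map_add, add_mul, mul_add, mul_add, h, h', anti x y]; simp
  | hs a x h => rw [map_smul, smul_mul_assoc, mul_smul_comm, h, smul_zero, smul_zero]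
  | hd u =>
    rw [hΦ]
    apply MulOpposite.unop_injective
    exact LinearMap.ext fun f => Subtype.ext (Coind.ext fun x => coind_mul_sq hρ hQ _ u x)

/-- The homomorphism `x dlog y₁ ∧ ⋯ ∧ dlog y_p ↦ {1 + x t^{n-1}, y₁, …, y_p}`, which kills the forms
that restrict to zero on `A/t`. -/
theorem exists_symbolHom {t : A} {n : ℕ} (hn : 2 ≤ n) (ht : t ^ n = 0) :
    ∃ B : Forms A →+ E,
      (∀ (x : A) (z : Aˣ), (z : A) = 1 + x * t ^ (n - 1) → ∀ l : List Aˣ,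
        B (x • (l.map fun u => ExteriorAlgebra.ι A (dlogOne A (Additive.ofMul u))).prod) =
          ρ (Additive.ofMul z) * (l.map fun u => ρ (Additive.ofMul u)).prod) ∧
      (∀ ω, B (t • ω) = 0) ∧ ∀ ω, B (dElem A t * ω) = 0 := by
  have hs : (t ^ (n - 1)) ^ 2 = 0 := by rw [← pow_mul]; exact pow_eq_zero_of_le (by omega) ht
  set s := t ^ (n - 1) with hs'
  have hst : t * s = 0 := by
    rw [hs', ← pow_succ', Nat.sub_add_cancel (by omega), ht]
  have nu : ∀ x : A, IsUnit (1 + x * s) := fun x =>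
    IsNilpotent.isUnit_one_add ⟨2, by rw [mul_pow, hs, mul_zero]⟩
  -- The starting vector x ↦ {1 + x t^{n-1}}; it is additive because t^{2(n-1)} = 0.
  let f₀ : Coind A E := AddMonoidHom.mk' (fun x => onUnits ρ (1 + x * s)) (fun x y => by
    rw [← onUnits_mul ρ (nu x) (nu y)]
    congr 1
    linear_combination -x * y * hs)
  have f₀_apply : ∀ x, f₀ x = onUnits ρ (1 + x * s) := fun x => rfl
  have hf₀ : f₀ ∈ dlogAdditive ρ := fun u v w huv x => by
    have := (isSteinberg_mul hρ).add_relation hQ (f := x * s) (by rw [mul_pow, hs, mul_zero])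
      u.isUnit v.isUnit (huv ▸ w.isUnit)
    rw [huv] at this
    simp only [onUnits_coe] at this
    simp only [f₀_apply, mul_right_comm x _ s]
    exact this
  obtain ⟨Φ, hΦ, hsq⟩ := exists_rmulForm hρ hQ
  let Ψ := ExteriorAlgebra.lift A ⟨Φ, hsq⟩
  have hΨ : ∀ x, Ψ (ExteriorAlgebra.ι A x) = Φ x := fun x => ExteriorAlgebra.lift_ι_apply A Φ hsq x
  -- The exterior algebra acts on `dlogAdditive`; the sought map is the orbit of `f₀`, evaluated at
  -- 1.
  let B : Forms A →+ E := AddMonoidHom.mk'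
    (fun ω => (((Ψ ω).unop ⟨f₀, hf₀⟩ : dlogAdditive ρ) : Coind A E) 1) (fun x y => by
      rw [map_add]; rfl)
  have hprod : ∀ (l : List Aˣ) (ω : Forms A) (f : dlogAdditive ρ) (x : A),
      (((Ψ (ω * (l.map fun u => ExteriorAlgebra.ι A (dlogOne A (Additive.ofMul u))).prod)).unop f :
        dlogAdditive ρ) : Coind A E) x = (((Ψ ω).unop f : dlogAdditive ρ) : Coind A E) x *
          (l.map fun u => ρ (Additive.ofMul u)).prod := by
    intro l
    induction l with
    | nil => intro ω f x; simp
    | cons u l ih =>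
      intro ω f x
      rw [List.map_cons, List.prod_cons, ← mul_assoc, ih, map_mul, hΨ, hΦ, List.map_cons,
        List.prod_cons, ← mul_assoc]
      rfl
  have hsmul : ∀ (a : A) (ω : Forms A) (f : dlogAdditive ρ), (Ψ (a • ω)).unop f =
      (Ψ ω).unop (a • f) := fun a ω f => by
    rw [map_smul, MulOpposite.unop_smul, map_smul]; rfl
  refine ⟨B, fun x z hz l => ?_, fun ω => ?_, fun ω => ?_⟩
  · change (((Ψ _).unop ⟨f₀, hf₀⟩ : dlogAdditive ρ) : Coind A E) 1 = _
    have := hprod l 1 (x • ⟨f₀, hf₀⟩) 1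
    rw [one_mul] at this
    rw [hsmul, this, map_one Ψ, ← onUnits_coe ρ z, hz]
    congr 1
    change f₀ (1 * x) = _
    rw [f₀_apply, one_mul]
  · change (((Ψ _).unop ⟨f₀, hf₀⟩ : dlogAdditive ρ) : Coind A E) 1 = _
    have : t • (⟨f₀, hf₀⟩ : dlogAdditive ρ) = 0 := Subtype.ext (Coind.ext fun x => by
      change f₀ (x * t) = 0
      rw [f₀_apply, mul_assoc, hst, mul_zero, add_zero, onUnits_one])
    rw [hsmul, this, map_zero]
    rfl
  · change (((Ψ _).unop ⟨f₀, hf₀⟩ : dlogAdditive ρ) : Coind A E) 1 = _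
    -- As t is not a unit, dt is written as v dlog v with v = 1 + t. It acts by zero on `f₀` since
    -- {1 + xv t^{n-1}, 1 + t} has total degree n.
    obtain ⟨v, hv⟩ : IsUnit (1 + t) := IsNilpotent.isUnit_one_add ⟨n, ht⟩
    have hd : dElem A t = (v : A) • ExteriorAlgebra.ι A (dlogOne A (Additive.ofMul v)) := by
      rw [← map_smul, coe_smul_dlogOne, hv, map_add, Derivation.map_one_eq_zero, zero_add,
        dElem_apply]
    have : (v : A) • rmulUnit hρ hQ v ⟨f₀, hf₀⟩ = 0 := Subtype.ext (Coind.ext fun x => by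
      change f₀ (x * v) * ρ (Additive.ofMul v) = 0
      have := (isSteinberg_mul hρ).one_add_one_add hQ ht (i := n - 1) (j := 1) (by omega) le_rfl
        (by omega) (x * v) 1
      rw [one_mul, pow_one, ← hv, onUnits_coe] at this
      exact this)
    rw [hd, smul_mul_assoc, hsmul, map_mul, hΨ, hΦ]
    change (((Ψ ω).unop (rmulUnit hρ hQ v ((v : A) • ⟨f₀, hf₀⟩)) : dlogAdditive ρ) : Coind A E) 1 = 0
    rw [map_smul, this, map_zero]
    rfl

end symbolHom

end

end MilnorDlog

namespace MilnorDlog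

noncomputable section

/-! ### Differential ideals, grading, contraction and Lie derivative -/

section generalForms

variable {A B : Type u} [CommRing A] [CommRing B]

/-- Induction on forms by left multiplication with functions and exact one-forms. -/
theorem forms_induction_left {P : Forms A → Prop} (h1 : P 1)
    (hadd : ∀ x y, P x → P y → P (x + y)) (hs : ∀ (a : A) x, P x → P (a • x))
    (hd : ∀ (a : A) x, P x → P (dElem A a * x)) (ω : Forms A) : P ω := by
  have key : ∀ ω : Forms A, ∀ x, P x → P (ω * x) := fun ω => by
    induction ω using forms_induction with
    | hc a => intro x hx; rw [← Algebra.smul_def]; exact hs a x hx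
    | hd a => exact hd a
    | hadd y z hy hz => intro x hx; rw [add_mul]; exact hadd _ _ (hy x hx) (hz x hx)
    | hmul y z hy hz => intro x hx; rw [mul_assoc]; exact hy _ (hz x hx)
  simpa using key ω 1 h1

theorem extD_one : extD A (1 : Forms A) = 0 := by
  rw [← map_one (algebraMap A _), extD_algebraMap, dElem_one]

theorem extD_extD (ω : Forms A) : extD A (extD A ω) = 0 := by
  induction ω using forms_induction_left with
  | h1 => rw [extD_one, map_zero]
  | hadd x y hx hy => rw [map_add, map_add, hx, hy, add_zero]
  | hs a x hx => rw [extD_smul, map_add, extD_dElem_mul, extD_smul, hx]; simp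
  | hd a x hx => rw [extD_dElem_mul, map_neg, extD_dElem_mul, hx]; simp

theorem mapForms_smul (f : A →+* B) (a : A) (ω : Forms A) :
    mapForms f (a • ω) = f a • mapForms f ω := by
  rw [Algebra.smul_def, map_mul, mapForms_algebraMap, Algebra.smul_def]

theorem mapForms_dElem_mul (f : A →+* B) (a : A) (ω : Forms A) :
    mapForms f (dElem A a * ω) = dElem B (f a) * mapForms f ω := by
  rw [map_mul, mapForms_dElem]

theorem mapForms_surjective {f : A →+* B} (hf : Function.Surjective f) :
    Function.Surjective (mapForms f) := by
  intro ω
  induction ω using forms_induction with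
  | hc b => obtain ⟨a, rfl⟩ := hf b; exact ⟨_, mapForms_algebraMap f a⟩
  | hd b => obtain ⟨a, rfl⟩ := hf b; exact ⟨_, mapForms_dElem f a⟩
  | hadd x y hx hy =>
    obtain ⟨x, rfl⟩ := hx; obtain ⟨y, rfl⟩ := hy; exact ⟨x + y, map_add _ _ _⟩
  | hmul x y hx hy =>
    obtain ⟨x, rfl⟩ := hx; obtain ⟨y, rfl⟩ := hy; exact ⟨x * y, map_mul _ _ _⟩

/-- The differential ideal of forms generated by a function `f`. -/
def formsIdeal (f : A) : Ideal (Forms A) where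
  carrier := {ω | ∃ α β, ω = f • α + dElem A f * β}
  add_mem' := by
    rintro _ _ ⟨α, β, rfl⟩ ⟨α', β', rfl⟩
    exact ⟨α + α', β + β', by rw [smul_add, mul_add]; abel⟩
  zero_mem' := ⟨0, 0, by simp⟩
  smul_mem' := by
    intro c x
    induction c using forms_induction generalizing x with
    | hc a =>
      rintro ⟨α, β, rfl⟩
      refine ⟨a • α, a • β, ?_⟩
      rw [smul_eq_mul, ← Algebra.smul_def, smul_add, smul_comm a f, mul_smul_comm]
    | hd a =>
      rintro ⟨α, β, rfl⟩
      refine ⟨dElem A a * α, -(dElem A a * β), ?_⟩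
      rw [smul_eq_mul, mul_add, mul_smul_comm, ← mul_assoc, dElem_swap A a f, mul_neg, neg_mul,
        mul_assoc]
    | hadd y z hy hz =>
      intro hx
      obtain ⟨α, β, h⟩ := hy hx
      obtain ⟨α', β', h'⟩ := hz hx
      refine ⟨α + α', β + β', ?_⟩
      rw [add_smul, h, h', smul_add, mul_add]
      abel
    | hmul y z hy hz => intro hx; rw [smul_eq_mul, mul_assoc]; exact hy (hz hx)

theorem smul_mem_formsIdeal (f : A) (ω : Forms A) : f • ω ∈ formsIdeal f := ⟨ω, 0, by simp⟩

instance (f : A) : (formsIdeal f).IsTwoSided where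
  mul_mem_of_left := by
    rintro _ c ⟨α, β, rfl⟩
    exact ⟨α * c, β * c, by rw [add_mul, smul_mul_assoc, mul_assoc]⟩

theorem extD_mem_formsIdeal {f : A} {ω : Forms A} (h : ω ∈ formsIdeal f) :
    extD A ω ∈ formsIdeal f := by
  obtain ⟨α, β, rfl⟩ := h
  refine ⟨extD A α, α - extD A β, ?_⟩
  rw [map_add, extD_smul, extD_dElem_mul, mul_sub]
  abel

/-- The exact forms in the differential ideal generated by `f` are the `d(f η)`. -/
theorem exists_extD_smul {f : A} {ω : Forms A} (h : ω ∈ formsIdeal f) :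
    ∃ η, extD A ω = extD A (f • η) := by
  obtain ⟨α, β, rfl⟩ := h
  -- Indeed df∧β = d(fβ) - f dβ, and d(fβ) is closed.
  refine ⟨α - extD A β, ?_⟩
  rw [map_add, extD_dElem_mul, extD_smul, extD_smul, map_sub, extD_extD, sub_zero, mul_sub]
  abel

/-- The kernel of `Ω_A → Ω_{A/f}`. -/
theorem mem_formsIdeal_of_mapForms_eq_zero {π : A →+* B} (hπ : Function.Surjective π) {f : A}
    (hf : RingHom.ker π = Ideal.span {f}) {ω : Forms A} (h : mapForms π ω = 0) :
    ω ∈ formsIdeal f := by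
  -- The ideal is two-sided and stable under d, so functions and differentials of B map to the
  -- quotient. The universal property of the forms on B then gives θ with θ ∘ `mapForms π` = q,
  -- which bounds the kernel.
  let q : Forms A →+* Forms A ⧸ formsIdeal f := Ideal.Quotient.mk (formsIdeal f)
  have q_eq : ∀ {x}, q x = 0 ↔ x ∈ formsIdeal f := Ideal.Quotient.eq_zero_iff_mem
  have ker_eq : ∀ {a}, π a = 0 → ∃ c, a = f * c := fun {a} ha => by
    have : a ∈ Ideal.span {f} := hf ▸ ha
    exact Ideal.mem_span_singleton.1 this
  let s : B →+* Forms A ⧸ formsIdeal f := π.liftOfSurjective hπ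
    ⟨q.comp (algebraMap A (Forms A)), fun a ha => by
      obtain ⟨c, rfl⟩ := ker_eq ha
      refine q_eq.2 ?_
      rw [map_mul, ← Algebra.smul_def]
      exact smul_mem_formsIdeal _ _⟩
  have s_apply : ∀ a, s (π a) = q (algebraMap A _ a) := fun a =>
    π.liftOfRightInverse_comp_apply _ _ ⟨q.comp (algebraMap A (Forms A)), _⟩ a
  let _ : Algebra B (Forms A ⧸ formsIdeal f) := RingHom.toAlgebra' s (fun b x => by
    obtain ⟨a, rfl⟩ := hπ b
    obtain ⟨x, rfl⟩ := Ideal.Quotient.mk_surjective x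
    rw [s_apply]
    change q _ * q x = q x * q _
    rw [← map_mul, ← map_mul, Algebra.commutes])
  have smul_q : ∀ (a : A) (x : Forms A), π a • q x = q (a • x) := fun a x => by
    rw [Algebra.smul_def, Algebra.smul_def, map_mul]
    congr 1
    exact s_apply a
  let d : B →+ Forms A ⧸ formsIdeal f := π.toAddMonoidHom.liftOfSurjective hπ
    ⟨q.toAddMonoidHom.comp (dElem A), fun a ha => by
      obtain ⟨c, rfl⟩ := ker_eq ha
      refine q_eq.2 ⟨dElem A c, algebraMap A _ c, ?_⟩
      rw [dElem_mul, ← Algebra.commutes, Algebra.smul_def c]⟩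
  have d_apply : ∀ a, d (π a) = q (dElem A a) := fun a =>
    π.toAddMonoidHom.liftOfRightInverse_comp_apply _ _ ⟨q.toAddMonoidHom.comp (dElem A), _⟩ a
  let D : Derivation ℤ B (Forms A ⧸ formsIdeal f) := Derivation.mk' d.toIntLinearMap (fun b b' => by
    obtain ⟨a, rfl⟩ := hπ b
    obtain ⟨a', rfl⟩ := hπ b'
    change d (π a * π a') = π a • d (π a') + π a' • d (π a)
    rw [← map_mul, d_apply, d_apply, d_apply, smul_q, smul_q, dElem_mul, map_add])
  have lift : ∀ y, ∃ x : Ω[A⁄ℤ], D.liftKaehlerDifferential y = q (ExteriorAlgebra.ι A x) := by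
    intro y
    induction y using kaehler_induction with
    | hd b =>
      obtain ⟨a, rfl⟩ := hπ b
      refine ⟨KaehlerDifferential.D ℤ A a, ?_⟩
      rw [Derivation.liftKaehlerDifferential_comp_D]
      exact d_apply a
    | h0 => exact ⟨0, by simp⟩
    | hadd y z hy hz =>
      obtain ⟨x, hx⟩ := hy
      obtain ⟨x', hx'⟩ := hz
      exact ⟨x + x', by rw [map_add, hx, hx', map_add, map_add]⟩
    | hs b y hy =>
      obtain ⟨x, hx⟩ := hy
      obtain ⟨a, rfl⟩ := hπ b
      exact ⟨a • x, by rw [map_smul, hx, smul_q, LinearMap.map_smul (ExteriorAlgebra.ι A)]⟩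
  have hsq : ∀ y, D.liftKaehlerDifferential y * D.liftKaehlerDifferential y = 0 := fun y => by
    obtain ⟨x, hx⟩ := lift y
    rw [hx, ← map_mul, ExteriorAlgebra.ι_sq_zero, map_zero]
  let θ : Forms B →ₐ[B] Forms A ⧸ formsIdeal f :=
    ExteriorAlgebra.lift B ⟨D.liftKaehlerDifferential, hsq⟩
  have hθ : ∀ ω, θ (mapForms π ω) = q ω := by
    intro ω
    induction ω using forms_induction with
    | hc a => rw [mapForms_algebraMap, AlgHom.commutes]; exact s_apply a
    | hd a =>
      rw [mapForms_dElem, dElem_apply]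
      refine (ExteriorAlgebra.lift_ι_apply B D.liftKaehlerDifferential hsq _).trans ?_
      rw [Derivation.liftKaehlerDifferential_comp_D]
      exact d_apply a
    | hadd x y hx hy => rw [map_add, map_add, hx, hy, map_add]
    | hmul x y hx hy => rw [map_mul, map_mul, hx, hy, map_mul]
  rw [← q_eq, ← hθ, h, map_zero]

/-- The component of degree `r` of a form. -/
def formsProj (r : ℕ) : Forms A →+ Forms A :=
  GradedRing.proj (fun i : ℕ => ⋀[A]^i Ω[A⁄ℤ]) r

theorem formsProj_mem (r : ℕ) (ω : Forms A) : formsProj r ω ∈ ⋀[A]^r Ω[A⁄ℤ] :=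
  (DirectSum.decompose (fun i : ℕ => ⋀[A]^i Ω[A⁄ℤ]) ω r).2

theorem formsProj_of_mem {r : ℕ} {ω : Forms A} (h : ω ∈ ⋀[A]^r Ω[A⁄ℤ]) : formsProj r ω = ω :=
  DirectSum.decompose_of_mem_same (fun i : ℕ => ⋀[A]^i Ω[A⁄ℤ]) h

theorem formsProj_of_mem_ne {r s : ℕ} {ω : Forms A} (h : ω ∈ ⋀[A]^r Ω[A⁄ℤ]) (hrs : r ≠ s) :
    formsProj s ω = 0 :=
  DirectSum.decompose_of_mem_ne (fun i : ℕ => ⋀[A]^i Ω[A⁄ℤ]) h hrs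

theorem forms_homogeneous_induction {P : Forms A → Prop} (h0 : P 0)
    (hadd : ∀ x y, P x → P y → P (x + y)) (hh : ∀ (r : ℕ) (ω), ω ∈ ⋀[A]^r Ω[A⁄ℤ] → P ω)
    (ω : Forms A) : P ω :=
  DirectSum.Decomposition.inductionOn (fun i : ℕ => ⋀[A]^i Ω[A⁄ℤ]) h0
    (fun {i} m => hh i m m.2) hadd ω

theorem formsProj_map {k : ℕ} (F : Forms A →+ Forms B)
    (hF : ∀ (r : ℕ) (ω), ω ∈ ⋀[A]^r Ω[A⁄ℤ] → F ω ∈ ⋀[B]^(r + k) Ω[B⁄ℤ]) (r : ℕ) (ω : Forms A) :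
    formsProj (r + k) (F ω) = F (formsProj r ω) := by
  induction ω using forms_homogeneous_induction with
  | h0 => simp
  | hadd x y hx hy => simp only [map_add, hx, hy]
  | hh s ω h =>
    by_cases hrs : s = r
    · subst hrs
      rw [formsProj_of_mem h, formsProj_of_mem (hF s ω h)]
    · rw [formsProj_of_mem_ne h hrs, formsProj_of_mem_ne (hF s ω h) (by omega), map_zero]

theorem formsProj_extD (r : ℕ) (ω : Forms A) :
    formsProj (r + 1) (extD A ω) = extD A (formsProj r ω) :=
  formsProj_map (extD A) (fun _ _ h => extD_mem A h) r ω

theorem formsProj_zero_extD (ω : Forms A) : formsProj 0 (extD A ω) = 0 := by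
  induction ω using forms_homogeneous_induction with
  | h0 => simp
  | hadd x y hx hy => simp only [map_add, hx, hy, add_zero]
  | hh s ω h => exact formsProj_of_mem_ne (extD_mem A h) (by omega)

theorem formsProj_mapForms (f : A →+* B) (r : ℕ) (ω : Forms A) :
    formsProj r (mapForms f ω) = mapForms f (formsProj r ω) :=
  formsProj_map (k := 0) (mapForms f).toAddMonoidHom (fun _ _ h => mapForms_mem f h) r ω

theorem formsProj_smul (r : ℕ) (a : A) (ω : Forms A) :
    formsProj r (a • ω) = a • formsProj r ω :=
  formsProj_map (k := 0) (DistribSMul.toAddMonoidHom (Forms A) a)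
    (fun _ _ h => Submodule.smul_mem _ a h) r ω

/-- Contraction of forms with a derivation of `A`. -/
def contr (E : Derivation ℤ A A) : Forms A →ₗ[A] Forms A :=
  CliffordAlgebra.contractLeft (E.liftKaehlerDifferential : Module.Dual A Ω[A⁄ℤ])

theorem contr_dElem_mul (E : Derivation ℤ A A) (a : A) (ω : Forms A) :
    contr E (dElem A a * ω) = E a • ω - dElem A a * contr E ω := by
  have := CliffordAlgebra.contractLeft_ι_mul (Q := (0 : QuadraticForm A Ω[A⁄ℤ]))
    (d := E.liftKaehlerDifferential) (KaehlerDifferential.D ℤ A a) ω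
  rw [Derivation.liftKaehlerDifferential_comp_D] at this
  exact this

theorem contr_one (E : Derivation ℤ A A) : contr E (1 : Forms A) = 0 :=
  CliffordAlgebra.contractLeft_one (Q := (0 : QuadraticForm A Ω[A⁄ℤ])) E.liftKaehlerDifferential

/-- The Lie derivative of forms along a derivation of `A`. -/
def lie (E : Derivation ℤ A A) : Forms A →ₗ[ℤ] Forms A :=
  ((extD A).comp (contr E).toAddMonoidHom + (contr E).toAddMonoidHom.comp (extD A)).toIntLinearMap

theorem lie_apply (E : Derivation ℤ A A) (ω : Forms A) :
    lie E ω = extD A (contr E ω) + contr E (extD A ω) := rfl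

theorem lie_smul (E : Derivation ℤ A A) (a : A) (ω : Forms A) :
    lie E (a • ω) = E a • ω + a • lie E ω := by
  rw [lie_apply, lie_apply, map_smul, extD_smul, extD_smul, map_add, contr_dElem_mul, map_smul,
    smul_add]
  abel

theorem lie_dElem_mul (E : Derivation ℤ A A) (a : A) (ω : Forms A) :
    lie E (dElem A a * ω) = dElem A (E a) * ω + dElem A a * lie E ω := by
  rw [lie_apply, lie_apply, contr_dElem_mul, extD_dElem_mul, map_sub, extD_smul, extD_dElem_mul,
    map_neg, contr_dElem_mul, mul_add]
  abel

/-- The hypothesis says that E preserves the ideal (f). It holds for the Euler field and f = t^m,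
and keeps the primitive in the Poincaré lemma inside the ideal. -/
theorem lie_mem_formsIdeal (E : Derivation ℤ A A) {f : A} (hE : ∃ c : A, E f = c * f) {ω : Forms A}
    (h : ω ∈ formsIdeal f) : contr E ω ∈ formsIdeal f ∧ lie E ω ∈ formsIdeal f := by
  have key : ∀ ω ∈ formsIdeal f, contr E ω ∈ formsIdeal f := by
    rintro _ ⟨α, β, rfl⟩
    obtain ⟨c, hc⟩ := hE
    refine ⟨contr E α + c • β, -contr E β, ?_⟩
    rw [map_add, map_smul, contr_dElem_mul, hc, smul_add, smul_smul, mul_comm c f, mul_neg]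
    abel
  exact ⟨key ω h, add_mem (extD_mem_formsIdeal (key ω h)) (key _ (extD_mem_formsIdeal h))⟩

end generalForms

end

end MilnorDlog

namespace MilnorDlog

noncomputable section

open scoped Polynomial TensorProduct

/-! ### Truncated polynomial rings and the Poincaré lemma -/

section truncated

/-- A presentation of `A` as the truncated polynomial ring `R[t]/(t^n)`. -/
structure TruncData (R A : Type u) [CommRing R] [CommRing A] (t : A) (n : ℕ) where
  toHom : R[X] →+* A
  surj : Function.Surjective toHom
  ker_eq : RingHom.ker toHom = Ideal.span {Polynomial.X ^ n}
  map_X : toHom Polynomial.X = t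

namespace TruncData

variable {R A B : Type u} [CommRing R] [CommRing A] [CommRing B] {t : A} {n : ℕ}
  (T : TruncData R A t n)

theorem hom_eq_zero_iff {p : R[X]} : T.toHom p = 0 ↔ Polynomial.X ^ n ∣ p := by
  rw [← RingHom.mem_ker, T.ker_eq, Ideal.mem_span_singleton]

include T in
theorem pow_eq_zero : t ^ n = 0 := by
  rw [← T.map_X, ← map_pow, T.hom_eq_zero_iff]

/-- The inclusion of constants. -/
def const : R →+* A := T.toHom.comp Polynomial.C

theorem hom_monomial (k : ℕ) (r : R) : T.toHom (Polynomial.monomial k r) = T.const r * t ^ k := by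
  rw [← Polynomial.C_mul_X_pow_eq_monomial, map_mul, map_pow, T.map_X]; rfl

/-- Evaluation at `t = 0`. -/
def ev (hn : 1 ≤ n) : A →+* R :=
  T.toHom.liftOfSurjective T.surj ⟨Polynomial.constantCoeff, fun p hp => by
    obtain ⟨q, rfl⟩ := T.hom_eq_zero_iff.1 hp
    change Polynomial.constantCoeff _ = 0
    rw [map_mul, map_pow, Polynomial.constantCoeff_apply, Polynomial.coeff_X_zero,
      zero_pow (by omega), zero_mul]⟩

theorem ev_hom (hn : 1 ≤ n) (p : R[X]) : T.ev hn (T.toHom p) = p.coeff 0 :=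
  T.toHom.liftOfRightInverse_comp_apply _ _ ⟨Polynomial.constantCoeff, _⟩ p

theorem ev_const (hn : 1 ≤ n) (r : R) : T.ev hn (T.const r) = r := by
  change T.ev hn (T.toHom _) = _
  rw [ev_hom, Polynomial.coeff_C_zero]

theorem ev_t (hn : 1 ≤ n) : T.ev hn t = 0 := by
  have := T.ev_hom hn Polynomial.X
  rwa [T.map_X, Polynomial.coeff_X_zero] at this

/-- The presentation induced on the quotient by `t^m`. -/
def quot (π : A →+* B) (hπ : Function.Surjective π) {m : ℕ} (hm : m ≤ n)
    (hk : RingHom.ker π = Ideal.span {t ^ m}) : TruncData R B (π t) m where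
  toHom := π.comp T.toHom
  surj := hπ.comp T.surj
  ker_eq := by
    ext p
    rw [RingHom.mem_ker, RingHom.comp_apply, ← RingHom.mem_ker, hk, Ideal.mem_span_singleton,
      Ideal.mem_span_singleton]
    constructor
    · rintro ⟨a, ha⟩
      obtain ⟨q, rfl⟩ := T.surj a
      have h : T.toHom (p - Polynomial.X ^ m * q) = 0 := by
        rw [map_sub, map_mul, map_pow, T.map_X, ha, sub_self]
      have := (pow_dvd_pow Polynomial.X hm).trans (T.hom_eq_zero_iff.1 h)
      simpa using dvd_add this (dvd_mul_right _ q)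
    · rintro ⟨q, rfl⟩
      exact ⟨T.toHom q, by rw [map_mul, map_pow, T.map_X]⟩
  map_X := by rw [RingHom.comp_apply, T.map_X]

/-- The derivation d/dt does not preserve the ideal (t^n), but t d/dt does. -/
theorem hom_X_mul_derivative_eq_zero {p : R[X]} (hp : T.toHom p = 0) :
    T.toHom (Polynomial.X * Polynomial.derivative p) = 0 := by
  obtain ⟨q, rfl⟩ := T.hom_eq_zero_iff.1 hp
  rw [T.hom_eq_zero_iff, Polynomial.derivative_mul, Polynomial.derivative_X_pow]
  rcases Nat.eq_zero_or_pos n with rfl | hn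
  · simp
  · refine ⟨(n : R[X]) * q + Polynomial.X * Polynomial.derivative q, ?_⟩
    obtain ⟨k, rfl⟩ := Nat.exists_eq_add_of_le hn
    simp only [Nat.add_sub_cancel_left, map_natCast]
    ring

/-- The Euler derivation `t ∂/∂t`. -/
def euler : Derivation ℤ A A :=
  Derivation.liftOfSurjective (f := T.toHom.toIntAlgHom) (d := (Polynomial.X : R[X]) •
    (Polynomial.derivative' (R := R)).restrictScalars ℤ) T.surj
    (fun _ => T.hom_X_mul_derivative_eq_zero)

theorem euler_hom (p : R[X]) :
    T.euler (T.toHom p) = T.toHom (Polynomial.X * Polynomial.derivative p) :=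
  Derivation.liftOfSurjective_apply (f := T.toHom.toIntAlgHom) (d := (Polynomial.X : R[X]) •
    (Polynomial.derivative' (R := R)).restrictScalars ℤ) T.surj
    (fun _ => T.hom_X_mul_derivative_eq_zero) p

theorem euler_t : T.euler t = t := by
  have := T.euler_hom Polynomial.X
  rwa [Polynomial.derivative_X, mul_one, T.map_X] at this

theorem euler_const (r : R) : T.euler (T.const r) = 0 := by
  change T.euler (T.toHom _) = _
  rw [euler_hom, Polynomial.derivative_C, mul_zero, map_zero]

theorem euler_t_pow (k : ℕ) : T.euler (t ^ k) = (k : A) * t ^ k := by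
  rw [Derivation.leibniz_pow, euler_t]
  cases k with
  | zero => simp
  | succ k => rw [Nat.add_sub_cancel, smul_eq_mul, ← pow_succ, nsmul_eq_mul]

theorem hom_induction {P : A → Prop} (hc : ∀ r, P (T.const r)) (ht : P t)
    (hadd : ∀ a b, P a → P b → P (a + b)) (hmul : ∀ a b, P a → P b → P (a * b)) (a : A) : P a := by
  obtain ⟨p, rfl⟩ := T.surj a
  induction p using Polynomial.induction_on with
  | C r => exact hc r
  | add p q hp hq => rw [map_add]; exact hadd _ _ hp hq
  | monomial k r h =>
    rw [pow_succ, ← mul_assoc, map_mul, T.map_X]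
    exact hmul _ _ h ht

/-- The homogeneous forms `t^i α` and `t^i dt ∧ α` for `α` a form over `R`. -/
def homogeneousForms : AddSubgroup (Forms A) :=
  AddSubgroup.closure ({ω | ∃ (i : ℕ) (α : Forms R), ω = t ^ i • mapForms T.const α} ∪
    {ω | ∃ (i : ℕ) (α : Forms R), ω = t ^ i • (dElem A t * mapForms T.const α)})

/-- Stability under functions and exact one-forms shows that the homogeneous forms exhaust `Forms
A`, so every form is a sum of eigenvectors of the Lie derivative. -/
theorem homogeneousForms_stable (a : A) : ∀ ω ∈ T.homogeneousForms,
    a • ω ∈ T.homogeneousForms ∧ dElem A a * ω ∈ T.homogeneousForms := by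
  have gen1 : ∀ (i : ℕ) (α : Forms R), t ^ i • mapForms T.const α ∈ T.homogeneousForms :=
    fun i α => AddSubgroup.subset_closure (Or.inl ⟨i, α, rfl⟩)
  have gen2 : ∀ (i : ℕ) (α : Forms R),
      t ^ i • (dElem A t * mapForms T.const α) ∈ T.homogeneousForms :=
    fun i α => AddSubgroup.subset_closure (Or.inr ⟨i, α, rfl⟩)
  have clos : ∀ F : Forms A →+ Forms A,
      (∀ i α, F (t ^ i • mapForms T.const α) ∈ T.homogeneousForms) →
      (∀ i α, F (t ^ i • (dElem A t * mapForms T.const α)) ∈ T.homogeneousForms) →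
      ∀ ω ∈ T.homogeneousForms, F ω ∈ T.homogeneousForms := by
    intro F h1 h2 ω hω
    have : T.homogeneousForms ≤ T.homogeneousForms.comap F := by
      refine (AddSubgroup.closure_le _).2 ?_
      rintro _ (⟨i, α, rfl⟩ | ⟨i, α, rfl⟩)
      exacts [h1 i α, h2 i α]
    exact this hω
  induction a using T.hom_induction with
  | hc r =>
    refine fun ω hω => ⟨clos (DistribSMul.toAddMonoidHom (Forms A) (T.const r)) (fun i α => ?_)
      (fun i α => ?_) ω hω, clos (AddMonoidHom.mulLeft (dElem A (T.const r))) (fun i α => ?_)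
      (fun i α => ?_) ω hω⟩
    · rw [DistribSMul.toAddMonoidHom_apply, smul_comm, ← mapForms_smul]
      exact gen1 i _
    · rw [DistribSMul.toAddMonoidHom_apply, smul_comm, ← mul_smul_comm, ← mapForms_smul]
      exact gen2 i _
    · rw [AddMonoidHom.coe_mulLeft, mul_smul_comm, ← mapForms_dElem_mul]
      exact gen1 i _
    · rw [AddMonoidHom.coe_mulLeft, mul_smul_comm, ← mul_assoc, dElem_swap, neg_mul, mul_assoc,
        ← mapForms_dElem_mul, smul_neg]
      exact neg_mem (gen2 i _)
  | ht =>
    refine fun ω hω => ⟨clos (DistribSMul.toAddMonoidHom (Forms A) t) (fun i α => ?_)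
      (fun i α => ?_) ω hω, clos (AddMonoidHom.mulLeft (dElem A t)) (fun i α => ?_)
      (fun i α => ?_) ω hω⟩
    · rw [DistribSMul.toAddMonoidHom_apply, smul_smul, ← pow_succ']
      exact gen1 _ _
    · rw [DistribSMul.toAddMonoidHom_apply, smul_smul, ← pow_succ']
      exact gen2 _ _
    · rw [AddMonoidHom.coe_mulLeft, mul_smul_comm]
      exact gen2 _ _
    · rw [AddMonoidHom.coe_mulLeft, mul_smul_comm, ← mul_assoc, dElem_sq, zero_mul, smul_zero]
      exact zero_mem _
  | hadd a b ha hb =>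
    intro ω hω
    rw [add_smul, map_add, add_mul]
    exact ⟨add_mem (ha ω hω).1 (hb ω hω).1, add_mem (ha ω hω).2 (hb ω hω).2⟩
  | hmul a b ha hb =>
    intro ω hω
    rw [mul_smul, dElem_mul, add_mul, smul_mul_assoc, smul_mul_assoc]
    exact ⟨(ha _ (hb ω hω).1).1, add_mem (ha _ (hb ω hω).2).1 (hb _ (ha ω hω).2).1⟩

theorem mem_homogeneousForms (ω : Forms A) : ω ∈ T.homogeneousForms := by
  induction ω using forms_induction_left with
  | h1 => exact AddSubgroup.subset_closure (Or.inl ⟨0, 1, by simp⟩)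
  | hadd x y hx hy => exact add_mem hx hy
  | hs a x hx => exact (T.homogeneousForms_stable a x hx).1
  | hd a x hx => exact (T.homogeneousForms_stable a x hx).2

theorem contr_const_mul (α : Forms R) (ω : Forms A) (h : contr T.euler ω = 0) :
    contr T.euler (mapForms T.const α * ω) = 0 := by
  induction α using forms_induction generalizing ω with
  | hc r => rw [mapForms_algebraMap, ← Algebra.smul_def, map_smul, h, smul_zero]
  | hd r => rw [mapForms_dElem, contr_dElem_mul, euler_const, h, zero_smul, mul_zero, sub_zero]
  | hadd x y hx hy => rw [map_add, add_mul, map_add, hx ω h, hy ω h, add_zero]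
  | hmul x y hx hy => rw [map_mul (mapForms T.const), mul_assoc]; exact hx _ (hy ω h)

theorem contr_const (α : Forms R) : contr T.euler (mapForms T.const α) = 0 := by
  have := T.contr_const_mul α 1 (contr_one _)
  rwa [mul_one] at this

theorem lie_const (α : Forms R) : lie T.euler (mapForms T.const α) = 0 := by
  rw [lie_apply, contr_const, extD_mapForms, contr_const, map_zero, add_zero]

/-- Forms coming from R have weight 0, while t and dt both have weight 1; hence the shift by one in
`lie_gen₂`. -/
theorem lie_gen₁ (i : ℕ) (α : Forms R) : lie T.euler (t ^ i • mapForms T.const α) =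
    (i : ℤ) • (t ^ i • mapForms T.const α) := by
  rw [lie_smul, lie_const, smul_zero, add_zero, euler_t_pow, mul_smul, Nat.cast_smul_eq_nsmul,
    natCast_zsmul]

theorem lie_gen₂ (i : ℕ) (α : Forms R) :
    lie T.euler (t ^ i • (dElem A t * mapForms T.const α)) =
      ((i + 1 : ℕ) : ℤ) • (t ^ i • (dElem A t * mapForms T.const α)) := by
  rw [lie_smul, lie_dElem_mul, lie_const, mul_zero, add_zero, euler_t, euler_t_pow, mul_smul,
    Nat.cast_smul_eq_nsmul, natCast_zsmul, succ_nsmul]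

end TruncData

theorem aeval_eigen {M : Type*} [AddCommGroup M] (f : M →ₗ[ℤ] M) {x : M} {c : ℤ} (h : f x = c • x)
    (p : ℤ[X]) : Polynomial.aeval (R := ℤ) (A := Module.End ℤ M) f p x = p.eval c • x := by
  induction p using Polynomial.induction_on with
  | C a => simp
  | add p q hp hq => rw [map_add, LinearMap.add_apply, hp, hq, Polynomial.eval_add, add_smul]
  | monomial k a hk =>
    rw [pow_succ, ← mul_assoc, map_mul, Polynomial.aeval_X, Module.End.mul_apply, h, map_smul, hk,
      Polynomial.eval_mul_X, smul_smul, mul_comm]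

theorem aeval_mem {M : Type*} [AddCommGroup M] (f : M →ₗ[ℤ] M) (S : AddSubgroup M)
    (h : ∀ x ∈ S, f x ∈ S) (p : ℤ[X]) {x : M} (hx : x ∈ S) :
    Polynomial.aeval (R := ℤ) (A := Module.End ℤ M) f p x ∈ S := by
  induction p using Polynomial.induction_on generalizing x with
  | C a => simpa using S.zsmul_mem hx a
  | add p q hp hq => rw [map_add, LinearMap.add_apply]; exact add_mem (hp hx) (hq hx)
  | monomial k a hk =>
    rw [pow_succ, ← mul_assoc, map_mul, Polynomial.aeval_X, Module.End.mul_apply]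
    exact hk (h x hx)

theorem aeval_comm {M : Type*} [AddCommGroup M] (f : M →ₗ[ℤ] M) (g : M →+ M)
    (h : ∀ x, f (g x) = g (f x)) (p : ℤ[X]) (x : M) :
    Polynomial.aeval (R := ℤ) (A := Module.End ℤ M) f p (g x) =
      g (Polynomial.aeval (R := ℤ) (A := Module.End ℤ M) f p x) := by
  induction p using Polynomial.induction_on generalizing x with
  | C a => simp
  | add p q hp hq => rw [map_add, LinearMap.add_apply, hp, hq, LinearMap.add_apply, map_add]
  | monomial k a hk =>
    rw [pow_succ, ← mul_assoc, map_mul, Polynomial.aeval_X, Module.End.mul_apply, h, hk,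
      Module.End.mul_apply]

theorem dElem_natCast {A : Type u} [CommRing A] (m : ℕ) : dElem A (m : A) = 0 := by
  rw [dElem_apply, D_natCast, map_zero]

theorem dElem_natCast_inv {A : Type u} [CommRing A] {m : ℕ} {c : A} (h : (m : A) * c = 1) :
    dElem A c = 0 := by
  have h1 := dElem_mul A (m : A) c
  rw [h, dElem_one, dElem_natCast, smul_zero, add_zero] at h1
  have h2 := congrArg (c • ·) h1
  simp only [smul_zero, smul_smul] at h2
  rwa [mul_comm, h, one_smul, eq_comm] at h2

/-- From 0 = d(t^n) = n t^{n-1} dt with n invertible. This is where truncated forms in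
characteristic 0 lose their top term. -/
theorem pow_smul_dElem_eq_zero {A : Type u} [CommRing A] (hQ : NatUnits A) {t : A} {n i : ℕ}
    (hn : 1 ≤ n) (ht : t ^ n = 0) (hi : n ≤ i + 1) : t ^ i • dElem A t = 0 := by
  have h : ∀ k : ℕ, dElem A (t ^ (k + 1)) = ((k + 1 : ℕ) : A) • (t ^ k • dElem A t) := by
    intro k
    induction k with
    | zero => simp
    | succ k ih =>
      rw [pow_succ, dElem_mul, ih, smul_smul, smul_smul, smul_smul, ← add_smul]
      congr 1
      push_cast
      ring
  have h1 := h (n - 1)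
  rw [Nat.sub_add_cancel hn, ht, map_zero] at h1
  obtain ⟨c, hc⟩ := (hQ n (by omega)).exists_right_inv
  have h2 : t ^ (n - 1) • dElem A t = 0 := by
    have := congrArg (c • ·) h1
    simp only [smul_zero, smul_smul] at this
    rwa [← mul_assoc, mul_comm c, hc, one_mul, eq_comm] at this
  obtain ⟨j, rfl⟩ := Nat.exists_eq_add_of_le (show n - 1 ≤ i by omega)
  rw [add_comm, pow_add, mul_smul, h2, smul_zero]

namespace TruncData

variable {R A B : Type u} [CommRing R] [CommRing A] [CommRing B] {t : A} {n : ℕ}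
  (T : TruncData R A t n)

/-- The Poincaré lemma for `R[t]/(t^n)`: a closed form `ω` differs from its constant part by an exact
form `dη`, and `η` lies in the differential ideal generated by `t^m` if `ω` does. -/
theorem poincare (hQ : NatUnits A) (hn : 1 ≤ n) {ω : Forms A} (hω : extD A ω = 0) :
    ∃ η, ω = mapForms T.const (mapForms (T.ev hn) ω) + extD A η ∧
      ∀ m, ω ∈ formsIdeal (t ^ m) → η ∈ formsIdeal (t ^ m) := by
  let L := lie T.euler
  -- The roots 1, …, n - 1 are all the nonzero weights that occur, as t^n = 0 and t^{n-1} dt = 0.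
  let p : ℤ[X] := ∏ i ∈ Finset.range (n - 1), (Polynomial.X - Polynomial.C ((i + 1 : ℕ) : ℤ))
  have hp : ∀ i : ℕ, 1 ≤ i → i < n → p.eval (i : ℤ) = 0 := fun i h1 h2 => by
    rw [Polynomial.eval_prod]
    refine Finset.prod_eq_zero (i := i - 1) (Finset.mem_range.2 (by omega)) ?_
    simp [Nat.sub_add_cancel h1]
  -- Only p(0) ≠ 0 matters (it is ±(n-1)!): its absolute value becomes a unit of A.
  obtain ⟨m, hm0, hm⟩ : ∃ m : ℕ, m ≠ 0 ∧ (p.eval 0 = m ∨ p.eval 0 = -m) := by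
    refine ⟨(p.eval 0).natAbs, ?_, Int.natAbs_eq _⟩
    rw [Int.natAbs_ne_zero, Polynomial.eval_prod, Finset.prod_ne_zero_iff]
    intro i _
    rw [Polynomial.eval_sub, Polynomial.eval_X, Polynomial.eval_C]
    omega
  -- `p(L)` is a multiple of the projection to the constant part
  have main : ∀ ω : Forms A, Polynomial.aeval (R := ℤ) (A := Module.End ℤ (Forms A)) L p ω =
      p.eval 0 • mapForms T.const (mapForms (T.ev hn) ω) := by
    intro ω
    have hω := T.mem_homogeneousForms ω
    induction hω using AddSubgroup.closure_induction with
    | mem ω h =>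
      rcases h with ⟨i, α, rfl⟩ | ⟨i, α, rfl⟩
      · rw [aeval_eigen L (T.lie_gen₁ i α), mapForms_smul, map_pow, ev_t, ← mapForms_comp]
        have : (T.ev hn).comp T.const = RingHom.id R := RingHom.ext (T.ev_const hn)
        rw [this, mapForms_id]
        rcases Nat.eq_zero_or_pos i with rfl | hi
        · simp
        · rw [zero_pow (by omega), zero_smul, map_zero, smul_zero]
          rcases lt_or_ge i n with h | h
          · rw [hp i hi h, zero_smul]
          · rw [pow_eq_zero_of_le h T.pow_eq_zero, zero_smul, smul_zero]
      · rw [aeval_eigen L (T.lie_gen₂ i α), mapForms_smul, mapForms_dElem_mul, ev_t, map_zero,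
          zero_mul, smul_zero, map_zero, smul_zero]
        rcases lt_or_ge (i + 1) n with h | h
        · rw [hp (i + 1) (by omega) h, zero_smul]
        · rw [← smul_mul_assoc, pow_smul_dElem_eq_zero hQ hn T.pow_eq_zero h, zero_mul, smul_zero]
    | zero => simp
    | add x y _ _ hx hy => rw [map_add, hx, hy, map_add, map_add, smul_add]
    | neg x _ hx => rw [map_neg, hx, map_neg, map_neg, smul_neg]
  have hcomm : ∀ x, L (extD A x) = extD A (L x) := fun x => by
    simp only [L, lie_apply, extD_extD, map_zero, add_zero, map_add, zero_add]
  -- Write p = p(0) + Xq and ξ = q(L)ω. As ξ is closed, Cartan's formula gives Lξ = d(ι ξ), so p(L)ω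
  -- differs from p(0)ω by an exact form.
  let q := p.divX
  have hpq : p = Polynomial.C (p.eval 0) + Polynomial.X * q := by
    rw [← Polynomial.coeff_zero_eq_eval_zero, add_comm, Polynomial.X_mul_divX_add]
  set ξ := Polynomial.aeval (R := ℤ) (A := Module.End ℤ (Forms A)) L q ω with hξ
  have hξ0 : extD A ξ = 0 := by
    rw [hξ, ← aeval_comm L (extD A) hcomm, hω, map_zero]
  have e := main ω
  have e' : Polynomial.aeval (R := ℤ) (A := Module.End ℤ (Forms A)) L p ω =
      p.eval 0 • ω + extD A (contr T.euler ξ) := by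
    rw [hpq, map_add, map_mul, Polynomial.aeval_X, Polynomial.aeval_C, LinearMap.add_apply,
      Module.End.mul_apply, ← hξ, ← hpq]
    congr 1
    simp only [L, lie_apply, hξ0, map_zero, add_zero]
  rw [e'] at e
  have hmem : ∀ m, ω ∈ formsIdeal (t ^ m) → contr T.euler ξ ∈ formsIdeal (t ^ m) := by
    intro m h
    have hE : ∃ c : A, T.euler (t ^ m) = c * t ^ m := ⟨m, T.euler_t_pow m⟩
    exact (lie_mem_formsIdeal T.euler hE (aeval_mem L (formsIdeal (t ^ m)).toAddSubgroup
      (fun x hx => (lie_mem_formsIdeal T.euler hE hx).2) q h)).1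
  obtain ⟨c, hc⟩ := (hQ m hm0).exists_right_inv
  -- Division by m commutes with d because d(1/m) = 0.
  have hdc := dElem_natCast_inv hc
  have div : ∀ ε x : Forms A, (m : ℤ) • ω + extD A x = (m : ℤ) • ε →
      ω = ε + extD A (-(c • x)) := by
    intro ε x h
    have h2 := congrArg (c • ·) h
    simp only [smul_add, natCast_zsmul, ← Nat.cast_smul_eq_nsmul A, smul_smul] at h2
    rw [mul_comm c, hc, one_smul, one_smul] at h2
    rw [map_neg, extD_smul, hdc, zero_mul, zero_add, ← h2]
    abel
  have smul_mem : ∀ (f : A) (x : Forms A), x ∈ formsIdeal f → c • x ∈ formsIdeal f :=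
    fun f x hx => by
      rw [Algebra.smul_def]; exact (formsIdeal f).mul_mem_left _ hx
  rcases hm with hm | hm
  · rw [hm] at e
    exact ⟨_, div _ _ e, fun k hk => neg_mem (smul_mem _ _ (hmem k hk))⟩
  · rw [hm] at e
    refine ⟨_, div _ (-contr T.euler ξ) ?_, fun k hk => neg_mem (smul_mem _ _ (neg_mem (hmem k hk)))⟩
    rw [map_neg]
    linear_combination (norm := module) -e

theorem mapForms_ev_eq_zero (hn : 1 ≤ n) {m : ℕ} (hm : 1 ≤ m) {ω : Forms A}
    (h : ω ∈ formsIdeal (t ^ m)) : mapForms (T.ev hn) ω = 0 := by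
  obtain ⟨α, β, rfl⟩ := h
  rw [map_add, mapForms_smul, mapForms_dElem_mul, map_pow, ev_t, zero_pow (by omega), map_zero,
    zero_smul, zero_mul, add_zero]

variable (hQ : NatUnits A) (π : A →+* B) (hπ : Function.Surjective π) {m : ℕ} (hm : 1 ≤ m)
  (hmn : m ≤ n) (hk : RingHom.ker π = Ideal.span {t ^ m})
include T hQ hπ hm hmn hk

/-- A closed form on `R[t]/(t^n)` which restricts to zero modulo `t^m` is of the form `d(t^m η)`. -/
theorem exists_eq_extD_smul {ω : Forms A} (hω : extD A ω = 0) (h : mapForms π ω = 0) :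
    ∃ η, ω = extD A (t ^ m • η) := by
  have hI := mem_formsIdeal_of_mapForms_eq_zero hπ hk h
  obtain ⟨η, h1, h2⟩ := T.poincare hQ (hm.trans hmn) hω
  rw [T.mapForms_ev_eq_zero _ hm hI, map_zero, zero_add] at h1
  obtain ⟨η', h3⟩ := exists_extD_smul (h2 m hI)
  exact ⟨η', h1.trans h3⟩

/-- Closed forms lift from `R[t]/(t^m)` to `R[t]/(t^n)`. -/
theorem exists_closed_lift {ω : Forms B} (hω : extD B ω = 0) :
    ∃ ω' : Forms A, extD A ω' = 0 ∧ mapForms π ω' = ω := by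
  let T' := T.quot π hπ hmn hk
  obtain ⟨η, h1, -⟩ := T'.poincare (hQ.map π) hm hω
  obtain ⟨η, rfl⟩ := mapForms_surjective hπ η
  -- The constant part lifts through the inclusion of R, the exact part by lifting its primitive;
  -- both lifts are closed.
  refine ⟨mapForms T.const (mapForms (T'.ev hm) ω) + extD A η, ?_, ?_⟩
  · rw [map_add, extD_extD, extD_mapForms, extD_mapForms, hω, map_zero, map_zero, add_zero]
  · rw [map_add, ← extD_mapForms, ← mapForms_comp π T.const]
    exact h1.symm

end TruncData

end truncated

end

end MilnorDlog

namespace MilnorDlog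

noncomputable section

open scoped Polynomial TensorProduct

/-! ### The kernel of η ↦ d(t^{n-1}η) -/

namespace TruncData

variable {R A : Type u} [CommRing R] [CommRing A] {t : A} {n : ℕ} (T : TruncData R A t n)

theorem ker_ev (hn : 1 ≤ n) : RingHom.ker (T.ev hn) = Ideal.span {t} := by
  ext a
  obtain ⟨p, rfl⟩ := T.surj a
  rw [RingHom.mem_ker, ev_hom, ← Polynomial.X_dvd_iff, Ideal.mem_span_singleton]
  constructor
  · rintro ⟨q, rfl⟩
    exact ⟨T.toHom q, by rw [map_mul, T.map_X]⟩
  · rintro ⟨a, ha⟩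
    obtain ⟨q, rfl⟩ := T.surj a
    have h : T.toHom (p - Polynomial.X * q) = 0 := by rw [map_sub, map_mul, T.map_X, ha, sub_self]
    have := (dvd_pow_self Polynomial.X (by omega)).trans (T.hom_eq_zero_iff.1 h)
    simpa using dvd_add this (dvd_mul_right _ q)

theorem ev_surjective (hn : 1 ≤ n) : Function.Surjective (T.ev hn) :=
  fun r => ⟨T.const r, T.ev_const hn r⟩

/-- The coefficient of `t^k`, for `k < n`. -/
def coeff (k : ℕ) (hk : k < n) : A →+ R :=
  T.toHom.toAddMonoidHom.liftOfSurjective T.surj ⟨(Polynomial.lcoeff R k).toAddMonoidHom,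
    fun _ hp => (Polynomial.X_pow_dvd_iff.1 (T.hom_eq_zero_iff.1 hp)) k hk⟩

theorem coeff_hom (k : ℕ) (hk : k < n) (p : R[X]) : T.coeff k hk (T.toHom p) = p.coeff k :=
  T.toHom.toAddMonoidHom.liftOfRightInverse_comp_apply _ _
    ⟨(Polynomial.lcoeff R k).toAddMonoidHom, _⟩ p

/-- The forms on `R[t]/(t^n)` map to the forms on `R` with coefficients in `R[t]/(t^n)`. -/
theorem exists_relative_hom : let _ := T.const.toAlgebra
    ∃ Ψ : Forms A →+* A ⊗[R] Forms R, (∀ a, Ψ (algebraMap A _ a) = a ⊗ₜ 1) ∧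
      ∀ α, Ψ (mapForms T.const α) = 1 ⊗ₜ α := by
  let _ := T.const.toAlgebra
  have alg : ∀ r : R, algebraMap R A r = T.const r := fun _ => rfl
  -- Differentiate the coefficients only, treating t as a constant.
  let g : R[X] →+ A ⊗[R] Ω[R⁄ℤ] := (Polynomial.lsum (R := ℤ) fun i =>
    (TensorProduct.mk R A Ω[R⁄ℤ] (t ^ i)).restrictScalars ℤ ∘ₗ
      (KaehlerDifferential.D ℤ R : R →ₗ[ℤ] Ω[R⁄ℤ])).toAddMonoidHom
  have g_mon : ∀ i r, g (Polynomial.monomial i r) = (t ^ i) ⊗ₜ KaehlerDifferential.D ℤ R r := by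
    intro i r
    change Polynomial.sum _ _ = _
    rw [Polynomial.sum_monomial_index _ _ (by simp)]
    rfl
  have g_ker : ∀ p, T.toHom p = 0 → g p = 0 := by
    intro p hp
    obtain ⟨q, rfl⟩ := T.hom_eq_zero_iff.1 hp
    clear hp
    induction q using Polynomial.induction_on' with
    | add p q hp hq => rw [mul_add, map_add, hp, hq, add_zero]
    | monomial k r =>
      rw [Polynomial.X_pow_eq_monomial, Polynomial.monomial_mul_monomial, g_mon, pow_add,
        T.pow_eq_zero, zero_mul, TensorProduct.zero_tmul]
  let d : A →+ A ⊗[R] Ω[R⁄ℤ] := T.toHom.toAddMonoidHom.liftOfSurjective T.surj ⟨g, g_ker⟩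
  have d_hom : ∀ p, d (T.toHom p) = g p := fun p =>
    T.toHom.toAddMonoidHom.liftOfRightInverse_comp_apply _ _ ⟨g, _⟩ p
  have d_mon : ∀ i r, d (T.const r * t ^ i) = (t ^ i) ⊗ₜ KaehlerDifferential.D ℤ R r := fun i r => by
    rw [← hom_monomial, d_hom, g_mon]
  let D : Derivation ℤ A (A ⊗[R] Ω[R⁄ℤ]) := Derivation.mk' d.toIntLinearMap (fun a b => by
    obtain ⟨p, rfl⟩ := T.surj a
    obtain ⟨q, rfl⟩ := T.surj b
    change d (_ * _) = _ • d _ + _ • d _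
    induction p using Polynomial.induction_on' with
    | add p p' hp hp' =>
      rw [map_add, add_mul, map_add, hp, hp', map_add, add_smul, smul_add]
      abel
    | monomial i r =>
      induction q using Polynomial.induction_on' with
      | add p p' hp hp' =>
        rw [map_add, mul_add, map_add, hp, hp', map_add, add_smul, smul_add]
        abel
      | monomial j s =>
        have e : T.const r * t ^ i * (T.const s * t ^ j) = T.const (r * s) * t ^ (i + j) := by
          rw [map_mul]; ring
        rw [hom_monomial, hom_monomial, e, d_mon, d_mon, d_mon, Derivation.leibniz,
          TensorProduct.tmul_add, ← TensorProduct.smul_tmul, ← TensorProduct.smul_tmul,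
          TensorProduct.smul_tmul', TensorProduct.smul_tmul', Algebra.smul_def, Algebra.smul_def,
          alg, alg, smul_eq_mul, smul_eq_mul]
        congr 2 <;> ring)
  let j : A ⊗[R] Ω[R⁄ℤ] →ₗ[A] A ⊗[R] Forms R := (ExteriorAlgebra.ι R).baseChange A
  have j_tmul : ∀ a x, j (a ⊗ₜ x) = a ⊗ₜ ExteriorAlgebra.ι R x := fun a x => rfl
  have anti : ∀ x y, j x * j y = -(j y * j x) := by
    intro x y
    induction x using TensorProduct.induction_on with
    | zero => simp
    | add x x' h h' => rw [map_add, add_mul, mul_add, h, h', neg_add]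
    | tmul a v =>
      induction y using TensorProduct.induction_on with
      | zero => simp
      | add x x' h h' => rw [map_add, add_mul, mul_add, h, h', neg_add]
      | tmul b w =>
        rw [j_tmul, j_tmul, Algebra.TensorProduct.tmul_mul_tmul,
          Algebra.TensorProduct.tmul_mul_tmul, mul_comm b a, ← TensorProduct.tmul_neg,
          eq_neg_of_add_eq_zero_left (ExteriorAlgebra.ι_add_mul_swap v w)]
  have sq : ∀ x, j x * j x = 0 := by
    intro x
    induction x using TensorProduct.induction_on with
    | zero => simp
    | add x y h h' => rw [map_add, add_mul, mul_add, mul_add, h, h', anti x y]; simp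
    | tmul a v =>
      rw [j_tmul, Algebra.TensorProduct.tmul_mul_tmul, ExteriorAlgebra.ι_sq_zero,
        TensorProduct.tmul_zero]
  let Ψ : Forms A →ₐ[A] A ⊗[R] Forms R := ExteriorAlgebra.lift A
    ⟨j ∘ₗ D.liftKaehlerDifferential, fun x => sq _⟩
  refine ⟨Ψ.toRingHom, fun a => Ψ.commutes a, fun α => ?_⟩
  change Ψ _ = _
  induction α using forms_induction with
  | hc r =>
    rw [mapForms_algebraMap, AlgHom.commutes, ← alg, Algebra.TensorProduct.algebraMap_apply,
      Algebra.algebraMap_self_apply, Algebra.algebraMap_eq_smul_one, TensorProduct.smul_tmul,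
      Algebra.algebraMap_eq_smul_one]
  | hd r =>
    rw [mapForms_dElem, dElem_apply, dElem_apply]
    refine (ExteriorAlgebra.lift_ι_apply A (j ∘ₗ D.liftKaehlerDifferential) _ _).trans ?_
    rw [LinearMap.comp_apply, Derivation.liftKaehlerDifferential_comp_D]
    have := d_mon 0 r
    rw [pow_zero, mul_one] at this
    exact congrArg j this
  | hadd x y hx hy => rw [map_add, map_add, hx, hy, TensorProduct.tmul_add]
  | hmul x y hx hy =>
    rw [map_mul, map_mul, hx, hy, Algebra.TensorProduct.tmul_mul_tmul, one_mul]

/-- After passing to forms on R with coefficients in A, the form α is the coefficient of t^{n-1}. -/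
theorem eq_zero_of_pow_smul_const (hn : 1 ≤ n) {α : Forms R}
    (h : t ^ (n - 1) • mapForms T.const α = 0) : α = 0 := by
  let _ := T.const.toAlgebra
  obtain ⟨Ψ, h1, h2⟩ := T.exists_relative_hom
  let l : A →ₗ[R] R :=
    { toFun := T.coeff (n - 1) (by omega)
      map_add' := map_add _
      map_smul' := fun r a => by
        obtain ⟨p, rfl⟩ := T.surj a
        have : r • T.toHom p = T.toHom (Polynomial.C r * p) := by
          rw [map_mul, Algebra.smul_def]; rfl
        rw [this, coeff_hom, coeff_hom, Polynomial.coeff_C_mul]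
        rfl }
  have hl : l (t ^ (n - 1)) = 1 := by
    change T.coeff (n - 1) (by omega) (t ^ (n - 1)) = 1
    have := T.coeff_hom (n - 1) (by omega) (Polynomial.X ^ (n - 1))
    rwa [map_pow, T.map_X, Polynomial.coeff_X_pow_self] at this
  let F : A ⊗[R] Forms R →ₗ[R] Forms R := TensorProduct.lift ((LinearMap.lsmul R (Forms R)) ∘ₗ l)
  have e := congrArg (fun x => F (Ψ x)) h
  simp only [map_zero] at e
  rw [Algebra.smul_def, map_mul, h1, h2, Algebra.TensorProduct.tmul_mul_tmul, mul_one, one_mul] at e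
  have : F ((t ^ (n - 1)) ⊗ₜ[R] α) = l (t ^ (n - 1)) • α := rfl
  rwa [this, hl, one_smul] at e

include T in
/-- If `d(t^{n-1} η) = 0` then `η` restricts to zero modulo `t`. -/
theorem mem_formsIdeal_of_extD_eq_zero (hQ : NatUnits A) (hn : 2 ≤ n) {η : Forms A}
    (h : extD A (t ^ (n - 1) • η) = 0) : η ∈ formsIdeal t := by
  have hn1 : 1 ≤ n := by omega
  set α := mapForms (T.ev hn1) η with hα
  have hx : η - mapForms T.const α ∈ formsIdeal t := by
    refine mem_formsIdeal_of_mapForms_eq_zero (T.ev_surjective hn1) (T.ker_ev hn1) ?_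
    have : (T.ev hn1).comp T.const = RingHom.id R := RingHom.ext (T.ev_const hn1)
    rw [map_sub, ← mapForms_comp, this, mapForms_id, hα, sub_self]
  suffices α = 0 by simpa [this] using hx
  apply T.eq_zero_of_pow_smul_const hn1
  -- Multiplication by t^{n-1} kills both t and dt, so η may be replaced by its constant part α.
  have hz : t ^ (n - 1) • (η - mapForms T.const α) = 0 := by
    obtain ⟨x, y, hxy⟩ := hx
    rw [hxy, smul_add, smul_smul, ← pow_succ, Nat.sub_add_cancel hn1, T.pow_eq_zero, zero_smul,
      ← smul_mul_assoc, pow_smul_dElem_eq_zero hQ hn1 T.pow_eq_zero (by omega), zero_mul, add_zero]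
  rw [smul_sub, sub_eq_zero] at hz
  rw [hz, extD_smul] at h
  -- Contracting d(t^{n-1}α) with the Euler field leaves (n-1) t^{n-1} α, and n - 1 is invertible
  -- because n ≥ 2.
  have e := congrArg (contr T.euler) h
  rw [map_add, contr_dElem_mul, contr_const, mul_zero, sub_zero, map_smul, extD_mapForms,
    contr_const, smul_zero, add_zero, map_zero, euler_t_pow, mul_smul] at e
  obtain ⟨c, hc⟩ := (hQ (n - 1) (by omega)).exists_left_inv
  have := congrArg (c • ·) e
  simpa only [smul_smul, ← mul_assoc, hc, one_mul, smul_zero] using this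

end TruncData

end

end MilnorDlog

namespace MilnorDlog

noncomputable section

/-! ### Relative Milnor K-groups and injectivity -/

section milnorAlgebra

open scoped TensorProduct

/-- A multilinear map which vanishes as soon as one argument lies in the kernel of a surjection `p`
descends along `p`. -/
theorem exists_multilinear_descent {M M' G : Type*} [AddCommGroup M] [AddCommGroup M']
    [AddCommGroup G] {r : ℕ} (p : M →ₗ[ℤ] M') (hp : Function.Surjective p)
    (f : MultilinearMap ℤ (fun _ : Fin r => M) G) (hf : ∀ v i, p (v i) = 0 → f v = 0) :
    ∃ g : MultilinearMap ℤ (fun _ : Fin r => M') G, ∀ v, g (fun i => p (v i)) = f v := by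
  classical
  have key : ∀ v v' : Fin r → M, (∀ i, p (v i) = p (v' i)) → f v = f v' := by
    intro v v' h
    -- Expand f at v = (v - v') + v' over subsets: every nonempty subset contributes an argument in
    -- the kernel of p.
    have e := f.map_add_univ (v - v') v'
    rw [sub_add_cancel, Finset.sum_eq_single ∅] at e
    · simpa using e
    · intro s _ hs
      obtain ⟨i, hi⟩ := Finset.nonempty_iff_ne_empty.2 hs
      refine hf _ i ?_
      rw [Finset.piecewise_eq_of_mem _ _ _ hi, Pi.sub_apply, map_sub, h, sub_self]
    · simp
  choose σ hσ using hp
  refine ⟨MultilinearMap.mk' (fun v => f fun i => σ (v i)) ?_ ?_, fun v => key _ _ fun i => hσ _⟩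
  · intro v i x y
    have e : ∀ x, f (fun j => σ (Function.update v i x j)) =
        f (Function.update (fun j => σ (v j)) i (σ x)) := fun x => key _ _ fun j => by
      by_cases hj : j = i
      · subst hj; simp
      · simp [Function.update_of_ne hj]
    change f _ = f _ + f _
    rw [e, e, e, ← f.map_update_add]
    refine key _ _ fun j => ?_
    by_cases hj : j = i
    · subst hj; simp [hσ]
    · simp [Function.update_of_ne hj]
  · intro v i c x
    have e : ∀ x, f (fun j => σ (Function.update v i x j)) =
        f (Function.update (fun j => σ (v j)) i (σ x)) := fun x => key _ _ fun j => by
      by_cases hj : j = i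
      · subst hj; simp
      · simp [Function.update_of_ne hj]
    change f _ = c • f _
    rw [e, e, ← f.map_update_smul]
    refine key _ _ fun j => ?_
    by_cases hj : j = i
    · subst hj; simp [hσ]
    · simp [Function.update_of_ne hj]

variable {A B : Type u} [CommRing A] [CommRing B]

/-- The symbol as a multilinear map. -/
def symbolHom (r : ℕ) (A : Type u) [CommRing A] :
    MultilinearMap ℤ (fun _ : Fin r => Additive Aˣ) (MilnorK r A) :=
  (QuotientAddGroup.mk' (steinberg r A)).toIntLinearMap.compMultilinearMap (PiTensorProduct.tprod ℤ)

theorem symbolHom_apply {r : ℕ} (a : Fin r → Aˣ) :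
    symbolHom r A (fun l => Additive.ofMul (a l)) = symbol r a := rfl

theorem symbol_eq_zero {r : ℕ} (a : Fin r → Aˣ) (i j : Fin r) (hij : (j : ℕ) = i + 1)
    (h : (a i : A) + a j = 1) : symbol r a = 0 :=
  (QuotientAddGroup.eq_zero_iff _).2 (AddSubgroup.subset_closure ⟨a, i, j, hij, h, rfl⟩)

theorem symbol_eq_zero_of_eq_one {r : ℕ} (a : Fin r → Aˣ) (i : Fin r) (h : a i = 1) :
    symbol r a = 0 :=
  (symbolHom r A).map_coord_zero i (by rw [h]; rfl)

theorem milnorK_induction {r : ℕ} {P : MilnorK r A → Prop} (h0 : P 0) (hs : ∀ a, P (symbol r a))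
    (hadd : ∀ x y, P x → P y → P (x + y)) (hneg : ∀ x, P x → P (-x)) (z : MilnorK r A) : P z := by
  let H : AddSubgroup (MilnorK r A) :=
    { carrier := {z | P z}, add_mem' := fun {x y} => hadd x y, zero_mem' := h0,
      neg_mem' := fun {x} => hneg x }
  have : QuotientAddGroup.mk' H = 0 := milnor_hom_ext fun a =>
    (QuotientAddGroup.eq_zero_iff _).2 (hs a)
  exact (QuotientAddGroup.eq_zero_iff (N := H) z).1 (DFunLike.congr_fun this z)

/-- If every unit of `B` and every Steinberg relation lifts to `A`, then the kernel of
`K^M_r(A) → K^M_r(B)` is generated by the symbols with an entry which maps to `1`. -/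
theorem mem_of_mapMilnor_eq_zero {r : ℕ} (π : A →+* B) (hπ : Function.Surjective π)
    (hu : ∀ a, IsUnit (π a) → IsUnit a) (H : AddSubgroup (MilnorK r A))
    (hH : ∀ (y : Fin r → Aˣ) (i : Fin r), π (y i) = 1 → symbol r y ∈ H) {z : MilnorK r A}
    (hz : mapMilnor r π z = 0) : z ∈ H := by
  classical
  let p : Additive Aˣ →ₗ[ℤ] Additive Bˣ :=
    (MonoidHom.toAdditive (Units.map (π : A →* B))).toIntLinearMap
  have p_val : ∀ x, (((p x).toMul : Bˣ) : B) = π (x.toMul : Aˣ) := fun x => rfl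
  have hp : Function.Surjective p := by
    intro b
    obtain ⟨a, ha⟩ := hπ (b.toMul : Bˣ)
    obtain ⟨a, rfl⟩ := hu a (ha ▸ Units.isUnit _)
    exact ⟨Additive.ofMul a, Additive.toMul.injective (Units.ext ha)⟩
  obtain ⟨g, hg⟩ := exists_multilinear_descent p hp
    ((QuotientAddGroup.mk' H).toIntLinearMap.compMultilinearMap (symbolHom r A))
    (fun v i hv => (QuotientAddGroup.eq_zero_iff _).2 (hH (fun l => (v l).toMul) i (by
      rw [← p_val, hv]; rfl)))
  have hg' : ∀ a : Fin r → Aˣ, g (fun i => p (Additive.ofMul (a i))) =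
      (symbol r a : MilnorK r A ⧸ H) := fun a => hg _
  -- An inverse direction K^M_r(B) → K^M_r(A)/H, obtained by lifting entries; its composite with
  -- reduction is the quotient map, so the kernel lies in H.
  let F : MilnorK r B →+ MilnorK r A ⧸ H := milnorLift r g (by
    intro b i j hij hb
    choose a ha using fun l => hp (Additive.ofMul (b l))
    have hne : i ≠ j := by rintro rfl; omega
    have hai : π ((a i).toMul : Aˣ) = b i := by rw [← p_val, ha]; rfl
    -- A Steinberg relation lifts: keep the lift of the i-th entry and take one minus it as the lift
    -- of the j-th.
    have h1 : π (1 - ((a i).toMul : Aˣ)) = b j := by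
      rw [map_sub, map_one, hai, ← hb, add_sub_cancel_left]
    obtain ⟨w, hw⟩ := hu _ (h1 ▸ Units.isUnit _)
    have e : (fun l => Additive.ofMul (b l)) =
        fun l => p (Additive.ofMul (Function.update (fun l => (a l).toMul) j w l)) := by
      funext l
      by_cases hl : l = j
      · subst hl
        rw [Function.update_self]
        refine Additive.toMul.injective (Units.ext ?_)
        rw [p_val]
        change (b l : B) = π w
        rw [hw, h1]
      · rw [Function.update_of_ne hl]
        exact (ha l).symm
    rw [e, hg', symbol_eq_zero _ i j hij]
    · rfl
    · rw [Function.update_self, Function.update_of_ne hne, hw, add_sub_cancel])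
  have : F.comp (mapMilnor r π) = QuotientAddGroup.mk' H := milnor_hom_ext fun a => by
    rw [AddMonoidHom.comp_apply, mapMilnor_symbol, milnorLift_symbol]
    exact hg' a
  have e := DFunLike.congr_fun this z
  rw [AddMonoidHom.comp_apply, hz, map_zero] at e
  exact (QuotientAddGroup.eq_zero_iff z).1 e.symm

theorem mapMilnor_injective {r : ℕ} (π : A →+* B) (hπ : Function.Bijective π) :
    Function.Injective (mapMilnor r π) := by
  refine (injective_iff_map_eq_zero _).2 fun z hz => ?_
  refine (AddSubgroup.mem_bot).1 (mem_of_mapMilnor_eq_zero π hπ.2 (fun a ha => ?_) ⊥ ?_ hz)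
  · obtain ⟨b, hb⟩ := ha.exists_right_inv
    obtain ⟨b, rfl⟩ := hπ.2 b
    exact IsUnit.of_mul_eq_one b (hπ.1 (by rw [map_mul, hb, map_one]))
  · intro y i h
    exact symbol_eq_zero_of_eq_one y i (Units.ext (hπ.1 (by rw [h, Units.val_one, map_one])))

theorem mapMilnor_surjective {r : ℕ} (π : A →+* B) (hπ : Function.Surjective π)
    (hu : ∀ a, IsUnit (π a) → IsUnit a) : Function.Surjective (mapMilnor r π) := by
  intro z
  induction z using milnorK_induction with
  | h0 => exact ⟨0, map_zero _⟩
  | hs b =>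
    choose a ha using fun l => hπ (b l)
    choose w hw using fun l => hu (a l) (ha l ▸ Units.isUnit _)
    refine ⟨symbol r w, ?_⟩
    rw [mapMilnor_symbol]
    congr 1
    funext l
    exact Units.ext ((congrArg π (hw l)).trans (ha l))
  | hadd x y hx hy =>
    obtain ⟨x, rfl⟩ := hx; obtain ⟨y, rfl⟩ := hy; exact ⟨x + y, map_add _ _ _⟩
  | hneg x hx => obtain ⟨x, rfl⟩ := hx; exact ⟨-x, map_neg _ _⟩

theorem mapMilnor_comp {C : Type u} [CommRing C] {r : ℕ} (g : B →+* C) (f : A →+* B)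
    (z : MilnorK r A) : mapMilnor r (g.comp f) z = mapMilnor r g (mapMilnor r f z) := by
  have : mapMilnor r (g.comp f) = (mapMilnor r g).comp (mapMilnor r f) :=
    milnor_hom_ext fun a => by
      rw [AddMonoidHom.comp_apply, mapMilnor_symbol, mapMilnor_symbol, mapMilnor_symbol]
      rfl
  exact DFunLike.congr_fun this z

theorem dlogForms_mapMilnor {r : ℕ} (f : A →+* B) (z : MilnorK r A) :
    dlogForms r B (mapMilnor r f z) = mapDeg r f (dlogForms r A z) :=
  congrArg Subtype.val (DFunLike.congr_fun
    (congrArg AddCommGrpCat.Hom.hom ((dlogNat r).naturality (CommRingCat.ofHom f))) z)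

theorem dlogForms_symbol_coe {r : ℕ} (a : Fin r → Aˣ) : (dlogForms r A (symbol r a) : Forms A) =
    ((List.ofFn a).map fun u => ExteriorAlgebra.ι A (dlogOne A (Additive.ofMul u))).prod := by
  rw [dlogForms_symbol, exteriorPower.ιMulti_apply_coe, ExteriorAlgebra.ιMulti_apply, List.map_ofFn]
  rfl

theorem symbolHom_curryLeft {r : ℕ} (u : Additive Aˣ) (a : Fin r → Aˣ) :
    (symbolHom (r + 1) A).curryLeft u (fun l => Additive.ofMul (a l)) =
      symbol (r + 1) (Fin.cons u.toMul a) := rfl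

theorem symbolHom_curryLeft_eq_zero {r : ℕ} (u : Additive Aˣ) (a : Fin r → Aˣ) (i j : Fin r)
    (hij : (j : ℕ) = i + 1) (h : (a i : A) + a j = 1) :
    (symbolHom (r + 1) A).curryLeft u (fun l => Additive.ofMul (a l)) = 0 := by
  rw [symbolHom_curryLeft]
  exact symbol_eq_zero _ i.succ j.succ (by simp [hij]) (by simpa using h)

/-- The map `z ↦ {u, z}`. -/
def symbolMul (r : ℕ) (A : Type u) [CommRing A] :
    Additive Aˣ →+ MilnorK r A →+ MilnorK (r + 1) A :=
  AddMonoidHom.mk' (fun u => milnorLift r ((symbolHom (r + 1) A).curryLeft u)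
      (symbolHom_curryLeft_eq_zero u))
    (fun u v => milnor_hom_ext fun a => by
      rw [AddMonoidHom.add_apply, milnorLift_symbol, milnorLift_symbol, milnorLift_symbol, map_add]
      rfl)

theorem symbolMul_symbol {r : ℕ} (u : Aˣ) (a : Fin r → Aˣ) :
    symbolMul r A (Additive.ofMul u) (symbol r a) = symbol (r + 1) (Fin.cons u a) :=
  (milnorLift_symbol r _ (symbolHom_curryLeft_eq_zero (Additive.ofMul u)) a).trans
    (symbolHom_curryLeft _ a)

/-- The product of all Milnor `K`-groups of `A`. -/
abbrev MilnorPi (A : Type u) [CommRing A] : Type u := (r : ℕ) → MilnorK r A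

/-- The operation of units on the product of all Milnor `K`-groups by left multiplication. -/
def milnorOp (A : Type u) [CommRing A] : Additive Aˣ →+ AddMonoid.End (MilnorPi A) :=
  AddMonoidHom.mk' (fun u => AddMonoidHom.mk' (fun f r => match r with
      | 0 => 0
      | r + 1 => symbolMul r A u (f r))
    (fun f g => by funext r; cases r <;> simp))
    (fun u v => by
      refine AddMonoidHom.ext fun f => ?_
      funext r
      cases r with
      | zero => exact (add_zero (0 : MilnorK 0 A)).symm
      | succ r => exact DFunLike.congr_fun ((symbolMul r A).map_add u v) (f r))

theorem milnorOp_succ (u : Additive Aˣ) (f : MilnorPi A) (r : ℕ) :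
    milnorOp A u f (r + 1) = symbolMul r A u (f r) := rfl

theorem milnorOp_steinberg (u v : Aˣ) (h : (u : A) + v = 1) :
    milnorOp A (Additive.ofMul u) * milnorOp A (Additive.ofMul v) = 0 := by
  refine AddMonoidHom.ext fun f => ?_
  funext r
  rcases r with _ | _ | r
  · rfl
  · change symbolMul _ _ _ 0 = _
    rw [map_zero]; rfl
  · change ((symbolMul (r + 1) A (Additive.ofMul u)).comp (symbolMul r A (Additive.ofMul v))) (f r) =
      (0 : MilnorK r A →+ MilnorK (r + 2) A) (f r)
    congr 1
    refine milnor_hom_ext fun a => ?_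
    rw [AddMonoidHom.comp_apply, symbolMul_symbol, symbolMul_symbol]
    exact symbol_eq_zero _ 0 1 rfl h

theorem prod_ofFn_eq_zero {E : Type*} [Ring E] {r : ℕ} (f : Fin r → E) (i j : Fin r)
    (hij : (j : ℕ) = i + 1) (h : f i * f j = 0) : (List.ofFn f).prod = 0 := by
  induction r with
  | zero => exact i.elim0
  | succ r ih =>
    rw [List.ofFn_succ, List.prod_cons]
    induction i using Fin.cases with
    | zero =>
      obtain _ | r := r
      · have := j.2; simp at hij
      · have : j = Fin.succ 0 := Fin.ext (by simpa using hij)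
        subst this
        rw [List.ofFn_succ, List.prod_cons, ← mul_assoc, h, zero_mul]
    | succ i =>
      induction j using Fin.cases with
      | zero => simp at hij
      | succ j => rw [ih (fun i => f i.succ) i j (by simpa using hij) h, mul_zero]

/-- The operation of `K^M_r(A)` on the product of all Milnor `K`-groups by left multiplication. -/
def milnorAct (r : ℕ) (A : Type u) [CommRing A] : MilnorK r A →+ AddMonoid.End (MilnorPi A) :=
  milnorLift r ((MultilinearMap.mkPiAlgebraFin ℤ r (AddMonoid.End (MilnorPi A))).compLinearMap
    fun _ => (milnorOp A).toIntLinearMap) (by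
    intro a i j hij h
    rw [MultilinearMap.compLinearMap_apply, MultilinearMap.mkPiAlgebraFin_apply]
    exact prod_ofFn_eq_zero _ i j hij (milnorOp_steinberg _ _ h))

theorem milnorAct_symbol {r : ℕ} (a : Fin r → Aˣ) : milnorAct r A (symbol r a) =
    ((List.ofFn a).map fun u => milnorOp A (Additive.ofMul u)).prod := by
  refine (milnorLift_symbol r _ _ _).trans ?_
  rw [MultilinearMap.compLinearMap_apply, MultilinearMap.mkPiAlgebraFin_apply, List.map_ofFn]
  rfl

/-- Acting on the unit of K^M_0 recovers z, so K^M_r(A) embeds in an endomorphism ring. There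
`exists_symbolHom`, which needs values in a ring, can be applied. -/
theorem milnorAct_apply_single {r : ℕ} (z : MilnorK r A) :
    milnorAct r A z (Pi.single 0 (symbol 0 Fin.elim0)) r = z := by
  let ev : AddMonoid.End (MilnorPi A) →+ MilnorK r A :=
    AddMonoidHom.mk' (fun f => f (Pi.single 0 (symbol 0 Fin.elim0)) r) (fun f g => rfl)
  have : ev.comp (milnorAct r A) = AddMonoidHom.id _ := milnor_hom_ext fun a => by
    change milnorAct r A (symbol r a) _ r = symbol r a
    rw [milnorAct_symbol]
    clear ev z
    induction r with
    | zero =>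
      rw [List.ofFn_zero, List.map_nil, List.prod_nil, AddMonoid.End.coe_one, id, Pi.single_eq_same]
      congr 1
      funext i
      exact i.elim0
    | succ r ih =>
      rw [List.ofFn_succ, List.map_cons, List.prod_cons, AddMonoid.End.coe_mul, Function.comp_apply, milnorOp_succ,
        ih, symbolMul_symbol]
      congr 1
      exact Fin.cons_self_tail a
  exact DFunLike.congr_fun this z

theorem milnorAct_injective (r : ℕ) : Function.Injective (milnorAct r A) := fun x y h => by
  rw [← milnorAct_apply_single x, h, milnorAct_apply_single]

/-- Applied both to operators on symbols and to one-forms, so the same sign appears on the two sides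
that are compared. -/
theorem prod_map_move {E ι : Type*} [Ring E] (f : ι → E) (h : ∀ u v, f u * f v = -(f v * f u))
    (l₁ l₂ : List ι) (z : ι) : ((l₁ ++ z :: l₂).map f).prod =
      ((-1) ^ l₁.length : ℤ) • (f z * ((l₁ ++ l₂).map f).prod) := by
  induction l₁ with
  | nil => simp
  | cons u l₁ ih =>
    rw [List.cons_append, List.map_cons, List.prod_cons, ih, List.cons_append, List.map_cons,
      List.prod_cons, ← mul_assoc, h z u, List.length_cons, pow_succ, mul_smul_comm]
    simp [mul_assoc]

theorem extD_prod_dlogOne (l : List Aˣ) :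
    extD A ((l.map fun u => ExteriorAlgebra.ι A (dlogOne A (Additive.ofMul u))).prod) = 0 := by
  induction l with
  | nil => exact extD_one
  | cons u l ih =>
    rw [List.map_cons, List.prod_cons, extD_ι_mul, ih, extD_dlogOne, zero_mul, mul_zero, sub_zero]

/-- With s = t^{n-1} both s² and s ds vanish, the latter because t^{n-1} dt = 0; hence the factor (1
+ xs)⁻¹ acts trivially on d(xs). -/
theorem ι_dlogOne_one_add {t : A} {n : ℕ} (hQ : NatUnits A) (hn : 2 ≤ n) (ht : t ^ n = 0) {x : A}
    {z : Aˣ} (hz : (z : A) = 1 + x * t ^ (n - 1)) :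
    ExteriorAlgebra.ι A (dlogOne A (Additive.ofMul z)) = dElem A (t ^ (n - 1) * x) := by
  have hs : t ^ (n - 1) * t ^ (n - 1) = 0 := by
    rw [← pow_add]; exact pow_eq_zero_of_le (by omega) ht
  have hds : t ^ (n - 1) • dElem A (t ^ (n - 1)) = 0 := by
    have e : ∀ k : ℕ, dElem A (t ^ k) = ((k : A) * t ^ (k - 1)) • dElem A t := fun k => by
      rw [dElem_apply, Derivation.leibniz_pow, map_nsmul, map_smul, ← dElem_apply,
        ← Nat.cast_smul_eq_nsmul A, smul_smul]
    rw [e, smul_smul, mul_left_comm, mul_smul, ← pow_add,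
      pow_smul_dElem_eq_zero hQ (by omega) ht (by omega), smul_zero]
  have h0 : (t ^ (n - 1) * x) • dElem A (t ^ (n - 1) * x) = 0 := by
    rw [dElem_mul, smul_add, smul_smul, smul_smul, mul_right_comm, hs, zero_mul, zero_smul, zero_add,
      mul_assoc, mul_comm, mul_smul, hds, smul_zero]
  have e : dElem A (z : A) = dElem A (t ^ (n - 1) * x) := by
    rw [hz, map_add, dElem_one, zero_add, mul_comm]
  rw [dlogOne_apply, map_smul, ← dElem_apply, e]
  have h1 : (z : A) • dElem A (t ^ (n - 1) * x) = dElem A (t ^ (n - 1) * x) := by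
    rw [hz, add_smul, one_smul, mul_comm x, h0, add_zero]
  conv_lhs => rw [← h1]
  rw [smul_smul, Units.inv_mul, one_smul]

namespace TruncData

variable {R : Type u} [CommRing R] {t : A} {n : ℕ} (T : TruncData R A t n)
include T

/-- Each z in the kernel is b(η) for a form η with dlog z = d(t^{n-1}η). If this is zero, η lies in
the ideal generated by t and dt, which b annihilates. -/
theorem eq_zero_of_mapMilnor_pred [IsLocalRing A] (hQ : NatUnits A) (hn : 2 ≤ n) {r : ℕ}
    (π : A →+* B) (hπ : Function.Surjective π) (hk : RingHom.ker π = Ideal.span {t ^ (n - 1)})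
    {z : MilnorK r A} (hz : mapMilnor r π z = 0) (hd : dlogForms r A z = 0) : z = 0 := by
  have ht := T.pow_eq_zero
  obtain ⟨b, hb, hbt, hbd⟩ := exists_symbolHom (ρ := milnorOp A) milnorOp_steinberg hQ hn ht
  have hnil : IsNilpotent (t ^ (n - 1)) := ⟨2, by
    rw [← pow_mul]; exact pow_eq_zero_of_le (by omega) ht⟩
  have ker_nil : ∀ a, π a = 0 → ∃ c, a = c * t ^ (n - 1) := fun a ha => by
    have : a ∈ Ideal.span {t ^ (n - 1)} := hk ▸ ha
    exact (Ideal.mem_span_singleton'.1 this).imp fun _ h => h.symm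
  let H : AddSubgroup (MilnorK r A) :=
    { carrier := {z | ∃ η, milnorAct r A z = b η ∧
        (dlogForms r A z : Forms A) = extD A (t ^ (n - 1) • η)}
      add_mem' := by
        rintro x y ⟨η, h1, h2⟩ ⟨η', h1', h2'⟩
        exact ⟨η + η', by rw [map_add, h1, h1', map_add], by
          rw [map_add, Submodule.coe_add, h2, h2', smul_add, map_add]⟩
      zero_mem' := ⟨0, by simp⟩
      neg_mem' := by
        rintro x ⟨η, h1, h2⟩
        exact ⟨-η, by rw [map_neg, h1, map_neg], by
          rw [map_neg, Submodule.coe_neg, h2, smul_neg, map_neg]⟩ }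
  have hH : z ∈ H := by
    refine mem_of_mapMilnor_eq_zero π hπ (fun a ha => ?_) H (fun y i hy => ?_) hz
    · obtain ⟨c, hc⟩ := ha.exists_right_inv
      obtain ⟨c, rfl⟩ := hπ c
      obtain ⟨d, hd⟩ := ker_nil (a * c - 1) (by rw [map_sub, map_mul, hc, map_one, sub_self])
      have : IsUnit (a * c) := by
        rw [sub_eq_iff_eq_add'.1 hd]
        exact ((Commute.all _ _).isNilpotent_mul_left hnil).isUnit_one_add
      exact isUnit_of_mul_isUnit_left this
    · obtain ⟨x, hx⟩ := ker_nil ((y i : A) - 1) (by rw [map_sub, hy, map_one, sub_self])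
      obtain ⟨l₁, l₂, hl⟩ := List.append_of_mem (List.mem_ofFn.2 ⟨i, rfl⟩ : y i ∈ List.ofFn y)
      refine ⟨((-1) ^ l₁.length : ℤ) • (x • ((l₁ ++ l₂).map fun u =>
        ExteriorAlgebra.ι A (dlogOne A (Additive.ofMul u))).prod), ?_, ?_⟩
      · rw [milnorAct_symbol, hl, prod_map_move _ (fun u v => mul_anticomm milnorOp_steinberg hQ u v),
          map_zsmul, hb x (y i) (sub_eq_iff_eq_add'.1 hx)]
      · rw [dlogForms_symbol_coe, hl, prod_map_move _ (fun u v =>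
          eq_neg_of_add_eq_zero_left (ExteriorAlgebra.ι_add_mul_swap _ _)), smul_comm, map_zsmul,
          ι_dlogOne_one_add hQ hn ht (sub_eq_iff_eq_add'.1 hx), smul_smul, extD_smul,
          extD_prod_dlogOne, smul_zero, add_zero]
  obtain ⟨η, h1, h2⟩ := hH
  rw [hd, ZeroMemClass.coe_zero] at h2
  obtain ⟨α, β, h⟩ := T.mem_formsIdeal_of_extD_eq_zero hQ hn h2.symm
  rw [h, map_add, hbt, hbd, add_zero] at h1
  exact milnorAct_injective r (h1.trans (map_zero _).symm)

/-- `K^M_r(A) → K^M_r(A/t^m) × Ω^r_A` is injective for a local ring `A = R[t]/(t^n)`. -/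
theorem eq_zero_of_mapMilnor [IsLocalRing A] (hQ : NatUnits A) {m : ℕ} (hm : 1 ≤ m) (hmn : m ≤ n)
    {r : ℕ} (π : A →+* B) (hπ : Function.Surjective π) (hk : RingHom.ker π = Ideal.span {t ^ m})
    {z : MilnorK r A} (hz : mapMilnor r π z = 0) (hd : dlogForms r A z = 0) : z = 0 := by
  induction n, hmn using Nat.le_induction generalizing A with
  | base =>
    refine mapMilnor_injective π ⟨?_, hπ⟩ (hz.trans (map_zero _).symm)
    rw [RingHom.injective_iff_ker_eq_bot, hk, T.pow_eq_zero, Ideal.span_singleton_eq_bot]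
  | succ n hmn ih =>
    -- Here t^{n+1} = 0. The map π factors through A/t^n, again local and truncated, where the
    -- induction hypothesis kills the image of z; the one-step case finishes.
    let I : Ideal A := Ideal.span {t ^ n}
    have hkq : RingHom.ker (Ideal.Quotient.mk I) = Ideal.span {t ^ n} := Ideal.mk_ker
    have hq : Function.Surjective (Ideal.Quotient.mk I) := Ideal.Quotient.mk_surjective
    refine T.eq_zero_of_mapMilnor_pred hQ (by omega) (Ideal.Quotient.mk I) hq hkq ?_ hd
    have hne : I ≠ ⊤ := by
      rw [Ne, Ideal.span_singleton_eq_top]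
      intro h
      have : (t ^ n) ^ (n + 1) = 0 := by rw [← pow_mul, mul_comm, pow_mul, T.pow_eq_zero, zero_pow (by omega)]
      exact not_isUnit_zero (this ▸ h.pow (n + 1))
    have : Nontrivial (A ⧸ I) := Ideal.Quotient.nontrivial_iff.2 hne
    have : IsLocalRing (A ⧸ I) := IsLocalRing.of_surjective' _ hq
    have hle : I ≤ RingHom.ker π := by
      rw [hk]; exact Ideal.span_singleton_le_span_singleton.2 (pow_dvd_pow _ hmn)
    let π' : A ⧸ I →+* B := Ideal.Quotient.lift I π hle
    have hπ' : π'.comp (Ideal.Quotient.mk I) = π := RingHom.ext fun a => rfl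
    refine ih (T.quot (Ideal.Quotient.mk I) hq (by omega) hkq) (hQ.map (Ideal.Quotient.mk I)) π' ?_
      ?_ ?_ ?_
    · exact Ideal.Quotient.lift_surjective_of_surjective _ _ hπ
    · ext x
      obtain ⟨a, rfl⟩ := hq x
      have h1 : π' (Ideal.Quotient.mk I a) = π a := rfl
      rw [RingHom.mem_ker, h1, ← RingHom.mem_ker, hk, ← map_pow, Ideal.mem_span_singleton,
        Ideal.mem_span_singleton]
      constructor
      · exact fun h => map_dvd _ h
      · rintro ⟨c, hc⟩
        obtain ⟨c, rfl⟩ := hq c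
        rw [← map_mul, Ideal.Quotient.eq, Ideal.mem_span_singleton] at hc
        have := dvd_add ((pow_dvd_pow t hmn).trans hc) (dvd_mul_right (t ^ m) c)
        rwa [sub_add_cancel] at this
    · rw [← mapMilnor_comp, hπ', hz]
    · rw [dlogForms_mapMilnor, hd, map_zero]

end TruncData

end milnorAlgebra

end

end MilnorDlog

namespace MilnorDlog

noncomputable section

open scoped Polynomial

/-! ### Exponentials and logarithmic primitives -/

section exponential

variable {A : Type u} [CommRing A]

/-- The exponential of a nilpotent element `w` is a unit `e ≡ 1` modulo `w` with `dlog e = dw`. -/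
theorem exists_dlogOne_eq (hQ : NatUnits A) {w : A} (hw : IsNilpotent w) :
    ∃ e : Aˣ, (∃ c, (e : A) = 1 + w * c) ∧
      ExteriorAlgebra.ι A (dlogOne A (Additive.ofMul e)) = dElem A w := by
  obtain ⟨N, hN⟩ := hw
  -- The coefficients 1/i! of the exponential series.
  choose c hc using fun i : ℕ => (hQ i.factorial i.factorial_ne_zero).exists_right_inv
  have hc0 : c 0 = 1 := by simpa using hc 0
  have hcs : ∀ i, c (i + 1) * (i + 1 : ℕ) = c i := fun i => by
    have h1 := hc (i + 1)
    rw [Nat.factorial_succ, Nat.cast_mul] at h1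
    linear_combination c i * h1 - c (i + 1) * (i + 1 : ℕ) * hc i
  let e : A := ∑ i ∈ Finset.range (N + 1), c i * w ^ i
  have he : e = 1 + w * ∑ i ∈ Finset.range N, c (i + 1) * w ^ i := by
    rw [Finset.mul_sum]
    simp only [e]
    rw [Finset.sum_range_succ', hc0, pow_zero, mul_one, add_comm]
    congr 1
    exact Finset.sum_congr rfl fun i _ => by ring
  have hu : IsUnit e := by
    rw [he]
    exact ((Commute.all _ _).isNilpotent_mul_right ⟨N, hN⟩).isUnit_one_add
  have hterm : ∀ i, dElem A (c (i + 1) * w ^ (i + 1)) = (c i * w ^ i) • dElem A w := fun i => by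
    rw [dElem_mul, dElem_natCast_inv (hc (i + 1)), smul_zero, add_zero, dElem_apply,
      Derivation.leibniz_pow, map_nsmul, map_smul, ← dElem_apply, ← Nat.cast_smul_eq_nsmul A,
      smul_smul, smul_smul, Nat.add_sub_cancel]
    rw [← hcs i]
  have hde : dElem A e = e • dElem A w := by
    have h1 : dElem A e = ∑ i ∈ Finset.range N, (c i * w ^ i) • dElem A w := by
      simp only [e]
      rw [Finset.sum_range_succ', map_add, map_sum, pow_zero, mul_one, hc0, dElem_one, add_zero]
      exact Finset.sum_congr rfl fun i _ => hterm i
    -- The derivative of the sum up to N stops at N - 1; the missing term w^N/N! is zero.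
    have h2 : e = ∑ i ∈ Finset.range N, c i * w ^ i := by
      simp only [e]
      rw [Finset.sum_range_succ, hN, mul_zero, add_zero]
    rw [h1, h2, Finset.sum_smul]
  obtain ⟨e', he'⟩ := hu
  refine ⟨e', ⟨_, he'.trans he⟩, ?_⟩
  rw [dlogOne_apply, map_smul, ← dElem_apply, he', hde, ← he', smul_smul, Units.inv_mul, one_smul]

theorem prod_smul_prod_dlogOne (l : List Aˣ) :
    (l.map fun v : Aˣ => (v : A)).prod •
      (l.map fun v => ExteriorAlgebra.ι A (dlogOne A (Additive.ofMul v))).prod =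
      (l.map fun v : Aˣ => dElem A (v : A)).prod := by
  induction l with
  | nil => simp
  | cons v l ih =>
    simp only [List.map_cons, List.prod_cons]
    rw [← ih, mul_smul_comm, dElem_apply, ← coe_smul_dlogOne, map_smul, smul_mul_assoc, smul_smul,
      mul_comm]

/-- The exact forms `d(t^m a du₁ ∧ ⋯ ∧ du_p)`, for units `u_i`, are logarithmic. -/
theorem exists_dlogForms_eq_extD (hQ : NatUnits A) {t : A} {n m : ℕ} (ht : t ^ n = 0) (hm : 1 ≤ m)
    {p : ℕ} (a : A) (v : Fin p → Aˣ) : ∃ e : Aˣ, (∃ c, (e : A) = 1 + t ^ m * c) ∧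
      (dlogForms (p + 1) A (symbol (p + 1) (Fin.cons e v)) : Forms A) =
        extD A (t ^ m • a • ((List.ofFn v).map fun v : Aˣ => dElem A (v : A)).prod) := by
  have hnil : IsNilpotent t := ⟨n, ht⟩
  set l := List.ofFn v with hl
  -- The product of the units in the exponent converts each dlog v_i into dv_i.
  obtain ⟨e, ⟨c, hc⟩, he⟩ := exists_dlogOne_eq hQ
    (w := t ^ m * (a * (l.map fun v : Aˣ => (v : A)).prod))
    ((Commute.all _ _).isNilpotent_mul_right (hnil.pow_of_pos (by omega)))
  refine ⟨e, ⟨_, hc.trans (by rw [mul_assoc])⟩, ?_⟩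
  rw [dlogForms_symbol_coe, List.ofFn_succ, List.map_cons, List.prod_cons]
  simp only [Fin.cons_zero, Fin.cons_succ]
  rw [← hl, he, ← prod_smul_prod_dlogOne, smul_smul, smul_smul, mul_assoc, extD_smul,
    extD_prod_dlogOne, smul_zero, add_zero]

/-- Forms are sums of the `a db₁ ∧ ⋯ ∧ db_p`. -/
theorem forms_sum_induction {P : Forms A → Prop} (hadd : ∀ x y, P x → P y → P (x + y))
    (hd : ∀ (a : A) (l : List A), P (a • (l.map (dElem A)).prod)) (ω : Forms A) : P ω := by
  have key : ω ∈ AddSubmonoid.closure {x | ∃ (a : A) (l : List A), x = a • (l.map (dElem A)).prod} := by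
    induction ω using forms_induction_left with
    | h1 => exact AddSubmonoid.subset_closure ⟨1, [], by simp⟩
    | hadd x y hx hy => exact add_mem hx hy
    | hs a x hx =>
      induction hx using AddSubmonoid.closure_induction with
      | mem x hx =>
        obtain ⟨b, l, rfl⟩ := hx
        exact AddSubmonoid.subset_closure ⟨a * b, l, by rw [smul_smul]⟩
      | zero => simp
      | add x y _ _ hx hy => rw [smul_add]; exact add_mem hx hy
    | hd a x hx =>
      induction hx using AddSubmonoid.closure_induction with
      | mem x hx =>
        obtain ⟨b, l, rfl⟩ := hx
        exact AddSubmonoid.subset_closure ⟨b, a :: l, by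
          rw [mul_smul_comm, List.map_cons, List.prod_cons]⟩
      | zero => simp
      | add x y _ _ hx hy => rw [mul_add]; exact add_mem hx hy
  induction key using AddSubmonoid.closure_induction with
  | mem x hx => obtain ⟨b, l, rfl⟩ := hx; exact hd b l
  | zero => simpa using hd 0 []
  | add x y _ _ hx hy => exact hadd x y hx hy

theorem prod_dElem_mem (l : List A) : (l.map (dElem A)).prod ∈ ⋀[A]^l.length Ω[A⁄ℤ] := by
  induction l with
  | nil => rw [List.map_nil, List.prod_nil, ExteriorAlgebra.exteriorPower]; exact Submodule.one_le.1 (by simp)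
  | cons a l ih => exact mul_mem_forms A (by simp [add_comm]) (ι_mem A _) ih

/-- Project a sum of decomposable forms to degree p: only those with exactly p differentials
survive, and the others become a trivial instance with coefficient 0. -/
theorem forms_degree_induction {p : ℕ} {P : Forms A → Prop} (hadd : ∀ x y, P x → P y → P (x + y))
    (hd : ∀ (a : A) (b : Fin p → A), P (a • ((List.ofFn b).map (dElem A)).prod)) {ω : Forms A}
    (hω : ω ∈ ⋀[A]^p Ω[A⁄ℤ]) : P ω := by
  rw [← formsProj_of_mem hω]
  refine forms_sum_induction (P := fun ω => P (formsProj p ω)) (fun x y hx hy => ?_)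
    (fun a l => ?_) ω
  · rw [map_add]; exact hadd _ _ hx hy
  · have hl : a • (l.map (dElem A)).prod ∈ ⋀[A]^l.length Ω[A⁄ℤ] :=
      Submodule.smul_mem _ _ (prod_dElem_mem l)
    by_cases h : l.length = p
    · subst h
      rw [formsProj_of_mem hl]
      have := hd a l.get
      rwa [List.ofFn_get] at this
    · rw [formsProj_of_mem_ne hl h]
      simpa using hd 0 (fun _ => 0)

end exponential

/-! ### Formally smooth algebras over k[t]/(t^n) -/

section formallySmooth

/-- The ring is kept abstract because the quotient of R[t] has a competing k[t]/(t^n)-algebra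
structure through R, in which t acts as 0 when R = A/t. -/
theorem exists_truncated_polynomial_ring (R : Type u) [CommRing R] (n : ℕ) :
    ∃ (C : Type u) (_ : CommRing C) (q : R[X] →+* C),
      Function.Surjective q ∧ RingHom.ker q = Ideal.span {Polynomial.X ^ n} :=
  ⟨R[X] ⧸ Ideal.span {(Polynomial.X : R[X]) ^ n}, Ideal.Quotient.commRing _,
    Ideal.Quotient.mk (Ideal.span {(Polynomial.X : R[X]) ^ n}), Ideal.Quotient.mk_surjective,
    Ideal.mk_ker⟩

variable {k : Type u} [Field k] {n : ℕ} {A : Type u} [CommRing A] [Algebra (TruncRing k n) A]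

/-- Both A and C = R[t]/(t^n) are nilpotent thickenings of R = A/t over k[t]/(t^n). Formal
smoothness lifts A → R to a map F into C with F(t) = t, and F is bijective by comparison along
powers of t. -/
theorem exists_truncData (hn : 1 ≤ n) [Algebra.FormallySmooth (TruncRing k n) A] :
    Nonempty (TruncData (A ⧸ Ideal.span {algebraMap (TruncRing k n) A
      (Ideal.Quotient.mk _ Polynomial.X)}) A
      (algebraMap (TruncRing k n) A (Ideal.Quotient.mk _ Polynomial.X)) n) := by
  set t := algebraMap (TruncRing k n) A (Ideal.Quotient.mk _ Polynomial.X) with ht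
  let R := A ⧸ Ideal.span {t}
  obtain ⟨C, _, q, hq, hqk⟩ := exists_truncated_polynomial_ring R n
  have q_zero : ∀ {p}, q p = 0 ↔ Polynomial.X ^ n ∣ p := fun {p} => by
    rw [← RingHom.mem_ker, hqk, Ideal.mem_span_singleton]
  -- Constants k → R; the new structure map k[t]/(t^n) → C sends t to the variable.
  let κ : k →+* R := ((algebraMap (TruncRing k n) R).comp (Ideal.Quotient.mk _)).comp Polynomial.C
  let g : TruncRing k n →+* C := Ideal.Quotient.lift (Ideal.span {(Polynomial.X : k[X]) ^ n})
    (q.comp (Polynomial.mapRingHom κ)) (fun p hp => by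
      obtain ⟨p, rfl⟩ : Polynomial.X ^ n ∣ p := Ideal.mem_span_singleton.1 hp
      rw [RingHom.comp_apply, q_zero, map_mul, map_pow, Polynomial.coe_mapRingHom, Polynomial.map_X]
      exact dvd_mul_right _ _)
  have g_mk : ∀ p, g (Ideal.Quotient.mk _ p) = q (Polynomial.map κ p) := fun p => rfl
  have g_X : g (Ideal.Quotient.mk _ Polynomial.X) = q Polynomial.X := by
    rw [g_mk, Polynomial.map_X]
  let _ : Algebra (TruncRing k n) C := g.toAlgebra
  let ε : C →+* R := q.liftOfSurjective hq ⟨Polynomial.constantCoeff, fun p hp => by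
    obtain ⟨p, rfl⟩ := q_zero.1 hp
    rw [RingHom.mem_ker, map_mul, map_pow, Polynomial.constantCoeff_apply, Polynomial.coeff_X_zero,
      zero_pow (by omega), zero_mul]⟩
  have ε_q : ∀ p, ε (q p) = p.coeff 0 := fun p =>
    q.liftOfRightInverse_comp_apply _ _ ⟨Polynomial.constantCoeff, _⟩ p
  have tR : algebraMap (TruncRing k n) R (Ideal.Quotient.mk _ Polynomial.X) = 0 :=
    Ideal.Quotient.eq_zero_iff_mem.2 (Ideal.mem_span_singleton_self _)
  have hε : ∀ x, ε (algebraMap (TruncRing k n) C x) = algebraMap (TruncRing k n) R x := by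
    have : (ε.comp g) = algebraMap (TruncRing k n) R := by
      refine Ideal.Quotient.ringHom_ext (Polynomial.ringHom_ext (fun c => ?_) ?_)
      · rw [RingHom.comp_apply, RingHom.comp_apply, RingHom.comp_apply, g_mk, ε_q, Polynomial.map_C,
          Polynomial.coeff_C_zero]
        rfl
      · rw [RingHom.comp_apply, RingHom.comp_apply, RingHom.comp_apply, g_X, ε_q, Polynomial.coeff_X_zero]
        exact tR.symm
    exact fun x => RingHom.congr_fun this x
  let ε' : C →ₐ[TruncRing k n] R := { ε with commutes' := hε }
  have ε_surj : Function.Surjective ε := fun r => ⟨q (Polynomial.C r), by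
    rw [ε_q, Polynomial.coeff_C_zero]⟩
  have ε_ker : ∀ c, ε c = 0 → ∃ d, c = q Polynomial.X * d := by
    intro c hc
    obtain ⟨p, rfl⟩ := hq c
    rw [ε_q] at hc
    obtain ⟨d, rfl⟩ := Polynomial.X_dvd_iff.2 hc
    exact ⟨q d, map_mul q _ _⟩
  have X_pow : q Polynomial.X ^ n = 0 := by
    rw [← map_pow, q_zero]
  have ε_nil : IsNilpotent (RingHom.ker (ε' : C →+* R)) := by
    refine ⟨n, ?_⟩
    have : RingHom.ker (ε' : C →+* R) ≤ Ideal.span {q Polynomial.X} := fun c hc => by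
      obtain ⟨d, rfl⟩ := ε_ker c hc
      exact Ideal.mul_mem_right _ _ (Ideal.mem_span_singleton_self _)
    refine le_bot_iff.1 ((Ideal.pow_right_mono this n).trans ?_)
    rw [Ideal.span_singleton_pow, X_pow]
    simp
  let F : A →ₐ[TruncRing k n] C := Algebra.FormallySmooth.liftOfSurjective
    (IsScalarTower.toAlgHom (TruncRing k n) A R) ε' ε_surj ε_nil
  have hF : ∀ a, ε (F a) = Ideal.Quotient.mk _ a := fun a =>
    DFunLike.congr_fun (Algebra.FormallySmooth.comp_liftOfSurjective
      (IsScalarTower.toAlgHom (TruncRing k n) A R) ε' ε_surj ε_nil) a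
  have F_t : F t = q Polynomial.X := (F.commutes _).trans g_X
  have tn : t ^ n = 0 := by
    rw [ht, ← map_pow, ← map_pow, Ideal.Quotient.eq_zero_iff_mem.2 (Ideal.mem_span_singleton_self _),
      map_zero]
  have inj : Function.Injective F := by
    refine (injective_iff_map_eq_zero F).2 fun a ha => ?_
    -- If t^i b is in the kernel with i < n, then F(b) has constant term 0, so b is divisible by t.
    have : ∀ i ≤ n, ∃ b, a = t ^ i * b := by
      intro i
      induction i with
      | zero => exact fun _ => ⟨a, by simp⟩
      | succ i ih =>
        intro hi
        obtain ⟨b, rfl⟩ := ih (by omega)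
        rw [map_mul, map_pow, F_t] at ha
        obtain ⟨p, hp⟩ := hq (F b)
        have hp' : F b = q p := hp.symm
        rw [hp', ← map_pow, ← map_mul, q_zero] at ha
        have h0 : p.coeff 0 = 0 := by
          have := Polynomial.X_pow_dvd_iff.1 ha i (by omega)
          rwa [Polynomial.coeff_X_pow_mul', if_pos le_rfl, Nat.sub_self] at this
        have := hF b
        rw [hp', ε_q, h0, eq_comm, Ideal.Quotient.eq_zero_iff_mem, Ideal.mem_span_singleton] at this
        obtain ⟨c, rfl⟩ := this
        exact ⟨c, by ring⟩
    obtain ⟨b, rfl⟩ := this n le_rfl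
    rw [tn, zero_mul]
  have surj : Function.Surjective F := by
    -- Successive approximation modulo powers of t, which stops at t^n = 0.
    have : ∀ i : ℕ, ∀ c, ∃ a d, c = F a + q Polynomial.X ^ i * d := by
      intro i
      induction i with
      | zero => exact fun c => ⟨0, c, by simp⟩
      | succ i ih =>
        intro c
        obtain ⟨a, d, rfl⟩ := ih c
        obtain ⟨b, hb⟩ := Ideal.Quotient.mk_surjective (ε d)
        obtain ⟨e, he⟩ := ε_ker (d - F b) (by rw [map_sub, hF, hb, sub_self])
        refine ⟨a + t ^ i * b, e, ?_⟩
        rw [map_add, map_mul, map_pow, F_t]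
        linear_combination q Polynomial.X ^ i * he
    intro c
    obtain ⟨a, d, rfl⟩ := this n c
    exact ⟨a, by rw [X_pow, zero_mul, add_zero]⟩
  let eq : A ≃+* C := RingEquiv.ofBijective F ⟨inj, surj⟩
  exact ⟨{
    toHom := (eq.symm : C →+* A).comp q
    surj := eq.symm.surjective.comp hq
    ker_eq := by
      ext p
      rw [RingHom.mem_ker, RingHom.comp_apply, RingHom.coe_coe, map_eq_zero_iff _ eq.symm.injective,
        q_zero, Ideal.mem_span_singleton]
    map_X := by
      rw [RingHom.comp_apply, RingHom.coe_coe, RingEquiv.symm_apply_eq]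
      exact F_t.symm }⟩

end formallySmooth

end

end MilnorDlog

namespace MilnorDlog

noncomputable section

/-! ### Local criteria for sheaves of abelian groups -/

section sheafTools

variable {X : TopCat.{u}}

theorem map_homOfLE_comp {F : (Opens X)ᵒᵖ ⥤ AddCommGrpCat.{u}} {U V W : Opens X} (h : V ≤ U)
    (h' : W ≤ V) (s : F.obj (op U)) :
    F.map (homOfLE h').op (F.map (homOfLE h).op s) = F.map (homOfLE (h'.trans h)).op s := by
  rw [← ConcreteCategory.comp_apply, ← F.map_comp]
  rfl

theorem section_eq_zero (S : TopCat.Sheaf AddCommGrpCat.{u} X) {U : Opens X} (s : S.obj.obj (op U))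
    (h : ∀ x ∈ U, ∃ (V : Opens X) (hV : V ≤ U), x ∈ V ∧ S.obj.map (homOfLE hV).op s = 0) :
    s = 0 := by
  choose V hV hxV hs using fun x : U => h x x.2
  refine S.eq_of_locally_eq' V U (fun i => homOfLE (hV i)) (fun x hx => ?_) s 0 (fun i => ?_)
  · exact Opens.mem_iSup.2 ⟨⟨x, hx⟩, hxV _⟩
  · rw [hs]
    exact (map_zero (S.obj.map (homOfLE (hV i)).op).hom).symm

variable {W P A B : TopCat.Sheaf AddCommGrpCat.{u} X}

theorem map_sub_app (f : P ⟶ A) {U : Opens X} (z z' : P.obj.obj (op U)) :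
    f.hom.app (op U) (z - z') = f.hom.app (op U) z - f.hom.app (op U) z' :=
  map_sub (f.hom.app (op U)).hom z z'

/-- Sections of a sheaf with prescribed image under a pair of jointly injective homomorphisms exist
if they exist locally. -/
theorem exists_section_of_local (f₁ : P ⟶ A) (f₂ : P ⟶ B)
    (hinj : ∀ (U : Opens X) (z : P.obj.obj (op U)), f₁.hom.app (op U) z = 0 →
      f₂.hom.app (op U) z = 0 → z = 0) {U : Opens X} (a : A.obj.obj (op U)) (b : B.obj.obj (op U))
    (hloc : ∀ x ∈ U, ∃ (V : Opens X) (hV : V ≤ U) (z : P.obj.obj (op V)), x ∈ V ∧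
      f₁.hom.app (op V) z = A.obj.map (homOfLE hV).op a ∧
      f₂.hom.app (op V) z = B.obj.map (homOfLE hV).op b) :
    ∃ z : P.obj.obj (op U), f₁.hom.app (op U) z = a ∧ f₂.hom.app (op U) z = b := by
  choose V hV z hxV h₁ h₂ using fun x : U => hloc x x.2
  have hcov : U ≤ iSup V := fun x hx => Opens.mem_iSup.2 ⟨⟨x, hx⟩, hxV _⟩
  have nat : ∀ {C : TopCat.Sheaf AddCommGrpCat.{u} X} (f : P ⟶ C) {U V : Opens X} (h : V ≤ U)
      (z : P.obj.obj (op U)), f.hom.app (op V) (P.obj.map (homOfLE h).op z) =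
        C.obj.map (homOfLE h).op (f.hom.app (op U) z) :=
    fun f _ _ h z => NatTrans.naturality_apply f.hom (homOfLE h).op z
  -- Joint injectivity makes the local solutions agree on overlaps.
  obtain ⟨s, hs, -⟩ := P.existsUnique_gluing' V U (fun i => homOfLE (hV i)) hcov z (by
    intro i j
    have key : ∀ {C : TopCat.Sheaf AddCommGrpCat.{u} X} (f : P ⟶ C) (c : C.obj.obj (op U)),
        (∀ i, f.hom.app (op (V i)) (z i) = C.obj.map (homOfLE (hV i)).op c) →
        f.hom.app (op (V i ⊓ V j)) (P.obj.map (homOfLE inf_le_left).op (z i) -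
          P.obj.map (homOfLE inf_le_right).op (z j)) = 0 := fun f c hc => by
      rw [map_sub_app, nat, nat, hc, hc, map_homOfLE_comp, map_homOfLE_comp, sub_self]
    exact sub_eq_zero.1 (hinj _ _ (key f₁ a h₁) (key f₂ b h₂)))
  have fin : ∀ {C : TopCat.Sheaf AddCommGrpCat.{u} X} (f : P ⟶ C) (c : C.obj.obj (op U)),
      (∀ i, f.hom.app (op (V i)) (z i) = C.obj.map (homOfLE (hV i)).op c) →
      f.hom.app (op U) s = c := fun {C} f c hc => by
    refine C.eq_of_locally_eq' V U (fun i => homOfLE (hV i)) hcov _ _ (fun i => ?_)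
    rw [← nat, hs, hc]
  exact ⟨s, fin f₁ a h₁, fin f₂ b h₂⟩

/-- A homomorphism of sheaves into `P`, prescribed by its compositions with a pair of jointly
injective homomorphisms. -/
theorem exists_lift_of_local (f₁ : P ⟶ A) (f₂ : P ⟶ B)
    (hinj : ∀ (U : Opens X) (z : P.obj.obj (op U)), f₁.hom.app (op U) z = 0 →
      f₂.hom.app (op U) z = 0 → z = 0) (g₁ : W ⟶ A) (g₂ : W ⟶ B)
    (hloc : ∀ (U : Opens X) (w : W.obj.obj (op U)), ∀ x ∈ U,
      ∃ (V : Opens X) (hV : V ≤ U) (z : P.obj.obj (op V)), x ∈ V ∧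
      f₁.hom.app (op V) z = A.obj.map (homOfLE hV).op (g₁.hom.app (op U) w) ∧
      f₂.hom.app (op V) z = B.obj.map (homOfLE hV).op (g₂.hom.app (op U) w)) :
    ∃ l : W ⟶ P, l ≫ f₁ = g₁ ∧ l ≫ f₂ = g₂ := by
  choose z h₁ h₂ using fun (U : Opens X) (w : W.obj.obj (op U)) =>
    exists_section_of_local f₁ f₂ hinj _ _ (hloc U w)
  have eq : ∀ {U : Opens X} {s s' : P.obj.obj (op U)}, f₁.hom.app (op U) s = f₁.hom.app (op U) s' →
      f₂.hom.app (op U) s = f₂.hom.app (op U) s' → s = s' := fun h h' => by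
    refine sub_eq_zero.1 (hinj _ _ ?_ ?_)
    · rw [map_sub_app, h, sub_self]
    · rw [map_sub_app, h', sub_self]
  have add : ∀ {C D : TopCat.Sheaf AddCommGrpCat.{u} X} (f : C ⟶ D) {U : Opens X}
      (z z' : C.obj.obj (op U)),
      f.hom.app (op U) (z + z') = f.hom.app (op U) z + f.hom.app (op U) z' :=
    fun f U z z' => map_add (f.hom.app (op U)).hom z z'
  refine ⟨⟨{ app := fun U => AddCommGrpCat.ofHom (AddMonoidHom.mk' (z U.unop) fun w w' => eq ?_ ?_),
             naturality := fun U V i => ConcreteCategory.hom_ext _ _ fun w => ?_ }⟩, ?_, ?_⟩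
  · rw [h₁, add, add, h₁, h₁]
  · rw [h₂, add, add, h₂, h₂]
  · change z V.unop (W.obj.map i w) = P.obj.map i (z U.unop w)
    refine eq ?_ ?_
    · rw [h₁]
      exact (NatTrans.naturality_apply g₁.hom i w).trans ((congrArg _ (h₁ U.unop w).symm).trans
        (NatTrans.naturality_apply f₁.hom i _).symm)
    · rw [h₂]
      exact (NatTrans.naturality_apply g₂.hom i w).trans ((congrArg _ (h₂ U.unop w).symm).trans
        (NatTrans.naturality_apply f₂.hom i _).symm)
  · exact Sheaf.hom_ext (NatTrans.ext (funext fun U => ConcreteCategory.hom_ext _ _ fun w => h₁ _ w))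
  · exact Sheaf.hom_ext (NatTrans.ext (funext fun U => ConcreteCategory.hom_ext _ _ fun w => h₂ _ w))

theorem sheafHom_mono (f : P ⟶ A)
    (hinj : ∀ (U : Opens X) (z : P.obj.obj (op U)), f.hom.app (op U) z = 0 → z = 0) : Mono f := by
  refine Sheaf.mono_of_injective f fun U => ?_
  exact (injective_iff_map_eq_zero (f.hom.app U).hom).2 (hinj U.unop)

theorem sheafHom_epi (f : P ⟶ A) (hsurj : ∀ (U : Opens X) (a : A.obj.obj (op U)), ∀ x ∈ U,
      ∃ (V : Opens X) (hV : V ≤ U) (z : P.obj.obj (op V)), x ∈ V ∧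
        f.hom.app (op V) z = A.obj.map (homOfLE hV).op a) : Epi f := by
  refine (TopCat.Sheaf.isLocallySurjective_iff_epi f).1 ?_
  rw [TopCat.Presheaf.isLocallySurjective_iff]
  intro U a x hx
  obtain ⟨V, hV, z, hxV, hz⟩ := hsurj U a x hx
  exact ⟨V, hV, ⟨z, hz⟩, hxV⟩

/-- Joint injectivity gives uniqueness, which turns local existence of lifts into global existence.
-/
theorem isPullback_of_local {C : TopCat.Sheaf AddCommGrpCat.{u} X} {f₁ : P ⟶ A} {f₂ : P ⟶ B}
    {g₁ : A ⟶ C} {g₂ : B ⟶ C} (w : f₁ ≫ g₁ = f₂ ≫ g₂)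
    (hinj : ∀ (U : Opens X) (z : P.obj.obj (op U)), f₁.hom.app (op U) z = 0 →
      f₂.hom.app (op U) z = 0 → z = 0)
    (hloc : ∀ (U : Opens X) (a : A.obj.obj (op U)) (b : B.obj.obj (op U)),
      g₁.hom.app (op U) a = g₂.hom.app (op U) b → ∀ x ∈ U,
      ∃ (V : Opens X) (hV : V ≤ U) (z : P.obj.obj (op V)), x ∈ V ∧
      f₁.hom.app (op V) z = A.obj.map (homOfLE hV).op a ∧
      f₂.hom.app (op V) z = B.obj.map (homOfLE hV).op b) : IsPullback f₁ f₂ g₁ g₂ := by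
  have lift : ∀ s : PullbackCone g₁ g₂, ∃ l : s.pt ⟶ P, l ≫ f₁ = s.fst ∧ l ≫ f₂ = s.snd := fun s =>
    exists_lift_of_local f₁ f₂ hinj s.fst s.snd fun U w x hx => hloc U _ _
      (ConcreteCategory.congr_hom (congrArg (fun α => α.hom.app (op U)) s.condition) w) x hx
  choose l h₁ h₂ using lift
  refine ⟨⟨w⟩, ⟨PullbackCone.IsLimit.mk w l h₁ h₂ fun s m hm₁ hm₂ => ?_⟩⟩
  refine Sheaf.hom_ext (NatTrans.ext (funext fun U => ConcreteCategory.hom_ext _ _ fun w => ?_))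
  refine sub_eq_zero.1 (hinj U.unop _ ?_ ?_)
  · rw [map_sub_app, sub_eq_zero]
    exact ConcreteCategory.congr_hom (congrArg (fun α => α.hom.app U) (hm₁.trans (h₁ s).symm)) w
  · rw [map_sub_app, sub_eq_zero]
    exact ConcreteCategory.congr_hom (congrArg (fun α => α.hom.app U) (hm₂.trans (h₂ s).symm)) w

end sheafTools

/-! ### Sections of associated sheaves -/

section sheafOf

variable (F : CommRingCat.{u} ⥤ AddCommGrpCat.{u}) (X : Scheme.{u})

/-- Restriction of functions. -/
abbrev resHom {U V : X.Opens} (h : V ≤ U) : Γ(X, U) →+* Γ(X, V) :=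
  (X.presheaf.map (homOfLE h).op).hom

theorem resHom_comp {U V W : X.Opens} (h : V ≤ U) (h' : W ≤ V) :
    (resHom X h').comp (resHom X h) = resHom X (h'.trans h) := by
  rw [← CommRingCat.hom_comp, ← X.presheaf.map_comp]
  rfl

theorem toSection_res {U V : X.Opens} (h : V ≤ U) (a : F.obj Γ(X, U)) :
    (sheafOf F X).obj.map (homOfLE h).op (toSection F X U a) =
      toSection F X V (F.map (CommRingCat.ofHom (resHom X h)) a) :=
  (NatTrans.naturality_apply (toSheafify (Opens.grothendieckTopology X) (X.presheaf ⋙ F))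
    (homOfLE h).op a).symm

theorem sheafOfMap_toSection {F G : CommRingCat.{u} ⥤ AddCommGrpCat.{u}} (α : F ⟶ G) (U : X.Opens)
    (a : F.obj Γ(X, U)) : (sheafOfMap α X).hom.app (op U) (toSection F X U a) =
      toSection G X U (α.app _ a) :=
  ConcreteCategory.congr_hom (congrArg (fun β => β.app (op U))
    (toSheafify_naturality (Opens.grothendieckTopology X) (Functor.whiskerLeft X.presheaf α)).symm) a

theorem exists_toSection_eq {U : X.Opens} (s : (sheafOf F X).obj.obj (op U)) (x : X) (hx : x ∈ U) :
    ∃ (V : X.Opens) (hV : V ≤ U) (a : F.obj Γ(X, V)), x ∈ V ∧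
      toSection F X V a = (sheafOf F X).obj.map (homOfLE hV).op s := by
  have := Presheaf.imageSieve_mem (Opens.grothendieckTopology X)
    (toSheafify (Opens.grothendieckTopology X) (X.presheaf ⋙ F)) (U := op U) s
  obtain ⟨V, i, ⟨a, ha⟩, hxV⟩ := this x hx
  exact ⟨V, i.le, a, hxV, ha⟩

theorem exists_map_eq_zero {U : X.Opens} (a : F.obj Γ(X, U)) (h : toSection F X U a = 0) (x : X)
    (hx : x ∈ U) : ∃ (V : X.Opens) (hV : V ≤ U), x ∈ V ∧
      F.map (CommRingCat.ofHom (resHom X hV)) a = 0 := by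
  have := Presheaf.equalizerSieve_mem (Opens.grothendieckTopology X)
    (toSheafify (Opens.grothendieckTopology X) (X.presheaf ⋙ F)) (X := op U) a 0
    (h.trans (map_zero ((toSheafify (Opens.grothendieckTopology X)
      (X.presheaf ⋙ F)).app (op U)).hom).symm)
  obtain ⟨V, i, h, hxV⟩ := this x hx
  exact ⟨V, i.le, hxV, h.trans (map_zero (F.map (X.presheaf.map i.op)).hom)⟩

theorem toSection_zero (U : X.Opens) : toSection F X U 0 = 0 := map_zero (toSection F X U).hom

theorem toSection_sub (U : X.Opens) (a b : F.obj Γ(X, U)) :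
    toSection F X U (a - b) = toSection F X U a - toSection F X U b :=
  map_sub (toSection F X U).hom a b

theorem sheafOf_hom_ext {S : TopCat.Sheaf AddCommGrpCat.{u} X} {f g : sheafOf F X ⟶ S}
    (h : ∀ (U : X.Opens) (a : F.obj Γ(X, U)),
      f.hom.app (op U) (toSection F X U a) = g.hom.app (op U) (toSection F X U a)) : f = g := by
  refine Sheaf.hom_ext (sheafify_hom_ext _ _ _ S.property ?_)
  exact NatTrans.ext (funext fun U => ConcreteCategory.hom_ext _ _ fun a => h U.unop a)

end sheafOf

end

end MilnorDlog

namespace MilnorDlog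

noncomputable section

/-! ### Geometry of the thickenings X_n -/

section schemeFacts

/-- The quotient map A → A/(f e) factors through the pushout, so nothing beyond the multiples of
f(e) can die there. -/
theorem ker_of_isPushout {R A R' P : CommRingCat.{u}} {f : R ⟶ A} {g : R ⟶ R'} {i : A ⟶ P}
    {j : R' ⟶ P} (h : IsPushout f g i j) (hg : Function.Surjective g.hom) {e : R}
    (hk : RingHom.ker g.hom = Ideal.span {e}) : RingHom.ker i.hom = Ideal.span {f.hom e} := by
  apply le_antisymm
  · let q : A →+* A ⧸ Ideal.span {f.hom e} := Ideal.Quotient.mk _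
    let s : R' →+* A ⧸ Ideal.span {f.hom e} := g.hom.liftOfSurjective hg ⟨q.comp f.hom, fun r hr => by
      rw [hk] at hr
      obtain ⟨c, rfl⟩ := Ideal.mem_span_singleton.1 hr
      refine Ideal.Quotient.eq_zero_iff_mem.2 ?_
      rw [map_mul]
      exact Ideal.mul_mem_right _ _ (Ideal.mem_span_singleton_self _)⟩
    have hs : ∀ r, s (g.hom r) = q (f.hom r) := fun r =>
      g.hom.liftOfRightInverse_comp_apply _ _ ⟨q.comp f.hom, _⟩ r
    let d : P ⟶ CommRingCat.of (A ⧸ Ideal.span {f.hom e}) :=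
      h.desc (CommRingCat.ofHom q) (CommRingCat.ofHom s) (CommRingCat.hom_ext
        (RingHom.ext fun r => (hs r).symm))
    have hd : i ≫ d = CommRingCat.ofHom q := h.inl_desc _ _ _
    intro a ha
    refine Ideal.Quotient.eq_zero_iff_mem.1 ?_
    have := RingHom.congr_fun (congrArg CommRingCat.Hom.hom hd) a
    refine this.symm.trans ?_
    rw [CommRingCat.hom_comp, RingHom.comp_apply, (RingHom.mem_ker).1 ha, map_zero]
  · rw [Ideal.span_singleton_le_iff_mem, RingHom.mem_ker]
    have := RingHom.congr_fun (congrArg CommRingCat.Hom.hom h.w) e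
    rw [CommRingCat.hom_comp, CommRingCat.hom_comp, RingHom.comp_apply, RingHom.comp_apply] at this
    have he : g.hom e = 0 := (RingHom.mem_ker).1 (hk ▸ Ideal.mem_span_singleton_self e)
    rw [this, he, map_zero]

variable {k : Type u} [Field k] {X : Scheme.{u}} (π : X ⟶ BaseS k)

theorem le_preimage_top {Y Z : Scheme.{u}} (f : Y ⟶ Z) (U : Y.Opens) : U ≤ f ⁻¹ᵁ ⊤ := le_top

/-- The structure homomorphism `k[t]/(t^n) → O(U)` for an open subset `U` of `X_n`. -/
def structHom (n : ℕ) (U : (thick π n).Opens) : TruncRing k n →+* Γ(thick π n, U) :=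
  ((pullback.snd π (baseSnToS k n)).appLE ⊤ U (le_preimage_top _ U)).hom.comp
    (Scheme.ΓSpecIso (CommRingCat.of (TruncRing k n))).inv.hom

theorem tFun_eq (n : ℕ) (U : (thick π n).Opens) :
    tFun π n U = structHom π n U (Ideal.Quotient.mk _ Polynomial.X) := rfl

theorem tFun_pow (n : ℕ) (U : (thick π n).Opens) : tFun π n U ^ n = 0 := by
  rw [tFun_eq, ← map_pow, ← map_pow, Ideal.Quotient.eq_zero_iff_mem.2
    (Ideal.mem_span_singleton_self _), map_zero]

theorem resHom_tFun (n : ℕ) {U V : (thick π n).Opens} (h : V ≤ U) :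
    resHom _ h (tFun π n U) = tFun π n V := by
  rw [tFun_eq, tFun_eq, structHom, structHom, ← Scheme.Hom.appLE_map _ (le_preimage_top _ _) (homOfLE h).op]
  rfl

theorem thickMap_snd {m n : ℕ} (h : m ≤ n) :
    thickMap π h ≫ pullback.snd π (baseSnToS k n) = pullback.snd _ _ ≫ baseSnToSn k h :=
  pullback.lift_snd _ _ _

/-- By pasting, X_m is also the fibre product of X_n and S_m over S_n; closedness, surjectivity and
kernels are inherited from S_m → S_n. -/
theorem thickMap_isPullback {m n : ℕ} (h : m ≤ n) :
    IsPullback (thickMap π h) (pullback.snd π (baseSnToS k m)) (pullback.snd π (baseSnToS k n))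
      (baseSnToSn k h) := by
  refine IsPullback.of_right (h₁₂ := pullback.fst π (baseSnToS k n)) (h₂₂ := baseSnToS k n)
    (v₁₃ := π) ?_ (thickMap_snd π h) (IsPullback.of_hasPullback _ _)
  have h1 : thickMap π h ≫ pullback.fst π (baseSnToS k n) = pullback.fst _ _ :=
    pullback.lift_fst _ _ _
  rw [h1, baseSnToSn_comp]
  exact IsPullback.of_hasPullback _ _

theorem truncProj_surjective {m n : ℕ} (h : m ≤ n) : Function.Surjective (truncProj k h) :=
  Ideal.Quotient.factor_surjective _

theorem ker_truncProj {m n : ℕ} (h : m ≤ n) : RingHom.ker (truncProj k h) =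
    Ideal.span {(Ideal.Quotient.mk _ Polynomial.X : TruncRing k n) ^ m} := by
  ext x
  obtain ⟨p, rfl⟩ := Ideal.Quotient.mk_surjective x
  have e : truncProj k h (Ideal.Quotient.mk _ p) = Ideal.Quotient.mk _ p := rfl
  rw [RingHom.mem_ker, e, Ideal.Quotient.eq_zero_iff_mem, Ideal.mem_span_singleton,
    Ideal.mem_span_singleton, ← map_pow]
  constructor
  · exact fun h => map_dvd _ h
  · rintro ⟨c, hc⟩
    obtain ⟨c, rfl⟩ := Ideal.Quotient.mk_surjective c
    rw [← map_mul, Ideal.Quotient.eq, Ideal.mem_span_singleton] at hc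
    have := dvd_add ((pow_dvd_pow Polynomial.X h).trans hc) (dvd_mul_right (Polynomial.X ^ m) c)
    rwa [sub_add_cancel] at this

theorem thickMap_app_structHom {m n : ℕ} (h : m ≤ n) (U : (thick π n).Opens) (x : TruncRing k n) :
    ((thickMap π h).app U).hom (structHom π n U x) =
      structHom π m (thickMap π h ⁻¹ᵁ U) (truncProj k h x) := by
  have e1 : (pullback.snd π (baseSnToS k n)).appLE ⊤ U (le_preimage_top _ U) ≫ (thickMap π h).app U =
      (baseSnToSn k h).appTop ≫
        (pullback.snd π (baseSnToS k m)).appLE ⊤ (thickMap π h ⁻¹ᵁ U) (le_preimage_top _ _) := by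
    have a1 := Scheme.Hom.appLE_comp_appLE (thickMap π h) (pullback.snd π (baseSnToS k n)) ⊤ U
      (thickMap π h ⁻¹ᵁ U) (le_preimage_top _ U) le_rfl
    have a2 := Scheme.Hom.comp_appLE (pullback.snd π (baseSnToS k m)) (baseSnToSn k h) ⊤
      (thickMap π h ⁻¹ᵁ U) (le_preimage_top _ _)
    simp only [thickMap_snd] at a1
    rw [Scheme.Hom.app_eq_appLE]
    exact a1.trans a2
  have e2 := Scheme.ΓSpecIso_inv_naturality (CommRingCat.ofHom (truncProj k h))
  have e3 : (Scheme.ΓSpecIso (CommRingCat.of (TruncRing k n))).inv ≫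
      (pullback.snd π (baseSnToS k n)).appLE ⊤ U (le_preimage_top _ U) ≫ (thickMap π h).app U =
      CommRingCat.ofHom (truncProj k h) ≫ (Scheme.ΓSpecIso (CommRingCat.of (TruncRing k m))).inv ≫
        (pullback.snd π (baseSnToS k m)).appLE ⊤ (thickMap π h ⁻¹ᵁ U) (le_preimage_top _ _) := by
    rw [e1, reassoc_of% e2]
    rfl
  exact ConcreteCategory.congr_hom e3 x

theorem thickMap_app_tFun {m n : ℕ} (h : m ≤ n) (U : (thick π n).Opens) :
    ((thickMap π h).app U).hom (tFun π n U) = tFun π m (thickMap π h ⁻¹ᵁ U) :=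
  thickMap_app_structHom π h U _

instance {m n : ℕ} (h : m ≤ n) : IsClosedImmersion (baseSnToSn k h) :=
  IsClosedImmersion.spec_of_surjective _ (truncProj_surjective h)

instance {m n : ℕ} (h : m ≤ n) : IsClosedImmersion (thickMap π h) :=
  MorphismProperty.of_isPullback (thickMap_isPullback π h).flip inferInstance

theorem thickMap_app_surjective {m n : ℕ} (h : m ≤ n) {U : (thick π n).Opens}
    (hU : IsAffineOpen U) : Function.Surjective ((thickMap π h).app U).hom :=
  Scheme.Hom.app_surjective _ U hU

/-- Sections of this fibre product over an affine open form a pushout of rings, and the kernel of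
k[t]/(t^n) → k[t]/(t^m) is generated by t^m. -/
theorem ker_thickMap_app {m n : ℕ} (h : m ≤ n) {U : (thick π n).Opens} (hU : IsAffineOpen U) :
    RingHom.ker ((thickMap π h).app U).hom = Ideal.span {tFun π n U ^ m} := by
  have H := thickMap_isPullback π h
  have iso := isIso_pushoutSection_of_isAffineOpen H (US := ⊤) (UT := ⊤) (UX := U)
    (UY := thickMap π h ⁻¹ᵁ U) (le_preimage_top _ _) (le_preimage_top _ _) (by simp) (isAffineOpen_top _) (isAffineOpen_top _) hU
  have P := (isIso_pushoutSection_iff ..).1 iso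
  have e2 := Scheme.ΓSpecIso_inv_naturality (CommRingCat.ofHom (truncProj k h))
  have e3 : (baseSnToSn k h).appLE ⊤ ⊤ (le_preimage_top _ _) = (baseSnToSn k h).appTop := by
    rw [Scheme.Hom.appTop, Scheme.Hom.app_eq_appLE]
    rfl
  have e4 : ∀ x, ((baseSnToSn k h).appLE ⊤ ⊤ (le_preimage_top _ _)).hom
      ((Scheme.ΓSpecIso (CommRingCat.of (TruncRing k n))).inv.hom x) =
      (Scheme.ΓSpecIso (CommRingCat.of (TruncRing k m))).inv.hom (truncProj k h x) := fun x => by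
    rw [e3]
    exact (ConcreteCategory.congr_hom e2 x).symm
  have bij : ∀ n, Function.Bijective
      (Scheme.ΓSpecIso (CommRingCat.of (TruncRing k n))).inv.hom := fun n =>
    ConcreteCategory.bijective_of_isIso (Scheme.ΓSpecIso (CommRingCat.of (TruncRing k n))).inv
  have := ker_of_isPushout P (e := (Scheme.ΓSpecIso (CommRingCat.of (TruncRing k n))).inv.hom
    ((Ideal.Quotient.mk _ Polynomial.X : TruncRing k n) ^ m)) ?_ ?_
  · rw [Scheme.Hom.app_eq_appLE, this, map_pow, map_pow]
    rfl
  · intro y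
    obtain ⟨x, rfl⟩ := (bij m).2 y
    obtain ⟨x, rfl⟩ := truncProj_surjective h x
    exact ⟨_, e4 x⟩
  · ext y
    obtain ⟨x, rfl⟩ := (bij n).2 y
    rw [RingHom.mem_ker, e4, map_eq_zero_iff _ (bij m).1, ← RingHom.mem_ker, ker_truncProj,
      Ideal.mem_span_singleton, Ideal.mem_span_singleton]
    constructor
    · exact fun h => map_dvd _ h
    · rintro ⟨c, hc⟩
      obtain ⟨c, rfl⟩ := (bij n).2 c
      rw [← map_mul] at hc
      exact ⟨c, (bij n).1 hc⟩

theorem natUnits_thick [CharZero k] (n : ℕ) (U : (thick π n).Opens) : NatUnits Γ(thick π n, U) := by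
  have : NatUnits k := fun m hm => (Nat.cast_ne_zero.2 hm).isUnit
  exact this.map ((structHom π n U).comp ((Ideal.Quotient.mk _).comp Polynomial.C))

/-- Every prime of k[t]/(t^n) contains the nilpotent t, hence t^m as m ≥ 1; surjectivity is stable
under base change. -/
theorem thickMap_surjective {m n : ℕ} (hm : 1 ≤ m) (h : m ≤ n) :
    Function.Surjective (thickMap π h) := by
  have : Surjective (baseSnToSn k h) := by
    refine ⟨Set.range_eq_univ.1 ((range_comap_of_surjective _ (truncProj k h)
      (truncProj_surjective h)).trans (Set.eq_univ_of_forall fun p => ?_))⟩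
    rw [PrimeSpectrum.mem_zeroLocus, ker_truncProj, SetLike.coe_subset_coe,
      Ideal.span_singleton_le_iff_mem]
    refine Ideal.pow_mem_of_mem _ (p.2.mem_of_pow_mem n ?_) m hm
    rw [← map_pow, Ideal.Quotient.eq_zero_iff_mem.2 (Ideal.mem_span_singleton_self _)]
    exact zero_mem _
  have : Surjective (thickMap π h) :=
    MorphismProperty.of_isPullback (thickMap_isPullback π h).flip inferInstance
  exact this.surj

/-- Together with surjectivity this expresses that X_m and X_n have the same open sets. -/
theorem exists_preimage_eq {m n : ℕ} (h : m ≤ n) (V : (thick π m).Opens) :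
    ∃ U : (thick π n).Opens, thickMap π h ⁻¹ᵁ U = V := by
  obtain ⟨U, hU, e⟩ := (thickMap π h).isClosedEmbedding.isInducing.isOpen_iff.1 V.2
  exact ⟨⟨U, hU⟩, Opens.ext e⟩

theorem exists_truncData_of_hom {n : ℕ} (hn : 1 ≤ n) {A : Type u} [CommRing A]
    (f : TruncRing k n →+* A) (hf : f.FormallySmooth) :
    ∃ (R : Type u) (_ : CommRing R),
      Nonempty (TruncData R A (f (Ideal.Quotient.mk _ Polynomial.X)) n) := by
  algebraize [f]
  exact ⟨_, inferInstance, exists_truncData (k := k) (A := A) hn⟩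

variable [Smooth π]

theorem structHom_formallySmooth {n : ℕ} {U : (thick π n).Opens} (hU : IsAffineOpen U) :
    (structHom π n U).FormallySmooth := by
  refine RingHom.FormallySmooth.comp (RingHom.FormallySmooth.of_bijective
    (ConcreteCategory.bijective_of_isIso (Scheme.ΓSpecIso (CommRingCat.of (TruncRing k n))).inv)) ?_
  exact (Scheme.Hom.smooth_appLE _ (isAffineOpen_top _) hU _).formallySmooth

theorem exists_truncData_section {n : ℕ} (hn : 1 ≤ n) {U : (thick π n).Opens}
    (hU : IsAffineOpen U) : ∃ (R : Type u) (_ : CommRing R),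
      Nonempty (TruncData R Γ(thick π n, U) (tFun π n U) n) :=
  exists_truncData_of_hom hn _ (structHom_formallySmooth π hU)

/-- Localization preserves formal smoothness, so the stalk is itself a truncated polynomial ring.
Injectivity of dlog is available only for local rings and is applied here. -/
theorem exists_truncData_stalk {n : ℕ} (hn : 1 ≤ n) {U : (thick π n).Opens}
    (hU : IsAffineOpen U) (x : thick π n) (hx : x ∈ U) : ∃ (R : Type u) (_ : CommRing R),
      Nonempty (TruncData R ((thick π n).presheaf.stalk x)
        (((thick π n).presheaf.germ U x hx).hom (tFun π n U)) n) := by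
  have hg : ((thick π n).presheaf.germ U x hx).hom.FormallySmooth := by
    let _ := (thick π n).presheaf.algebra_section_stalk ⟨x, hx⟩
    have := hU.isLocalization_stalk ⟨x, hx⟩
    exact RingHom.formallySmooth_algebraMap.2
      (Algebra.FormallySmooth.of_isLocalization (hU.primeIdealOf ⟨x, hx⟩).asIdeal.primeCompl)
  exact exists_truncData_of_hom hn _ ((structHom_formallySmooth π hU).comp hg)

end schemeFacts

end

end MilnorDlog

namespace MilnorDlog

noncomputable section

/-! ### Milnor K-groups and stalks -/

section stalks

variable {X : Scheme.{u}} {x : X}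

theorem exists_common_open {ι : Type*} [Fintype ι] (V : ι → X.Opens) (hx : ∀ l, x ∈ V l) :
    ∃ W : X.Opens, x ∈ W ∧ ∀ l, W ≤ V l := by
  refine ⟨Finset.univ.inf V, ?_, fun l => Finset.inf_le (Finset.mem_univ l)⟩
  rw [← SetLike.mem_coe, Opens.coe_finset_inf]
  simpa using hx

/-- The homomorphism from functions to germs. -/
abbrev germHom (U : X.Opens) (hx : x ∈ U) : Γ(X, U) →+* X.presheaf.stalk x :=
  (X.presheaf.germ U x hx).hom

theorem resHom_resHom {U V W : X.Opens} (h : V ≤ U) (h' : W ≤ V) (a : Γ(X, U)) :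
    resHom X h' (resHom X h a) = resHom X (h'.trans h) a :=
  RingHom.congr_fun (resHom_comp X h h') a

theorem germHom_resHom {U V : X.Opens} (h : V ≤ U) (hx : x ∈ V) (a : Γ(X, U)) :
    germHom V hx (resHom X h a) = germHom U (h hx) a :=
  X.presheaf.germ_res_apply (homOfLE h) x hx a

theorem exists_resHom_eq {U V : X.Opens} (hxU : x ∈ U) (hxV : x ∈ V) (a : Γ(X, U)) (b : Γ(X, V))
    (h : germHom U hxU a = germHom V hxV b) :
    ∃ (W : X.Opens) (hU : W ≤ U) (hV : W ≤ V), x ∈ W ∧ resHom X hU a = resHom X hV b := by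
  obtain ⟨W, hxW, iU, iV, e⟩ := X.presheaf.germ_eq x hxU hxV a b h
  exact ⟨W, iU.le, iV.le, hxW, e⟩

theorem exists_unit_res {U : X.Opens} (hx : x ∈ U) (a : Γ(X, U)) (h : IsUnit (germHom U hx a)) :
    ∃ (V : X.Opens) (hV : V ≤ U), x ∈ V ∧ IsUnit (resHom X hV a) :=
  ⟨X.basicOpen a, X.basicOpen_le a, (X.mem_basicOpen a x hx).2 h,
    RingedSpace.isUnit_res_basicOpen X.toRingedSpace a⟩

theorem exists_units_germ {ι : Type*} [Fintype ι] (v : ι → (X.presheaf.stalk x)ˣ) :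
    ∃ (W : X.Opens) (hx : x ∈ W) (w : ι → Γ(X, W)ˣ), ∀ l, Units.map (germHom W hx).toMonoidHom (w l) = v l := by
  have : ∀ l, ∃ (W : X.Opens) (hx : x ∈ W) (w : Γ(X, W)ˣ), Units.map (germHom W hx).toMonoidHom w = v l := by
    intro l
    obtain ⟨U, hxU, a, ha⟩ := X.presheaf.exists_germ_eq (v l : X.presheaf.stalk x)
    obtain ⟨V, hV, hxV, w, hw⟩ := exists_unit_res hxU a (by
      rw [show germHom U hxU a = v l from ha]; exact Units.isUnit _)
    refine ⟨V, hxV, w, Units.ext ?_⟩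
    change germHom V hxV w = _
    rw [hw, germHom_resHom]
    exact ha
  choose V hxV w hw using this
  obtain ⟨W, hxW, hW⟩ := exists_common_open V hxV
  refine ⟨W, hxW, fun l => Units.map (resHom X (hW l)).toMonoidHom (w l), fun l => ?_⟩
  rw [← hw l]
  exact Units.ext (germHom_resHom (hW l) hxW _)

/-- An element of `K^M_r(O(U))` whose germ in `K^M_r(O_x)` vanishes is zero near `x`. -/
theorem exists_mapMilnor_resHom_eq_zero {r : ℕ} {U : X.Opens} (hx : x ∈ U)
    {z : MilnorK r Γ(X, U)} (hz : mapMilnor r (germHom U hx) z = 0) :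
    ∃ (V : X.Opens) (hV : V ≤ U), x ∈ V ∧ mapMilnor r (resHom X hV) z = 0 := by
  classical
  -- The group K^M_r(O_x) is mapped to the stalk of U ↦ K^M_r(O(U)) by lifting entries to a
  -- neighbourhood; `key` is independence of the lift.
  let F : TopCat.Presheaf AddCommGrpCat.{u} X := X.presheaf ⋙ milnorFunctor r
  let γ : ∀ (W : X.Opens), x ∈ W → MilnorK r Γ(X, W) →+ (F.stalk x : AddCommGrpCat.{u}) :=
    fun W hW => (F.germ W x hW).hom
  have γ_res : ∀ {W W' : X.Opens} (h : W' ≤ W) (hx : x ∈ W') (s : MilnorK r Γ(X, W)),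
      γ W' hx (mapMilnor r (resHom X h) s) = γ W (h hx) s := fun h hx s =>
    F.germ_res_apply (homOfLE h) x hx s
  have key : ∀ {W W' : X.Opens} (hW : x ∈ W) (hW' : x ∈ W') (w : Fin r → Γ(X, W)ˣ)
      (w' : Fin r → Γ(X, W')ˣ), (∀ l, Units.map (germHom W hW).toMonoidHom (w l) =
        Units.map (germHom W' hW').toMonoidHom (w' l)) →
      γ W hW (symbol r w) = γ W' hW' (symbol r w') := by
    intro W W' hW hW' w w' h
    choose V h1 h2 hxV e using fun l => exists_resHom_eq hW hW' (w l : Γ(X, W)) (w' l : Γ(X, W'))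
      (congrArg Units.val (h l))
    obtain ⟨V', hxV', hV'⟩ := exists_common_open (fun o : Option (Fin r) => o.elim (W ⊓ W') V)
      (fun o => by cases o with
        | none => exact ⟨hW, hW'⟩
        | some l => exact hxV l)
    have k1 : V' ≤ W := (hV' none).trans inf_le_left
    have k2 : V' ≤ W' := (hV' none).trans inf_le_right
    rw [← γ_res k1 hxV', ← γ_res k2 hxV', mapMilnor_symbol, mapMilnor_symbol]
    congr 2
    funext l
    refine Units.ext ?_
    change resHom X k1 (w l) = resHom X k2 (w' l)
    have hl : V' ≤ V l := hV' (some l)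
    have := congrArg (resHom X hl) (e l)
    rwa [resHom_resHom, resHom_resHom] at this
  choose W hW w hw using fun v : Fin r → (X.presheaf.stalk x)ˣ => exists_units_germ v
  let g : (Fin r → Additive (X.presheaf.stalk x)ˣ) → (F.stalk x : AddCommGrpCat.{u}) := fun v =>
    γ _ (hW fun l => (v l).toMul) (symbol r (w fun l => (v l).toMul))
  have hg : ∀ {W : X.Opens} (hW : x ∈ W) (w : Fin r → Γ(X, W)ˣ),
      g (fun l => Additive.ofMul (Units.map (germHom W hW).toMonoidHom (w l))) = γ W hW (symbol r w) :=
    fun hW' w' => key _ _ _ _ (hw _)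
  have upd : ∀ {W : X.Opens} (hW : x ∈ W) (a : Fin r → Γ(X, W)ˣ) (i : Fin r) (b : Γ(X, W)ˣ),
      Function.update (fun l => Additive.ofMul (Units.map (germHom W hW).toMonoidHom (a l))) i
        (Additive.ofMul (Units.map (germHom W hW).toMonoidHom b)) =
      fun l => Additive.ofMul (Units.map (germHom W hW).toMonoidHom (Function.update a i b l)) := by
    intro W hW a i b
    funext l
    by_cases hl : l = i
    · subst hl; simp
    · simp [Function.update_of_ne hl]
  have sym : ∀ {W : X.Opens} (a : Fin r → Γ(X, W)ˣ) (i : Fin r) (b : Γ(X, W)ˣ),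
      symbol r (Function.update a i b) = symbolHom r Γ(X, W)
        (Function.update (fun l => Additive.ofMul (a l)) i (Additive.ofMul b)) := by
    intro W a i b
    rw [← symbolHom_apply]
    congr 1
  let φ : MultilinearMap ℤ (fun _ : Fin r => Additive (X.presheaf.stalk x)ˣ)
      (F.stalk x : AddCommGrpCat.{u}) := MultilinearMap.mk' g (by
      intro v i a b
      -- All entries, including the two to be added, are lifted over a common neighbourhood, where
      -- additivity holds for actual symbols.
      obtain ⟨W, hW, w, hw⟩ := exists_units_germ (Sum.elim (fun l => (v l).toMul)
        (fun o : Bool => if o then a.toMul else b.toMul))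
      have hv : v = fun l => Additive.ofMul (Units.map (germHom W hW).toMonoidHom (w (Sum.inl l))) :=
        funext fun l => (hw (Sum.inl l)).symm
      have ha : a = Additive.ofMul (Units.map (germHom W hW).toMonoidHom (w (Sum.inr true))) :=
        (hw (Sum.inr true)).symm
      have hb : b = Additive.ofMul (Units.map (germHom W hW).toMonoidHom (w (Sum.inr false))) :=
        (hw (Sum.inr false)).symm
      rw [hv, ha, hb, ← ofMul_mul, ← map_mul, upd, upd, upd, hg, hg, hg, sym, sym, sym, ofMul_mul,
        MultilinearMap.map_update_add, map_add]) (by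
      intro v i c a
      obtain ⟨W, hW, w, hw⟩ := exists_units_germ (Sum.elim (fun l => (v l).toMul)
        (fun _ : Unit => a.toMul))
      have hv : v = fun l => Additive.ofMul (Units.map (germHom W hW).toMonoidHom (w (Sum.inl l))) :=
        funext fun l => (hw (Sum.inl l)).symm
      have ha : a = Additive.ofMul (Units.map (germHom W hW).toMonoidHom (w (Sum.inr ()))) :=
        (hw (Sum.inr ())).symm
      rw [hv, ha, ← ofMul_zpow, ← map_zpow, upd, upd, hg, hg, sym, sym, ofMul_zpow,
        MultilinearMap.map_update_smul, map_zsmul])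
  let Φ : MilnorK r (X.presheaf.stalk x) →+ (F.stalk x : AddCommGrpCat.{u}) := milnorLift r φ (by
    intro a i j hij h
    obtain ⟨W, hW, w, hw⟩ := exists_units_germ a
    -- A Steinberg relation between germs already holds on a neighbourhood.
    obtain ⟨V, h1, h2, hxV, e⟩ := exists_resHom_eq hW hW ((w i : Γ(X, W)) + w j) 1 (by
      rw [map_add, map_one, ← h, ← hw i, ← hw j]; rfl)
    have ha : (fun l => Additive.ofMul (a l)) = fun l => Additive.ofMul (Units.map
        (germHom V hxV).toMonoidHom (Units.map (resHom X h1).toMonoidHom (w l))) := by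
      funext l
      rw [← hw l]
      exact congrArg Additive.ofMul (Units.ext (germHom_resHom h1 hxV _).symm)
    change g _ = 0
    rw [ha, hg, symbol_eq_zero _ i j hij, map_zero]
    rw [map_add, map_one] at e
    exact e)
  have hΦ : Φ.comp (mapMilnor r (germHom U hx)) = γ U hx := milnor_hom_ext fun a => by
    rw [AddMonoidHom.comp_apply, mapMilnor_symbol, milnorLift_symbol]
    exact hg hx a
  have h0 : γ U hx z = γ U hx 0 := by
    rw [← hΦ, AddMonoidHom.comp_apply, hz, map_zero, map_zero]
  obtain ⟨V, hxV, i1, i2, e⟩ := F.germ_eq x hx hx z 0 h0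
  exact ⟨V, i1.le, hxV, e.trans (map_zero (F.map i2.op).hom)⟩

end stalks

end

end MilnorDlog

namespace MilnorDlog

noncomputable section

/-! ### Injectivity and lifting near a point -/

section localStatements

theorem isUnit_of_map {A B : Type u} [CommRing A] [CommRing B] (f : A →+* B)
    (hf : Function.Surjective f) {t : A} {n m : ℕ} (ht : t ^ n = 0) (hm : 1 ≤ m)
    (hk : RingHom.ker f = Ideal.span {t ^ m}) (a : A) (ha : IsUnit (f a)) : IsUnit a := by
  obtain ⟨c, hc⟩ := ha.exists_right_inv
  obtain ⟨c, rfl⟩ := hf c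
  have h : a * c - 1 ∈ Ideal.span {t ^ m} := by
    rw [← hk, RingHom.mem_ker, map_sub, map_mul, hc, map_one, sub_self]
  obtain ⟨d, hd⟩ := Ideal.mem_span_singleton.1 h
  have hnil : IsNilpotent (t ^ m) := IsNilpotent.pow_of_pos ⟨n, ht⟩ (by omega)
  have : IsUnit (a * c) := by
    rw [sub_eq_iff_eq_add'.1 hd]
    exact ((Commute.all _ _).isNilpotent_mul_right hnil).isUnit_one_add
  exact isUnit_of_mul_isUnit_left this

theorem exists_affine_le {X : Scheme.{u}} {U : X.Opens} {x : X} (hx : x ∈ U) :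
    ∃ V : X.Opens, IsAffineOpen V ∧ V ≤ U ∧ x ∈ V := by
  obtain ⟨V, hV, hxV, h⟩ := exists_isAffineOpen_mem_and_subset hx
  exact ⟨V, hV, h, hxV⟩

theorem mapDeg_comp {A B C : Type u} [CommRing A] [CommRing B] [CommRing C] {r : ℕ} (g : B →+* C)
    (f : A →+* B) (ω : ⋀[A]^r Ω[A⁄ℤ]) : mapDeg r (g.comp f) ω = mapDeg r g (mapDeg r f ω) :=
  Subtype.ext (mapForms_comp g f ω)

section squares

variable {A B C D : Type u} [CommRing A] [CommRing B] [CommRing C] [CommRing D] {f : A →+* B}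
  {g : A →+* C} {f' : C →+* D} {g' : B →+* D}

theorem mapMilnor_square (w : f'.comp g = g'.comp f) {r : ℕ} (z : MilnorK r A) :
    mapMilnor r f' (mapMilnor r g z) = mapMilnor r g' (mapMilnor r f z) := by
  rw [← mapMilnor_comp, w, mapMilnor_comp]

theorem mapDeg_square (w : f'.comp g = g'.comp f) {r : ℕ} (z : ⋀[A]^r Ω[A⁄ℤ]) :
    mapDeg r f' (mapDeg r g z) = mapDeg r g' (mapDeg r f z) := by
  rw [← mapDeg_comp, w, mapDeg_comp]

theorem exists_comp_eq (hf : Function.Surjective f) {e : A} (hk : RingHom.ker f = Ideal.span {e})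
    (hg : g e = 0) : ∃ σ : B →+* C, σ.comp f = g := by
  have hle : ∀ a ∈ RingHom.ker f, g a = 0 := fun a ha => by
    rw [hk] at ha
    obtain ⟨c, rfl⟩ := Ideal.mem_span_singleton.1 ha
    rw [map_mul, hg, zero_mul]
  exact ⟨f.liftOfSurjective hf ⟨g, hle⟩, RingHom.ext fun a =>
    f.liftOfRightInverse_comp_apply _ (Function.rightInverse_surjInv hf) ⟨g, hle⟩ a⟩

/-- The map A → C → C/t^m factors through B, so the vanishing over B passes to C/t^m, where the
injectivity theorem for the local ring C applies. -/
theorem mapMilnor_eq_zero_of_isLocalRing [IsLocalRing C] {R : Type u} [CommRing R] {t : A} {m n : ℕ}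
    (T : TruncData R C (g t) n) (hQ : NatUnits C) (hm : 1 ≤ m) (hmn : m ≤ n)
    (hf : Function.Surjective f) (hk : RingHom.ker f = Ideal.span {t ^ m}) {r : ℕ} {z : MilnorK r A}
    (hz : mapMilnor r f z = 0) (hd : dlogForms r A z = 0) : mapMilnor r g z = 0 := by
  let q := Ideal.Quotient.mk (Ideal.span {g t ^ m})
  obtain ⟨σ, hσ⟩ := exists_comp_eq (g := q.comp g) hf hk (by
    rw [RingHom.comp_apply, map_pow]
    exact Ideal.Quotient.eq_zero_iff_mem.2 (Ideal.mem_span_singleton_self _))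
  refine T.eq_zero_of_mapMilnor hQ hm hmn q Ideal.Quotient.mk_surjective Ideal.mk_ker ?_ ?_
  · rw [← mapMilnor_comp, ← hσ, mapMilnor_comp, hz, map_zero]
  · rw [dlogForms_mapMilnor, hd, map_zero]

/-- The `(p+1)`-form `ω` is the logarithmic derivative of a symbol which vanishes under `f`. -/
def IsRelLog (p : ℕ) (f : A →+* B) (ω : Forms A) : Prop :=
  ∃ z : MilnorK (p + 1) A, mapMilnor (p + 1) f z = 0 ∧ (dlogForms (p + 1) A z : Forms A) = ω

theorem IsRelLog.add {p : ℕ} {ω ω' : Forms A} (h : IsRelLog p f ω) (h' : IsRelLog p f ω') :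
    IsRelLog p f (ω + ω') := by
  obtain ⟨z, h1, h2⟩ := h
  obtain ⟨z', h1', h2'⟩ := h'
  refine ⟨z + z', by rw [map_add, h1, h1', add_zero], ?_⟩
  rw [map_add, Submodule.coe_add, h2, h2']

theorem IsRelLog.map {p : ℕ} {ω : Forms A} (h : IsRelLog p f ω) (w : f'.comp g = g'.comp f) :
    IsRelLog p f' (mapForms g ω) := by
  obtain ⟨z, h1, h2⟩ := h
  refine ⟨mapMilnor (p + 1) g z, by rw [mapMilnor_square w, h1, map_zero], ?_⟩
  rw [dlogForms_mapMilnor, ← h2]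
  rfl

/-- Translating b_i by a natural number does not change db_i but makes its image a unit, after which
the exponential supplies the symbol. -/
theorem isRelLog_extD (hQ : NatUnits C) {s : C} {n m : ℕ} (hs : s ^ n = 0) (hm : 1 ≤ m)
    (hf : f' (s ^ m) = 0) {t : A} (ht : g t = s) {p : ℕ} (a : A) (b : Fin p → A) (c : Fin p → ℕ)
    (hu : ∀ i, IsUnit (g (b i + c i))) : IsRelLog p f' (mapForms g (extD A
      (t ^ m • a • ((List.ofFn b).map (dElem A)).prod))) := by
  choose v hv using hu
  obtain ⟨e, ⟨d, hd⟩, he⟩ := exists_dlogForms_eq_extD hQ hs hm (g a) v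
  refine ⟨symbol (p + 1) (Fin.cons e v), ?_, ?_⟩
  · rw [mapMilnor_symbol]
    refine symbol_eq_zero_of_eq_one _ 0 (Units.ext ?_)
    change f' e = 1
    rw [hd, map_add, map_one, map_mul, hf, zero_mul, add_zero]
  · rw [he, ← extD_mapForms, mapForms_smul, mapForms_smul, map_pow, ht, map_list_prod]
    congr 4
    rw [List.map_ofFn, List.map_ofFn, List.map_ofFn]
    congr 1
    funext i
    simp only [Function.comp_apply]
    rw [mapForms_dElem, hv, map_add, map_natCast, map_add, dElem_natCast, add_zero]

/-- The primitive is cut down to a single degree. In degree 0 there is no primitive, as exact forms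
have no component there, and the form vanishes. -/
theorem exists_eq_extD_of_mapDeg {R : Type u} [CommRing R] {t : A} {m n : ℕ}
    (T : TruncData R A t n) (hQ : NatUnits A) (hm : 1 ≤ m) (hmn : m ≤ n)
    (hf : Function.Surjective f) (hk : RingHom.ker f = Ideal.span {t ^ m}) {r : ℕ}
    (ω : ⋀[A]^r Ω[A⁄ℤ]) (hω : extDeriv A r ω = 0) (h0 : mapDeg r f ω = 0) :
    (r = 0 ∧ ω = 0) ∨ ∃ (p : ℕ) (η : ⋀[A]^p Ω[A⁄ℤ]), r = p + 1 ∧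
      (ω : Forms A) = extD A (t ^ m • (η : Forms A)) := by
  obtain ⟨η, hη⟩ := T.exists_eq_extD_smul hQ f hf hm hmn hk
    (congrArg Subtype.val hω) (congrArg Subtype.val h0)
  cases r with
  | zero =>
    refine Or.inl ⟨rfl, Subtype.ext ?_⟩
    rw [← formsProj_of_mem ω.2, hη, formsProj_zero_extD]
    rfl
  | succ p =>
    refine Or.inr ⟨p, ⟨formsProj p η, formsProj_mem p η⟩, rfl, ?_⟩
    rw [← formsProj_of_mem ω.2, hη, formsProj_extD, formsProj_smul]

theorem exists_sub_dlogForms_eq {R : Type u} [CommRing R] {t : A} {m n : ℕ}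
    (T : TruncData R A t n) (hQ : NatUnits A) (hm : 1 ≤ m) (hmn : m ≤ n)
    (hf : Function.Surjective f) (hk : RingHom.ker f = Ideal.span {t ^ m}) {r : ℕ}
    (a : MilnorK r A) (b : ⋀[A]^r Ω[A⁄ℤ]) (hb : extDeriv A r b = 0)
    (hab : dlogForms r B (mapMilnor r f a) = mapDeg r f b) :
    (r = 0 ∧ dlogForms r A a = b) ∨ ∃ (p : ℕ) (η : ⋀[A]^p Ω[A⁄ℤ]), r = p + 1 ∧
      ((b - dlogForms r A a : ⋀[A]^r Ω[A⁄ℤ]) : Forms A) = extD A (t ^ m • (η : Forms A)) := by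
  have hc : extDeriv A r (b - dlogForms r A a) = 0 := by
    rw [map_sub, hb, zero_sub, neg_eq_zero]
    exact (dlogClosed r A a).2
  have h0 : mapDeg r f (b - dlogForms r A a) = 0 := by
    rw [map_sub, ← hab, dlogForms_mapMilnor, sub_self]
  exact (exists_eq_extD_of_mapDeg T hQ hm hmn hf hk _ hc h0).imp_left
    fun h => ⟨h.1, (sub_eq_zero.1 h.2).symm⟩

theorem exists_milnor_lift_of_isRelLog (w : f'.comp g = g'.comp f) {p : ℕ} (a : MilnorK (p + 1) A)
    (b : ⋀[A]^(p + 1) Ω[A⁄ℤ])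
    (h : IsRelLog p f' (mapForms g (b - dlogForms (p + 1) A a : ⋀[A]^(p + 1) Ω[A⁄ℤ]))) :
    ∃ z : MilnorK (p + 1) C, mapMilnor (p + 1) f' z = mapMilnor (p + 1) g' (mapMilnor (p + 1) f a) ∧
      dlogForms (p + 1) C z = mapDeg (p + 1) g b := by
  obtain ⟨z, h1, h2⟩ := h
  refine ⟨mapMilnor _ g a + z, by rw [map_add, h1, add_zero, mapMilnor_square w], Subtype.ext ?_⟩
  rw [map_add, Submodule.coe_add, h2, dlogForms_mapMilnor]
  change mapForms g _ + mapForms g _ = mapForms g _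
  rw [← map_add, ← Submodule.coe_add, add_sub_cancel]

end squares

variable {k : Type u} [Field k] {X : Scheme.{u}} (π : X ⟶ BaseS k)

/-- Restriction of functions from `U ⊆ X_n` to `X_m`. -/
abbrev thickHom {m n : ℕ} (h : m ≤ n) (U : (thick π n).Opens) :
    Γ(thick π n, U) →+* Γ(thick π m, thickMap π h ⁻¹ᵁ U) := ((thickMap π h).app U).hom

theorem preimage_le {Y Z : Scheme.{u}} (f : Y ⟶ Z) {U V : Z.Opens} (h : V ≤ U) :
    f ⁻¹ᵁ V ≤ f ⁻¹ᵁ U := fun _ hx => h hx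

theorem thickHom_comp_resHom {m n : ℕ} (h : m ≤ n) {U V : (thick π n).Opens} (hV : V ≤ U) :
    (thickHom π h V).comp (resHom _ hV) =
      (resHom _ (preimage_le (thickMap π h) hV)).comp (thickHom π h U) :=
  congrArg CommRingCat.Hom.hom ((thickMap π h).naturality (homOfLE hV).op)

theorem thickHom_tFun_pow {m n : ℕ} (h : m ≤ n) (U : (thick π n).Opens) :
    thickHom π h U (tFun π n U ^ m) = 0 := by
  rw [map_pow]
  exact (congrArg (· ^ m) (thickMap_app_tFun π h U)).trans (tFun_pow π m _)

theorem mapMilnor_thickHom_resHom {r m n : ℕ} (h : m ≤ n) {U V : (thick π n).Opens} (hV : V ≤ U)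
    (z : MilnorK r Γ(thick π n, U)) :
    mapMilnor r (thickHom π h V) (mapMilnor r (resHom _ hV) z) =
      mapMilnor r (resHom _ (preimage_le (thickMap π h) hV)) (mapMilnor r (thickHom π h U) z) := by
  rw [← mapMilnor_comp, thickHom_comp_resHom, mapMilnor_comp]

/-- Vanishing is proved over the local ring at x and then spread to a neighbourhood. -/
theorem exists_restriction_eq_zero [CharZero k] [Smooth π] {r m n : ℕ} (hm : 1 ≤ m) (h : m ≤ n)
    {U : (thick π n).Opens} {x : thick π n} (hx : x ∈ U) (z : MilnorK r Γ(thick π n, U))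
    (h1 : mapMilnor r (thickHom π h U) z = 0) (h2 : dlogForms r _ z = 0) :
    ∃ (V : (thick π n).Opens) (hV : V ≤ U), x ∈ V ∧ mapMilnor r (resHom _ hV) z = 0 := by
  obtain ⟨V, hVa, hVU, hxV⟩ := exists_affine_le hx
  obtain ⟨R, _, ⟨T⟩⟩ := exists_truncData_stalk π (hm.trans h) hVa x hxV
  have e : mapMilnor r (germHom V hxV) (mapMilnor r (resHom _ hVU) z) = 0 :=
    mapMilnor_eq_zero_of_isLocalRing T ((natUnits_thick π n V).map (germHom V hxV)) hm h
      (thickMap_app_surjective π h hVa) (ker_thickMap_app π h hVa)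
      (by rw [mapMilnor_thickHom_resHom, h1, map_zero]) (by rw [dlogForms_mapMilnor, h2, map_zero])
  obtain ⟨W, hW, hxW, e'⟩ := exists_mapMilnor_resHom_eq_zero hxV e
  refine ⟨W, hW.trans hVU, hxW, ?_⟩
  rwa [← mapMilnor_comp, resHom_comp] at e'

/-- Near `x`, the form `d(t^m η)` is logarithmic. -/
theorem exists_isRelLog [CharZero k] {p m n : ℕ} (hm : 1 ≤ m) (h : m ≤ n)
    {U : (thick π n).Opens} {x : thick π n} (hx : x ∈ U) {η : Forms Γ(thick π n, U)}
    (hη : η ∈ ⋀[Γ(thick π n, U)]^p Ω[Γ(thick π n, U)⁄ℤ]) :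
    ∃ (V : (thick π n).Opens) (hV : V ≤ U), x ∈ V ∧ IsRelLog p (thickHom π h V)
        (mapForms (resHom _ hV) (extD _ (tFun π n U ^ m • η))) := by
  refine forms_degree_induction (P := fun η => ∃ (V : (thick π n).Opens) (hV : V ≤ U), x ∈ V ∧
      IsRelLog p (thickHom π h V)
        (mapForms (resHom _ hV) (extD _ (tFun π n U ^ m • η)))) ?_ ?_ hη
  · rintro η η' ⟨V, hV, hxV, h1⟩ ⟨V', hV', hxV', h1'⟩
    have a1 := h1.map (thickHom_comp_resHom π h (inf_le_left : V ⊓ V' ≤ V))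
    have b1 := h1'.map (thickHom_comp_resHom π h (inf_le_right : V ⊓ V' ≤ V'))
    rw [← mapForms_comp, resHom_comp] at a1 b1
    refine ⟨V ⊓ V', inf_le_left.trans hV, ⟨hxV, hxV'⟩, ?_⟩
    rw [smul_add, map_add, map_add]
    exact a1.add b1
  · intro a b
    have hQ := (natUnits_thick π n U).map (germHom U hx)
    -- Only finitely many functions have to be made units, first at x and then on a common
    -- neighbourhood.
    choose c hc using fun i => exists_isUnit_add hQ (germHom U hx (b i))
    choose V hV hxV hu using fun i => exists_unit_res hx (b i + (c i : Γ(thick π n, U))) (by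
      rw [map_add, map_natCast]; exact hc i)
    obtain ⟨W, hxW, hW⟩ := exists_common_open (fun o : Option (Fin p) => o.elim U V)
      (fun o => by cases o with
        | none => exact hx
        | some l => exact hxV l)
    have hWU : W ≤ U := hW none
    refine ⟨W, hWU, hxW, isRelLog_extD (natUnits_thick π n W) (tFun_pow π n W) hm
      (thickHom_tFun_pow π h W) (resHom_tFun π n hWU) a b c fun i => ?_⟩
    have hWV : W ≤ V i := hW (some i)
    rw [← resHom_resHom (hV i) hWV]
    exact (hu i).map _

set_option maxHeartbeats 1000000 in
/-- Near `x`, a symbol on `X_m` and a closed form on `X_n` with the same image in the forms on `X_m`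
come from a symbol on `X_n`. -/
theorem exists_symbol_lift [CharZero k] [Smooth π] {r m n : ℕ} (hm : 1 ≤ m) (h : m ≤ n)
    {U : (thick π n).Opens} (hU : IsAffineOpen U) {x : thick π n} (hx : x ∈ U)
    (a : MilnorK r Γ(thick π m, thickMap π h ⁻¹ᵁ U))
    (b : ⋀[Γ(thick π n, U)]^r Ω[Γ(thick π n, U)⁄ℤ]) (hb : extDeriv _ r b = 0)
    (hab : dlogForms r _ a = mapDeg r (thickHom π h U) b) :
    ∃ (V : (thick π n).Opens) (hV : V ≤ U) (z : MilnorK r Γ(thick π n, V)), x ∈ V ∧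
      mapMilnor r (thickHom π h V) z =
        mapMilnor r (resHom _ (preimage_le (thickMap π h) hV)) a ∧
      dlogForms r _ z = mapDeg r (resHom _ hV) b := by
  -- Lift the symbol arbitrarily. The error b - dlog a is closed and zero modulo t^m, hence near x
  -- the dlog of a symbol that dies on X_m, which corrects the lift.
  obtain ⟨a, rfl⟩ := mapMilnor_surjective (r := r) (thickHom π h U)
    (thickMap_app_surjective π h hU) (isUnit_of_map _ (thickMap_app_surjective π h hU)
      (tFun_pow π n U) hm (ker_thickMap_app π h hU)) a
  obtain ⟨R, _, ⟨T⟩⟩ := exists_truncData_section π (hm.trans h) hU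
  rcases exists_sub_dlogForms_eq T (natUnits_thick π n U) hm h (thickMap_app_surjective π h hU)
    (ker_thickMap_app π h hU) a b hb hab with ⟨-, h0⟩ | ⟨p, η, rfl, hη⟩
  · refine ⟨U, le_rfl, mapMilnor r (resHom _ le_rfl) a, hx, mapMilnor_thickHom_resHom π h _ _, ?_⟩
    rw [dlogForms_mapMilnor, h0]
  · obtain ⟨V, hV, hxV, h1⟩ := exists_isRelLog π hm h hx η.2
    rw [← hη] at h1
    obtain ⟨z, hz⟩ := exists_milnor_lift_of_isRelLog (thickHom_comp_resHom π h hV) a b h1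
    exact ⟨V, hV, z, hxV, hz⟩

end localStatements

end

end MilnorDlog

namespace MilnorDlog

noncomputable section

/-! ### Sections of direct images along X_m → X_n -/

section pushforward

variable (F : CommRingCat.{u} ⥤ AddCommGrpCat.{u})

theorem functor_map_resHom_resHom {X : Scheme.{u}} {U V W : X.Opens} (h : V ≤ U) (h' : W ≤ V)
    (a : F.obj Γ(X, U)) :
    F.map (CommRingCat.ofHom (resHom X h')) (F.map (CommRingCat.ofHom (resHom X h)) a) =
      F.map (CommRingCat.ofHom (resHom X (h'.trans h))) a := by
  rw [← ConcreteCategory.comp_apply, ← F.map_comp, ← CommRingCat.ofHom_comp, resHom_comp]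

theorem toSection_resHom {X : Scheme.{u}} {U V W : X.Opens} {s : (sheafOf F X).obj.obj (op U)}
    {hV : V ≤ U} {a : F.obj Γ(X, V)} (e : toSection F X V a = (sheafOf F X).obj.map (homOfLE hV).op s)
    (h : W ≤ V) : toSection F X W (F.map (CommRingCat.ofHom (resHom X h)) a) =
      (sheafOf F X).obj.map (homOfLE (h.trans hV)).op s := by
  rw [← toSection_res, e, map_homOfLE_comp]

variable {X Y : Scheme.{u}} (f : Y ⟶ X)

theorem functor_map_app_resHom {U V : X.Opens} (h : V ≤ U) (a : F.obj Γ(X, U)) :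
    F.map (f.app V) (F.map (CommRingCat.ofHom (resHom X h)) a) =
      F.map (CommRingCat.ofHom (resHom Y (preimage_le f h))) (F.map (f.app U) a) := by
  rw [← ConcreteCategory.comp_apply, ← ConcreteCategory.comp_apply, ← F.map_comp, ← F.map_comp]
  exact ConcreteCategory.congr_hom (congrArg F.map (f.naturality (homOfLE h).op)) a

theorem toSection_push_resHom {U V W : X.Opens}
    {s : ((pushSheaf f).obj (sheafOf F Y)).obj.obj (op U)} {hV : V ≤ U} {a : F.obj Γ(Y, f ⁻¹ᵁ V)}
    (e : toSection F Y (f ⁻¹ᵁ V) a =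
      ((pushSheaf f).obj (sheafOf F Y)).obj.map (homOfLE hV).op s) (h : W ≤ V) :
    toSection F Y (f ⁻¹ᵁ W) (F.map (CommRingCat.ofHom (resHom Y (preimage_le f h))) a) =
      ((pushSheaf f).obj (sheafOf F Y)).obj.map (homOfLE (h.trans hV)).op s :=
  toSection_resHom F (s := s) (hV := preimage_le f hV) e (preimage_le f h)

/-- Neighbourhoods in Y are preimages of neighbourhoods in X, so local representatives of a section
of the direct image live over open sets of X. -/
theorem exists_push_toSection_eq (hs : Function.Surjective f)
    (hp : ∀ V : Y.Opens, ∃ U : X.Opens, f ⁻¹ᵁ U = V) {U : X.Opens}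
    (s : ((pushSheaf f).obj (sheafOf F Y)).obj.obj (op U)) (x : X) (hx : x ∈ U) :
    ∃ (V : X.Opens) (hV : V ≤ U) (a : F.obj Γ(Y, f ⁻¹ᵁ V)), x ∈ V ∧ toSection F Y (f ⁻¹ᵁ V) a =
      ((pushSheaf f).obj (sheafOf F Y)).obj.map (homOfLE hV).op s := by
  obtain ⟨y, rfl⟩ := hs x
  obtain ⟨V, hV, a, hyV, e⟩ := exists_toSection_eq F Y (U := f ⁻¹ᵁ U) s y hx
  obtain ⟨V, rfl⟩ := hp V
  refine ⟨V ⊓ U, inf_le_right, _, ⟨hyV, hx⟩,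
    toSection_resHom F e (preimage_le f (inf_le_left : V ⊓ U ≤ V))⟩

theorem exists_push_map_eq_zero (hs : Function.Surjective f)
    (hp : ∀ V : Y.Opens, ∃ U : X.Opens, f ⁻¹ᵁ U = V) {U : X.Opens} (a : F.obj Γ(Y, f ⁻¹ᵁ U))
    (h : toSection F Y (f ⁻¹ᵁ U) a = 0) (x : X) (hx : x ∈ U) :
    ∃ (V : X.Opens) (hV : V ≤ U), x ∈ V ∧
      F.map (CommRingCat.ofHom (resHom Y (preimage_le f hV))) a = 0 := by
  obtain ⟨y, rfl⟩ := hs x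
  obtain ⟨V, hV, hyV, e⟩ := exists_map_eq_zero F Y a h y hx
  obtain ⟨V, rfl⟩ := hp V
  refine ⟨V ⊓ U, inf_le_right, ⟨hyV, hx⟩, ?_⟩
  rw [← functor_map_resHom_resHom F hV (preimage_le f (inf_le_left : V ⊓ U ≤ V)), e]
  exact map_zero (F.map _).hom

end pushforward

/-! ### The cartesian square -/

section square

theorem mapMilnor_resHom_resHom {X : Scheme.{u}} {U V W : X.Opens} (h : V ≤ U) (h' : W ≤ V) {r : ℕ}
    (z : MilnorK r Γ(X, U)) : mapMilnor r (resHom X h') (mapMilnor r (resHom X h) z) =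
      mapMilnor r (resHom X (h'.trans h)) z := by
  rw [← mapMilnor_comp, resHom_comp]

theorem mapDeg_resHom_resHom {X : Scheme.{u}} {U V W : X.Opens} (h : V ≤ U) (h' : W ≤ V) {r : ℕ}
    (z : ⋀[Γ(X, U)]^r Ω[Γ(X, U)⁄ℤ]) : mapDeg r (resHom X h') (mapDeg r (resHom X h) z) =
      mapDeg r (resHom X (h'.trans h)) z := by
  rw [← mapDeg_comp, resHom_comp]

theorem dlogForms_mapMilnor_eq_zero {A B C : Type u} [CommRing A] [CommRing B] [CommRing C]
    {f : A →+* B} {g : B →+* C} {p : A →+* C} (hp : g.comp f = p) {r : ℕ} {z : MilnorK r A}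
    (h : mapDeg r f (dlogForms r A z) = 0) : dlogForms r C (mapMilnor r p z) = 0 := by
  rw [dlogForms_mapMilnor, ← hp, mapDeg_comp, h, map_zero]

theorem dlogForms_mapMilnor_eq_mapDeg {A B C D : Type u} [CommRing A] [CommRing B] [CommRing C]
    [CommRing D] {f : A →+* B} {g : A →+* C} {f' : C →+* D} {g' : B →+* D}
    (w : f'.comp g = g'.comp f) {r : ℕ} {a : MilnorK r B} {b : ⋀[A]^r Ω[A⁄ℤ]}
    (h : mapDeg r g' (dlogForms r B a - mapDeg r f b) = 0) :
    dlogForms r D (mapMilnor r g' a) = mapDeg r f' (mapDeg r g b) := by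
  rwa [map_sub, sub_eq_zero, ← dlogForms_mapMilnor, ← mapDeg_square w] at h

variable {k : Type u} [Field k] {X : Scheme.{u}} (π : X ⟶ BaseS k)

theorem milnorRes_dlogPush (r : ℕ) {m n : ℕ} (h : m ≤ n) :
    milnorRes π r h ≫ dlogPush π r h = dlogSheaf r (thick π n) ≫ closedRes π r h := by
  refine sheafOf_hom_ext _ _ fun U a => ?_
  have e1 := sheafRestrict_toSection (milnorFunctor r) (thickMap π h) U a
  have e2 := sheafOfMap_toSection _ (dlogNat r) U a
  have e3 := sheafRestrict_toSection (closedFunctor r) (thickMap π h) U ((dlogNat r).app _ a)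
  have e4 := sheafOfMap_toSection _ (dlogNat r) (thickMap π h ⁻¹ᵁ U)
    ((milnorFunctor r).map ((thickMap π h).app U) a)
  refine (congrArg (fun s => (dlogPush π r h).hom.app (op U) s) e1).trans (e4.trans ?_)
  refine Eq.trans ?_ (e3.symm.trans (congrArg (fun s => (closedRes π r h).hom.app (op U) s) e2.symm))
  exact congrArg _ (NatTrans.naturality_apply (dlogNat r) ((thickMap π h).app U) a)

/-- Represent the section by an element of K^M_r on a neighbourhood, shrink until both of its images
vanish as elements, and apply `exists_restriction_eq_zero`. -/
theorem milnorSection_eq_zero [CharZero k] [Smooth π] (r : ℕ) {m n : ℕ} (hm : 1 ≤ m) (h : m ≤ n)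
    (U : (thick π n).Opens) (z : (milnorSheaf r (thick π n)).obj.obj (op U))
    (h1 : (milnorRes π r h).hom.app (op U) z = 0)
    (h2 : (dlogSheaf r (thick π n)).hom.app (op U) z = 0) : z = 0 := by
  refine section_eq_zero _ _ fun x hx => ?_
  obtain ⟨V, hV, (a : MilnorK r Γ(thick π n, V)), hxV, e⟩ :=
    exists_toSection_eq (milnorFunctor r) _ z x hx
  have res : ∀ {S : TopCat.Sheaf AddCommGrpCat.{u} (thick π n)} (f : milnorSheaf r (thick π n) ⟶ S),
      f.hom.app (op U) z = 0 → f.hom.app (op V) (toSection (milnorFunctor r) _ V a) = 0 := by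
    intro S f hf
    rw [e]
    refine (NatTrans.naturality_apply f.hom (homOfLE hV).op z).trans ?_
    rw [hf]
    exact map_zero (S.obj.map (homOfLE hV).op).hom
  have e1 := (sheafRestrict_toSection (milnorFunctor r) (thickMap π h) V a).symm.trans (res _ h1)
  have e2 := (sheafOfMap_toSection _ (dlogNat r) V a).symm.trans (res _ h2)
  obtain ⟨V1, hV1, hxV1, k1⟩ := exists_push_map_eq_zero (milnorFunctor r) (thickMap π h)
    (thickMap_surjective π hm h) (exists_preimage_eq π h) _ e1 x hxV
  obtain ⟨V2, hV2, hxV2, k2⟩ := exists_map_eq_zero (closedFunctor r) _ _ e2 x hxV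
  have l1 : V1 ⊓ V2 ≤ V := inf_le_left.trans hV1
  have j1 : mapMilnor r (thickHom π h (V1 ⊓ V2)) (mapMilnor r (resHom _ l1) a) = 0 := by
    rw [mapMilnor_thickHom_resHom, ← resHom_comp _ (preimage_le (thickMap π h) hV1)
      (preimage_le (thickMap π h) (inf_le_left : V1 ⊓ V2 ≤ V1)), mapMilnor_comp]
    exact (congrArg _ k1).trans (map_zero _)
  have k2' : mapDeg r (resHom _ hV2) (dlogForms r _ a) = 0 := congrArg Subtype.val k2
  have j2 : dlogForms r _ (mapMilnor r (resHom _ l1) a) = 0 :=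
    dlogForms_mapMilnor_eq_zero (resHom_comp _ hV2 (inf_le_right : V1 ⊓ V2 ≤ V2)) k2'
  obtain ⟨W, hW, hxW, k⟩ := exists_restriction_eq_zero π hm h
    (show x ∈ V1 ⊓ V2 from ⟨hxV1, hxV2⟩) _ j1 j2
  refine ⟨W, (hW.trans l1).trans hV, hxW, ?_⟩
  rw [← toSection_resHom (milnorFunctor r) (toSection_resHom (milnorFunctor r) e l1) hW]
  exact (congrArg _ k).trans (toSection_zero (milnorFunctor r) _ W)

set_option maxHeartbeats 1000000 in
theorem exists_symbol_lift_of_toSection_eq_zero [CharZero k] [Smooth π] (r : ℕ) {m n : ℕ} (hm : 1 ≤ m)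
    (h : m ≤ n) (U : (thick π n).Opens) (a : MilnorK r Γ(thick π m, thickMap π h ⁻¹ᵁ U))
    (b : closedSubgroup Γ(thick π n, U) r)
    (e : toSection (closedFunctor r) _ (thickMap π h ⁻¹ᵁ U) ((dlogNat r).app _ a -
      (closedFunctor r).map ((thickMap π h).app U) b) = 0) (x : thick π n) (hx : x ∈ U) :
    ∃ (V : (thick π n).Opens) (hV : V ≤ U) (z : MilnorK r Γ(thick π n, V)), x ∈ V ∧
      mapMilnor r (thickHom π h V) z = mapMilnor r (resHom _ (preimage_le (thickMap π h) hV)) a ∧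
      dlogForms r _ z = mapDeg r (resHom _ hV) b := by
  obtain ⟨V, hV, hxV, k⟩ := exists_push_map_eq_zero (closedFunctor r) (thickMap π h)
    (thickMap_surjective π hm h) (exists_preimage_eq π h) _ e x hx
  obtain ⟨W, hWa, hWV, hxW⟩ := exists_affine_le hxV
  have k' : mapDeg r (resHom _ (preimage_le (thickMap π h) hV))
    (dlogForms r _ a - mapDeg r (thickHom π h U) b) = 0 := congrArg Subtype.val k
  have j := dlogForms_mapMilnor_eq_mapDeg (thickHom_comp_resHom π h hV) k'
  have j' := (dlogForms_mapMilnor (resHom _ (preimage_le (thickMap π h) hWV)) _).trans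
    ((congrArg (mapDeg r _) j).trans (mapDeg_square (thickHom_comp_resHom π h hWV) _).symm)
  have hb : extDeriv _ r (mapDeg r (resHom _ hWV) (mapDeg r (resHom _ hV) b)) = 0 :=
    ((closedFunctor r).map (CommRingCat.ofHom (resHom _ hWV))
      ((closedFunctor r).map (CommRingCat.ofHom (resHom _ hV)) b)).2
  obtain ⟨Z, hZ, z, hxZ, h1, h2⟩ := exists_symbol_lift π hm h hWa hxW _ _ hb j'
  refine ⟨Z, (hZ.trans hWV).trans hV, z, hxZ, h1.trans ?_, h2.trans ?_⟩
  · exact (congrArg (mapMilnor r _) (mapMilnor_resHom_resHom _ _ _)).trans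
      (mapMilnor_resHom_resHom _ _ _)
  · exact (congrArg (mapDeg r _) (mapDeg_resHom_resHom _ _ _)).trans (mapDeg_resHom_resHom _ _ _)

theorem exists_milnorSection [CharZero k] [Smooth π] (r : ℕ) {m n : ℕ} (hm : 1 ≤ m) (h : m ≤ n)
    (U : (thick π n).Opens)
    (a : ((pushSheaf (thickMap π h)).obj (milnorSheaf r (thick π m))).obj.obj (op U))
    (b : (closedSheaf r (thick π n)).obj.obj (op U))
    (hab : (dlogPush π r h).hom.app (op U) a = (closedRes π r h).hom.app (op U) b)
    (x : thick π n) (hx : x ∈ U) :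
    ∃ (V : (thick π n).Opens) (hV : V ≤ U) (z : (milnorSheaf r (thick π n)).obj.obj (op V)), x ∈ V ∧
      (milnorRes π r h).hom.app (op V) z =
        ((pushSheaf (thickMap π h)).obj (milnorSheaf r (thick π m))).obj.map (homOfLE hV).op a ∧
      (dlogSheaf r (thick π n)).hom.app (op V) z =
        (closedSheaf r (thick π n)).obj.map (homOfLE hV).op b := by
  obtain ⟨V1, hV1, a1, hxV1, e1⟩ := exists_push_toSection_eq (milnorFunctor r) (thickMap π h)
    (thickMap_surjective π hm h) (exists_preimage_eq π h) a x hx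
  obtain ⟨V2, hV2, b2, hxV2, e2⟩ := exists_toSection_eq (closedFunctor r) _ b x hx
  have l1 : V1 ⊓ V2 ≤ V1 := inf_le_left
  have l2 : V1 ⊓ V2 ≤ V2 := inf_le_right
  replace e1 := toSection_push_resHom (milnorFunctor r) (thickMap π h) e1 l1
  replace e2 := toSection_resHom (closedFunctor r) e2 l2
  have e3 : toSection (closedFunctor r) _ (thickMap π h ⁻¹ᵁ (V1 ⊓ V2))
      ((dlogNat r).app _ ((milnorFunctor r).map (CommRingCat.ofHom (resHom _ (preimage_le _ l1))) a1) -
        (closedFunctor r).map ((thickMap π h).app _)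
          ((closedFunctor r).map (CommRingCat.ofHom (resHom _ l2)) b2)) = 0 := by
    rw [toSection_sub, sub_eq_zero]
    refine (sheafOfMap_toSection _ (dlogNat r) (thickMap π h ⁻¹ᵁ (V1 ⊓ V2)) _).symm.trans
      (Eq.trans ?_ (sheafRestrict_toSection (closedFunctor r) (thickMap π h) (V1 ⊓ V2) _))
    refine (congrArg ((dlogPush π r h).hom.app (op (V1 ⊓ V2))) e1).trans
      (Eq.trans ?_ (congrArg ((closedRes π r h).hom.app (op (V1 ⊓ V2))) e2).symm)
    exact (NatTrans.naturality_apply (dlogPush π r h).hom (homOfLE (l1.trans hV1)).op a).trans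
      ((congrArg _ hab).trans
        (NatTrans.naturality_apply (closedRes π r h).hom (homOfLE (l1.trans hV1)).op b).symm)
  obtain ⟨V, hV, z, hxV, z1, z2⟩ := exists_symbol_lift_of_toSection_eq_zero π r hm h _ _ _ e3 x
    ⟨hxV1, hxV2⟩
  refine ⟨V, hV.trans (l1.trans hV1), toSection (milnorFunctor r) _ V z, hxV, ?_, ?_⟩
  · exact (sheafRestrict_toSection (milnorFunctor r) (thickMap π h) V z).trans ((congrArg _ z1).trans
      (toSection_push_resHom (milnorFunctor r) (thickMap π h) e1 hV))
  · exact (sheafOfMap_toSection _ (dlogNat r) V z).trans ((congrArg _ (Subtype.ext z2)).trans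
      (toSection_resHom (closedFunctor r) e2 hV))

/-- Needed for general m: the value m = 1 is the stated square, m = n - 1 produces the exact rows.
-/
theorem isPullback_milnor [CharZero k] [Smooth π] (r : ℕ) {m n : ℕ} (hm : 1 ≤ m) (h : m ≤ n) :
    IsPullback (milnorRes π r h) (dlogSheaf r (thick π n)) (dlogPush π r h) (closedRes π r h) :=
  isPullback_of_local (milnorRes_dlogPush π r h) (milnorSection_eq_zero π r hm h)
    (exists_milnorSection π r hm h)

end square

end

end MilnorDlog

namespace MilnorDlog

noncomputable section

/-! ### The map η ↦ d(t^{n-1}η) on rings -/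

section formMaps

variable {A B : Type u} [CommRing A] [CommRing B] {f : A →+* B}

theorem dElem_pow (t : A) (k : ℕ) : dElem A (t ^ k) = ((k : A) * t ^ (k - 1)) • dElem A t := by
  rw [dElem_apply, Derivation.leibniz_pow, map_nsmul, map_smul, ← dElem_apply,
    ← Nat.cast_smul_eq_nsmul A, smul_smul]

/-- Since t^{n-1} annihilates both t and dt, the form d(t^{n-1}η) depends only on η modulo t; this
makes a independent of lifts. -/
theorem extD_pow_smul_eq_zero (hQ : NatUnits A) {t : A} {n : ℕ} (hn : 1 ≤ n) (ht : t ^ n = 0)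
    {η : Forms A} (h : η ∈ formsIdeal t) : extD A (t ^ (n - 1) • η) = 0 := by
  obtain ⟨α, β, rfl⟩ := h
  rw [smul_add, smul_smul, ← pow_succ, Nat.sub_add_cancel hn, ht, zero_smul, zero_add,
    ← smul_mul_assoc, pow_smul_dElem_eq_zero hQ hn ht (by omega), zero_mul, map_zero]

/-- The map `η ↦ d(sη)` from `Ω^r_A` to `Z^{r+1}_A`. -/
def extDerivSMul (r : ℕ) (s : A) : ⋀[A]^r Ω[A⁄ℤ] →+ closedSubgroup A (r + 1) :=
  ((extDeriv A r).comp (DistribSMul.toAddMonoidHom _ s)).codRestrict (closedSubgroup A (r + 1))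
    fun η => Subtype.ext (extD_extD (s • (η : Forms A)))

theorem coe_extDerivSMul {r : ℕ} (s : A) (η : ⋀[A]^r Ω[A⁄ℤ]) :
    ((extDerivSMul r s η : ⋀[A]^(r + 1) Ω[A⁄ℤ]) : Forms A) = extD A (s • (η : Forms A)) := rfl

theorem mapDeg_extDerivSMul {r : ℕ} {s : A} {s' : B} (hs : f s = s') (η : ⋀[A]^r Ω[A⁄ℤ]) :
    mapDeg (r + 1) f (extDerivSMul r s η) = extDerivSMul r s' (mapDeg r f η) := by
  refine Subtype.ext ?_
  change mapForms f (extD A (s • (η : Forms A))) = extD B (s' • mapForms f η)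
  rw [← extD_mapForms, mapForms_smul, hs]

theorem extDerivSMul_zero {r : ℕ} (η : ⋀[A]^r Ω[A⁄ℤ]) : extDerivSMul r 0 η = 0 :=
  Subtype.ext (Subtype.ext (by rw [coe_extDerivSMul, zero_smul, map_zero]; rfl))

theorem extDerivSMul_pow {r : ℕ} (t : A) (n : ℕ) (η : ⋀[A]^r Ω[A⁄ℤ]) :
    (extDerivSMul r (t ^ (n - 1)) η : ⋀[A]^(r + 1) Ω[A⁄ℤ]) = t ^ (n - 1) • extDeriv A r η +
      (((n - 1 : ℕ) : A) * t ^ (n - 2)) • wedgeD A r t η := by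
  refine Subtype.ext ?_
  rw [coe_extDerivSMul, extD_smul, dElem_pow, add_comm, smul_mul_assoc]
  rfl

theorem extDerivSMul_eq_zero (hQ : NatUnits A) {t : A} {n : ℕ} (hn : 1 ≤ n) (ht : t ^ n = 0)
    (hf : Function.Surjective f) (hk : RingHom.ker f = Ideal.span {t ^ 1}) {r : ℕ}
    {η : ⋀[A]^r Ω[A⁄ℤ]} (h : mapDeg r f η = 0) : extDerivSMul r (t ^ (n - 1)) η = 0 := by
  rw [pow_one] at hk
  exact Subtype.ext (Subtype.ext (extD_pow_smul_eq_zero hQ hn ht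
    (mem_formsIdeal_of_mapForms_eq_zero hf hk (congrArg Subtype.val h))))

theorem mapDeg_eq_zero_of_extDerivSMul {R : Type u} [CommRing R] {t : A} {n : ℕ}
    (T : TruncData R A t n) (hQ : NatUnits A) (hn : 2 ≤ n) (hf : f t = 0) {r : ℕ}
    {η : ⋀[A]^r Ω[A⁄ℤ]} (h : extDerivSMul r (t ^ (n - 1)) η = 0) : mapDeg r f η = 0 := by
  have : extD A (t ^ (n - 1) • (η : Forms A)) = 0 := by rw [← coe_extDerivSMul, h]; rfl
  obtain ⟨α, β, e⟩ := T.mem_formsIdeal_of_extD_eq_zero hQ hn this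
  refine Subtype.ext ?_
  change mapForms f η = 0
  rw [e, map_add, mapForms_smul, mapForms_dElem_mul, hf, map_zero, zero_smul, zero_mul, add_zero]

theorem mapDeg_surjective (hf : Function.Surjective f) (r : ℕ) : Function.Surjective (mapDeg r f) := by
  intro ω
  obtain ⟨η, hη⟩ := mapForms_surjective hf (ω : Forms B)
  refine ⟨⟨formsProj r η, formsProj_mem r η⟩, Subtype.ext ?_⟩
  change mapForms f (formsProj r η) = ω
  rw [← formsProj_mapForms, hη, formsProj_of_mem ω.2]

theorem exists_closedSubgroup_lift {R : Type u} [CommRing R] {t : A} {m n : ℕ}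
    (T : TruncData R A t n) (hQ : NatUnits A) (hm : 1 ≤ m) (hmn : m ≤ n)
    (hf : Function.Surjective f) (hk : RingHom.ker f = Ideal.span {t ^ m}) {r : ℕ}
    (ω : closedSubgroup B r) : ∃ ω' : closedSubgroup A r,
      mapDeg r f (ω' : ⋀[A]^r Ω[A⁄ℤ]) = (ω : ⋀[B]^r Ω[B⁄ℤ]) := by
  have hω : extD B ((ω : ⋀[B]^r Ω[B⁄ℤ]) : Forms B) = 0 := congrArg Subtype.val ω.2
  obtain ⟨η, h1, h2⟩ := T.exists_closed_lift hQ f hf hm hmn hk hω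
  refine ⟨⟨⟨formsProj r η, formsProj_mem r η⟩, Subtype.ext ?_⟩, Subtype.ext ?_⟩
  · change extD A (formsProj r η) = 0
    rw [← formsProj_extD, h1, map_zero]
  · change mapForms f (formsProj r η) = _
    rw [← formsProj_mapForms, h2, formsProj_of_mem (ω : ⋀[B]^r Ω[B⁄ℤ]).2]

/-- With dlog(1 + x t^{n-1}) = d(t^{n-1}x) and the other factors closed, the Leibniz rule leaves a
single term. This is dlog ∘ b = a on generators. -/
theorem dlogForms_symbol_cons (hQ : NatUnits A) {t : A} {n : ℕ} (hn : 2 ≤ n) (ht : t ^ n = 0) {x : A}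
    {z : Aˣ} (hz : (z : A) = 1 + x * t ^ (n - 1)) {r : ℕ} (y : Fin r → Aˣ) :
    dlogClosed (r + 1) A (symbol (r + 1) (Fin.cons z y)) =
      extDerivSMul r (t ^ (n - 1)) (x • dlogForms r A (symbol r y)) := by
  refine Subtype.ext (Subtype.ext ?_)
  change ((dlogForms (r + 1) A (symbol (r + 1) (Fin.cons z y)) : ⋀[A]^(r + 1) Ω[A⁄ℤ]) : Forms A) =
    extD A (t ^ (n - 1) • x • (dlogForms r A (symbol r y) : Forms A))
  rw [dlogForms_symbol_coe, dlogForms_symbol_coe, List.ofFn_cons, List.map_cons, List.prod_cons,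
    ι_dlogOne_one_add hQ hn ht hz, smul_smul, extD_smul, extD_prod_dlogOne, smul_zero, add_zero]

end formMaps

end

end MilnorDlog

namespace MilnorDlog

noncomputable section

/-! ### Sections over small affine opens -/

section localSections

variable (F : CommRingCat.{u} ⥤ AddCommGrpCat.{u}) {X Y : Scheme.{u}} (f : Y ⟶ X)

theorem exists_affine_map_eq_zero {U : X.Opens} (a : F.obj Γ(X, U)) (h : toSection F X U a = 0) (x : X)
    (hx : x ∈ U) : ∃ (V : X.Opens) (hV : V ≤ U), IsAffineOpen V ∧ x ∈ V ∧
      F.map (CommRingCat.ofHom (resHom X hV)) a = 0 := by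
  obtain ⟨V, hV, hxV, e⟩ := exists_map_eq_zero F X a h x hx
  obtain ⟨W, hWa, hWV, hxW⟩ := exists_affine_le hxV
  refine ⟨W, hWV.trans hV, hWa, hxW, ?_⟩
  rw [← functor_map_resHom_resHom F hV hWV, e]
  exact map_zero (F.map _).hom

theorem exists_affine_push_toSection_eq (hs : Function.Surjective f)
    (hp : ∀ V : Y.Opens, ∃ U : X.Opens, f ⁻¹ᵁ U = V) {U : X.Opens}
    (s : ((pushSheaf f).obj (sheafOf F Y)).obj.obj (op U)) (x : X) (hx : x ∈ U) :
    ∃ (V : X.Opens) (hV : V ≤ U) (a : F.obj Γ(Y, f ⁻¹ᵁ V)), IsAffineOpen V ∧ x ∈ V ∧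
      toSection F Y (f ⁻¹ᵁ V) a =
        ((pushSheaf f).obj (sheafOf F Y)).obj.map (homOfLE hV).op s := by
  obtain ⟨V, hV, a, hxV, e⟩ := exists_push_toSection_eq F f hs hp s x hx
  obtain ⟨W, hWa, hWV, hxW⟩ := exists_affine_le hxV
  exact ⟨W, hWV.trans hV, _, hWa, hxW, toSection_push_resHom F f e hWV⟩

theorem exists_toSection_of_sheafRestrict_eq_zero (hs : Function.Surjective f)
    (hp : ∀ V : Y.Opens, ∃ U : X.Opens, f ⁻¹ᵁ U = V) {U : X.Opens}
    (s : (sheafOf F X).obj.obj (op U)) (h0 : (sheafRestrict F f).hom.app (op U) s = 0) (x : X)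
    (hx : x ∈ U) : ∃ (V : X.Opens) (hV : V ≤ U) (a : F.obj Γ(X, V)), IsAffineOpen V ∧ x ∈ V ∧
      toSection F X V a = (sheafOf F X).obj.map (homOfLE hV).op s ∧ F.map (f.app V) a = 0 := by
  obtain ⟨V, hV, a, hxV, e⟩ := exists_toSection_eq F X s x hx
  have e0 : toSection F Y (f ⁻¹ᵁ V) (F.map (f.app V) a) = 0 := by
    rw [← sheafRestrict_toSection, e]
    refine (NatTrans.naturality_apply (sheafRestrict F f).hom (homOfLE hV).op s).trans ?_
    rw [h0]
    exact map_zero (((pushSheaf f).obj (sheafOf F Y)).obj.map (homOfLE hV).op).hom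
  obtain ⟨V', hV', hxV', k⟩ := exists_push_map_eq_zero F f hs hp _ e0 x hxV
  obtain ⟨W, hWa, hWV, hxW⟩ := exists_affine_le hxV'
  refine ⟨W, (hWV.trans hV').trans hV, _, hWa, hxW, toSection_resHom F e (hWV.trans hV'), ?_⟩
  rw [functor_map_app_resHom, ← functor_map_resHom_resHom F (preimage_le f hV') (preimage_le f hWV), k]
  exact map_zero (F.map _).hom

theorem sheafRestrict_epi (hs : Function.Surjective f)
    (hp : ∀ V : Y.Opens, ∃ U : X.Opens, f ⁻¹ᵁ U = V)
    (h : ∀ (U : X.Opens), IsAffineOpen U → Function.Surjective (F.map (f.app U))) :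
    Epi (sheafRestrict F f) := by
  refine sheafHom_epi _ fun U s x hx => ?_
  obtain ⟨V, hV, a, hVa, hxV, e⟩ := exists_affine_push_toSection_eq F f hs hp s x hx
  obtain ⟨b, hb⟩ := h V hVa a
  refine ⟨V, hV, toSection F X V b, hxV, ?_⟩
  rw [sheafRestrict_toSection, hb, e]

end localSections

/-! ### The lower exact row -/

section formSheaves

variable {k : Type u} [Field k] {X : Scheme.{u}} (π : X ⟶ BaseS k)

theorem closedRes_epi [CharZero k] [Smooth π] (r : ℕ) {m n : ℕ} (hm : 1 ≤ m) (h : m ≤ n) :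
    Epi (closedRes π r h) :=
  sheafRestrict_epi _ _ (thickMap_surjective π hm h) (exists_preimage_eq π h) fun U hU ω => by
    obtain ⟨R, _, ⟨T⟩⟩ := exists_truncData_section π (hm.trans h) hU
    obtain ⟨ω', e⟩ := exists_closedSubgroup_lift T (natUnits_thick π n U) hm h
      (thickMap_app_surjective π h hU) (ker_thickMap_app π h hU) ω
    exact ⟨ω', Subtype.ext e⟩

theorem formsRes_epi (r : ℕ) {m n : ℕ} (hm : 1 ≤ m) (h : m ≤ n) : Epi (formsRes π r h) :=
  sheafRestrict_epi _ _ (thickMap_surjective π hm h) (exists_preimage_eq π h) fun _ hU =>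
    mapDeg_surjective (thickMap_app_surjective π h hU) r

/-- `η ↦ d(t^{n-1}η)` as a homomorphism of presheaves. -/
def tPowDerivNat (r n : ℕ) : (thick π n).presheaf ⋙ formsFunctor r ⟶
    (thick π n).presheaf ⋙ closedFunctor (r + 1) where
  app U := AddCommGrpCat.ofHom (extDerivSMul r (tFun π n U.unop ^ (n - 1)))
  naturality U V i := ConcreteCategory.hom_ext _ _ fun η => by
    refine Subtype.ext (mapDeg_extDerivSMul (f := resHom _ i.unop.le) ?_ η).symm
    rw [map_pow, resHom_tFun]

/-- `η ↦ d(t^{n-1}η)` as a homomorphism of sheaves. -/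
def tPowDeriv (r n : ℕ) : formsSheaf r (thick π n) ⟶ closedSheaf (r + 1) (thick π n) :=
  (presheafToSheaf (Opens.grothendieckTopology (thick π n)) AddCommGrpCat.{u}).map
    (tPowDerivNat π r n)

theorem tPowDeriv_toSection (r n : ℕ) (U : (thick π n).Opens)
    (η : ⋀[Γ(thick π n, U)]^r Ω[Γ(thick π n, U)⁄ℤ]) :
    (tPowDeriv π r n).hom.app (op U) (toSection (formsFunctor r) (thick π n) U η) =
      toSection (closedFunctor (r + 1)) (thick π n) U (extDerivSMul r (tFun π n U ^ (n - 1)) η) :=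
  ConcreteCategory.congr_hom (congrArg (fun β => β.app (op U))
    (toSheafify_naturality (Opens.grothendieckTopology (thick π n)) (tPowDerivNat π r n)).symm)
    (show (formsFunctor r).obj Γ(thick π n, U) from η)

theorem tPowDeriv_eq_zero [CharZero k] (r : ℕ) {n : ℕ} (h : 1 ≤ n) {U : (thick π n).Opens}
    (s : (formsSheaf r (thick π n)).obj.obj (op U)) (h0 : (formsRes π r h).hom.app (op U) s = 0) :
    (tPowDeriv π r n).hom.app (op U) s = 0 := by
  refine section_eq_zero _ _ fun x hx => ?_
  obtain ⟨V, hV, η, hVa, hxV, e, e0⟩ := exists_toSection_of_sheafRestrict_eq_zero (formsFunctor r)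
    (thickMap π h) (thickMap_surjective π le_rfl h) (exists_preimage_eq π h) s h0 x hx
  refine ⟨V, hV, hxV, (NatTrans.naturality_apply (tPowDeriv π r n).hom (homOfLE hV).op s).symm.trans ?_⟩
  refine (congrArg _ e.symm).trans ((tPowDeriv_toSection π r n V η).trans ?_)
  rw [extDerivSMul_eq_zero (natUnits_thick π n V) h (tFun_pow π n V) (thickMap_app_surjective π h hVa)
    (ker_thickMap_app π h hVa) e0]
  exact toSection_zero _ _ _

/-- Restriction of forms is an epimorphism of sheaves whose kernel is killed by `tPowDeriv`, so the
latter descends to X_1. -/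
theorem exists_formMap [CharZero k] (r : ℕ) {n : ℕ} (h : 1 ≤ n) :
    ∃ a : (pushSheaf (thickMap π h)).obj (formsSheaf r (thick π 1)) ⟶ closedSheaf (r + 1) (thick π n),
      formsRes π r h ≫ a = tPowDeriv π r n := by
  have := formsRes_epi π r le_rfl h
  refine ⟨Abelian.epiDesc (formsRes π r h) (tPowDeriv π r n) ?_, Abelian.comp_epiDesc _ _ _⟩
  refine Sheaf.hom_ext (NatTrans.ext (funext fun U => ConcreteCategory.hom_ext _ _ fun s => ?_))
  exact tPowDeriv_eq_zero π r h _ (ConcreteCategory.congr_hom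
    (congrArg (fun α => α.hom.app U) (kernel.condition (formsRes π r h))) s)

variable {π} {r n : ℕ} {h : 1 ≤ n} {a : (pushSheaf (thickMap π h)).obj (formsSheaf r (thick π 1)) ⟶
  closedSheaf (r + 1) (thick π n)}

theorem formMap_app (ha : formsRes π r h ≫ a = tPowDeriv π r n)
    {U : (thick π n).Opens} {s : (formsSheaf r (thick π n)).obj.obj (op U)} :
    a.hom.app (op U) ((formsRes π r h).hom.app (op U) s) = (tPowDeriv π r n).hom.app (op U) s :=
  ConcreteCategory.congr_hom (congrArg (fun α => α.hom.app (op U)) ha) s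

theorem isFormMap (ha : formsRes π r h ≫ a = tPowDeriv π r n) : IsFormMap π h a := fun U η => by
  rw [formMap_app ha, ← extDerivSMul_pow]
  refine (congrArg _ (tPowDeriv_toSection π r n U η)).trans ?_
  exact sheafOfMap_toSection _ (closedIncl (r + 1)) U _

theorem formMap_closedRes (ha : formsRes π r h ≫ a = tPowDeriv π r n) :
    a ≫ closedRes π (r + 1) (Nat.sub_le n 1) = 0 := by
  have := formsRes_epi π r le_rfl h
  rw [← cancel_epi (formsRes π r h), comp_zero, ← Category.assoc, ha]
  refine sheafOf_hom_ext _ _ fun U η => ?_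
  refine (congrArg _ (tPowDeriv_toSection π r n U η)).trans
    ((sheafRestrict_toSection (closedFunctor (r + 1)) _ U _).trans ?_)
  refine (congrArg _ (Subtype.ext ?_)).trans (toSection_zero (closedFunctor (r + 1)) _ _)
  refine (mapDeg_extDerivSMul (f := thickHom π (Nat.sub_le n 1) U) (thickHom_tFun_pow π _ U) η).trans ?_
  rw [extDerivSMul_zero]
  rfl

theorem formMap_app_eq_zero (ha : formsRes π r h ≫ a = tPowDeriv π r n)
    [CharZero k] [Smooth π] (hn : 2 ≤ n) (U : (thick π n).Opens)
    (s : ((pushSheaf (thickMap π h)).obj (formsSheaf r (thick π 1))).obj.obj (op U))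
    (hs : a.hom.app (op U) s = 0) : s = 0 := by
  refine section_eq_zero _ _ fun x hx => ?_
  obtain ⟨V, hV, η, hVa, hxV, e⟩ := exists_affine_push_toSection_eq (formsFunctor r) (thickMap π h)
    (thickMap_surjective π le_rfl h) (exists_preimage_eq π h) s x hx
  obtain ⟨η, rfl⟩ := mapDeg_surjective (thickMap_app_surjective π h hVa) r η
  have e' := (sheafRestrict_toSection (formsFunctor r) (thickMap π h) V η).trans e
  have e0 : toSection (closedFunctor (r + 1)) (thick π n) V
      (extDerivSMul r (tFun π n V ^ (n - 1)) η) = 0 := by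
    refine (tPowDeriv_toSection π r n V η).symm.trans ((formMap_app ha).symm.trans ?_)
    rw [e']
    refine (NatTrans.naturality_apply a.hom (homOfLE hV).op s).trans ?_
    rw [hs]
    exact map_zero ((closedSheaf (r + 1) (thick π n)).obj.map (homOfLE hV).op).hom
  obtain ⟨W, hW, hWa, hxW, k0⟩ := exists_affine_map_eq_zero (closedFunctor (r + 1)) _ e0 x hxV
  refine ⟨W, hW.trans hV, hxW, ?_⟩
  rw [← toSection_push_resHom (formsFunctor r) _ e hW]
  have k1 : extDerivSMul r (tFun π n W ^ (n - 1)) (mapDeg r (resHom _ hW) η) = 0 := by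
    refine (Subtype.ext (mapDeg_extDerivSMul (f := resHom _ hW) ?_ η)).symm.trans k0
    rw [map_pow, resHom_tFun]
  obtain ⟨R, _, ⟨T⟩⟩ := exists_truncData_section π h hWa
  have k2 := mapDeg_eq_zero_of_extDerivSMul T (natUnits_thick π n W) hn (f := thickHom π h W)
    ((pow_one (tFun π n W)) ▸ thickHom_tFun_pow π h W) k1
  refine (congrArg _ ?_).trans (toSection_zero (formsFunctor r) _ _)
  exact (mapDeg_square (thickHom_comp_resHom π h hW) η).symm.trans k2

/-- Exactness in the middle is the Poincaré lemma with m = n - 1. The primitive has degree r, and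
the degree 0 alternative cannot occur for an (r+1)-form. -/
theorem exists_formMap_eq (ha : formsRes π r h ≫ a = tPowDeriv π r n)
    [CharZero k] [Smooth π] (hn : 2 ≤ n) {U : (thick π n).Opens}
    (s : (closedSheaf (r + 1) (thick π n)).obj.obj (op U))
    (hs : (closedRes π (r + 1) (Nat.sub_le n 1)).hom.app (op U) s = 0) (x : thick π n) (hx : x ∈ U) :
    ∃ (V : (thick π n).Opens) (hV : V ≤ U)
      (z : ((pushSheaf (thickMap π h)).obj (formsSheaf r (thick π 1))).obj.obj (op V)), x ∈ V ∧
      a.hom.app (op V) z = (closedSheaf (r + 1) (thick π n)).obj.map (homOfLE hV).op s := by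
  have hm : 1 ≤ n - 1 := by omega
  obtain ⟨V, hV, ω, hVa, hxV, e, e0⟩ := exists_toSection_of_sheafRestrict_eq_zero
    (closedFunctor (r + 1)) (thickMap π (Nat.sub_le n 1)) (thickMap_surjective π hm _)
    (exists_preimage_eq π _) s hs x hx
  obtain ⟨R, _, ⟨T⟩⟩ := exists_truncData_section π h hVa
  obtain ⟨hr, -⟩ | ⟨p, η, hp, e1⟩ := exists_eq_extD_of_mapDeg T (natUnits_thick π n V) hm
    (Nat.sub_le n 1) (thickMap_app_surjective π _ hVa) (ker_thickMap_app π _ hVa) ω.1 ω.2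
    (congrArg Subtype.val e0)
  · omega
  · obtain rfl : r = p := by omega
    refine ⟨V, hV, (formsRes π r h).hom.app (op V) (toSection (formsFunctor r) _ V η), hxV, ?_⟩
    rw [formMap_app ha, ← e]
    refine (tPowDeriv_toSection π r n V η).trans (congrArg _ ?_)
    exact Subtype.ext (Subtype.ext e1.symm)

end formSheaves

end

end MilnorDlog

namespace MilnorDlog

noncomputable section

/-! ### The upper exact row and the theorem -/

section main

variable {k : Type u} [Field k] {X : Scheme.{u}} (π : X ⟶ BaseS k)

/-- Local preimages are unique by injectivity of f, so they glue and factor the kernel of g through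
f. The factorization is kept since the upper row reuses it. -/
theorem exact_of_exists_local {Y : TopCat.{u}} {S T R : TopCat.Sheaf AddCommGrpCat.{u} Y} (f : S ⟶ T)
    (g : T ⟶ R) (w : f ≫ g = 0)
    (hinj : ∀ (U : Opens Y) (z : S.obj.obj (op U)), f.hom.app (op U) z = 0 → z = 0)
    (h : ∀ (U : Opens Y) (s : T.obj.obj (op U)), g.hom.app (op U) s = 0 → ∀ x ∈ U,
      ∃ (V : Opens Y) (hV : V ≤ U) (z : S.obj.obj (op V)), x ∈ V ∧
        f.hom.app (op V) z = T.obj.map (homOfLE hV).op s) :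
    (ShortComplex.mk f g w).Exact ∧ ∃ l : kernel g ⟶ S, l ≫ f = kernel.ι g := by
  obtain ⟨l, hl, -⟩ := exists_lift_of_local f f (fun U z hz _ => hinj U z hz) (kernel.ι g) (kernel.ι g) fun U s x hx => by
    obtain ⟨V, hV, z, hxV, e⟩ := h U ((kernel.ι g).hom.app (op U) s)
      (ConcreteCategory.congr_hom (congrArg (fun α => α.hom.app (op U)) (kernel.condition g)) s) x hx
    exact ⟨V, hV, z, hxV, e, e⟩
  refine ⟨?_, l, hl⟩
  rw [ShortComplex.exact_iff_kernel_ι_comp_cokernel_π_zero]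
  change kernel.ι g ≫ cokernel.π f = 0
  rw [← hl, Category.assoc, cokernel.condition, comp_zero]

/-- In an abelian category, the base change of the epimorphism `closedRes` in the cartesian square
is again an epimorphism. -/
theorem milnorRes_epi [CharZero k] [Smooth π] (r : ℕ) {m n : ℕ} (hm : 1 ≤ m) (h : m ≤ n) :
    Epi (milnorRes π r h) := by
  have := closedRes_epi π r hm h
  exact Abelian.epi_fst_of_isLimit _ _ (isPullback_milnor π r hm h).isLimit

/-- Restriction to X_{n-1} and dlog are jointly injective on symbols, so the formula is checked
after each: both restrictions vanish, and both logarithmic derivatives are d(t^{n-1} x dlog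
y_1∧⋯∧dlog y_r). -/
theorem isSymbolMap [CharZero k] [Smooth π] {r n : ℕ} (hn : 2 ≤ n) {h : 1 ≤ n}
    {a : (pushSheaf (thickMap π h)).obj (formsSheaf r (thick π 1)) ⟶ closedSheaf (r + 1) (thick π n)}
    (ha : formsRes π r h ≫ a = tPowDeriv π r n)
    {b : (pushSheaf (thickMap π h)).obj (formsSheaf r (thick π 1)) ⟶ milnorSheaf (r + 1) (thick π n)}
    (hb : b ≫ milnorRes π (r + 1) (Nat.sub_le n 1) = 0)
    (hb' : b ≫ dlogSheaf (r + 1) (thick π n) = a) : IsSymbolMap π h b := by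
  intro U x y z hz
  refine sub_eq_zero.1 (milnorSection_eq_zero π (r + 1) (by omega : 1 ≤ n - 1) (Nat.sub_le n 1) U _
    ?_ ?_)
  · rw [map_sub_app, sub_eq_zero]
    have e : mapMilnor (r + 1) (thickHom π (Nat.sub_le n 1) U) (symbol (r + 1) (Fin.cons z y)) = 0 := by
      rw [mapMilnor_symbol]
      refine symbol_eq_zero_of_eq_one _ 0 (Units.ext ?_)
      change thickHom π (Nat.sub_le n 1) U z = 1
      rw [hz, map_add, map_one, map_mul, thickHom_tFun_pow, mul_zero, add_zero]
    refine (ConcreteCategory.congr_hom (congrArg (fun α => α.hom.app (op U)) hb) _).trans ?_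
    exact ((sheafRestrict_toSection (milnorFunctor (r + 1)) _ U _).trans
      ((congrArg _ e).trans (toSection_zero (milnorFunctor (r + 1)) _ _))).symm
  · rw [map_sub_app, sub_eq_zero]
    refine (ConcreteCategory.congr_hom (congrArg (fun α => α.hom.app (op U)) hb') _).trans ?_
    refine (formMap_app ha).trans ((tPowDeriv_toSection π r n U _).trans ?_)
    refine Eq.trans ?_ (sheafOfMap_toSection _ (dlogNat (r + 1)) U _).symm
    exact congrArg _ (dlogForms_symbol_cons (natUnits_thick π n U) hn (tFun_pow π n U) hz y).symm

/-- The map b is the lift of the pair (0, a) through the cartesian square, so the commutation dlog ∘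
b = a holds by construction and makes b a monomorphism. -/
theorem exists_shortExact [CharZero k] [Smooth π] (r n : ℕ) (hn : 2 ≤ n) :
      ∃ (b : (pushSheaf (thickMap π (one_le_two.trans hn))).obj (formsSheaf r (thick π 1)) ⟶
            milnorSheaf (r + 1) (thick π n))
        (a : (pushSheaf (thickMap π (one_le_two.trans hn))).obj (formsSheaf r (thick π 1)) ⟶
            closedSheaf (r + 1) (thick π n))
        (hb : b ≫ milnorRes π (r + 1) (Nat.sub_le n 1) = 0)
        (ha : a ≫ closedRes π (r + 1) (Nat.sub_le n 1) = 0),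
        IsSymbolMap π (one_le_two.trans hn) b ∧ IsFormMap π (one_le_two.trans hn) a ∧
        (ShortComplex.mk b _ hb).ShortExact ∧ (ShortComplex.mk a _ ha).ShortExact ∧
        ∃ φ : ShortComplex.mk b _ hb ⟶ ShortComplex.mk a _ ha,
          φ.τ₁ = 𝟙 _ ∧ φ.τ₂ = dlogSheaf (r + 1) (thick π n) ∧
            φ.τ₃ = dlogPush π (r + 1) (Nat.sub_le n 1) := by
  have hm : 1 ≤ n - 1 := by omega
  obtain ⟨a, ha⟩ := exists_formMap π r (one_le_two.trans hn)
  have ha0 := formMap_closedRes ha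
  have ainj := formMap_app_eq_zero ha hn
  have amono := sheafHom_mono a ainj
  have sq := isPullback_milnor π (r + 1) hm (Nat.sub_le n 1)
  have w : 0 ≫ dlogPush π (r + 1) (Nat.sub_le n 1) = a ≫ closedRes π (r + 1) (Nat.sub_le n 1) := by
    rw [ha0, zero_comp]
  obtain ⟨aexact, l, hl⟩ := exact_of_exists_local a _ ha0 ainj
    fun _ => exists_formMap_eq ha hn
  have hb := sq.lift_fst 0 a w
  have hb' := sq.lift_snd 0 a w
  generalize sq.lift 0 a w = b at hb hb'
  have bmono : Mono b := mono_of_mono_fac hb'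
  -- dlog carries the kernel of the upper restriction into that of the lower one, which factors
  -- through a by `l`; uniqueness in the cartesian square turns this into a factorization through b.
  have bexact : (ShortComplex.mk b _ hb).Exact := by
    have wκ : (kernel.ι (milnorRes π (r + 1) (Nat.sub_le n 1)) ≫ dlogSheaf (r + 1) (thick π n)) ≫
        closedRes π (r + 1) (Nat.sub_le n 1) = 0 := by
      rw [Category.assoc, ← sq.w, ← Category.assoc, kernel.condition, zero_comp]
    have e : (kernel.lift _ _ wκ ≫ l) ≫ b = kernel.ι (milnorRes π (r + 1) (Nat.sub_le n 1)) := by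
      refine sq.hom_ext ?_ ?_
      · rw [Category.assoc, hb, comp_zero, kernel.condition]
      · rw [Category.assoc, hb', Category.assoc, hl, kernel.lift_ι]
    rw [ShortComplex.exact_iff_kernel_ι_comp_cokernel_π_zero]
    change kernel.ι (milnorRes π (r + 1) (Nat.sub_le n 1)) ≫ cokernel.π b = 0
    rw [← e, Category.assoc, cokernel.condition, comp_zero]
  refine ⟨b, a, hb, ha0, isSymbolMap π hn ha hb hb', isFormMap ha,
    { exact := bexact, mono_f := bmono, epi_g := milnorRes_epi π (r + 1) hm _ },
    { exact := aexact, mono_f := amono, epi_g := closedRes_epi π (r + 1) hm _ },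
    { τ₁ := 𝟙 _, τ₂ := dlogSheaf (r + 1) (thick π n), τ₃ := dlogPush π (r + 1) (Nat.sub_le n 1),
      comm₁₂ := ?_, comm₂₃ := ?_ }, rfl, rfl, rfl⟩
  · exact (Category.id_comp _).trans hb'.symm
  · exact sq.w.symm

/-- A closed function that vanishes modulo t^m would be d of a form of degree -1, hence is zero. -/
theorem isIso_closedRes_zero [CharZero k] [Smooth π] {m n : ℕ} (hm : 1 ≤ m) (h : m ≤ n) :
    IsIso (closedRes π 0 h) := by
  have := closedRes_epi π 0 hm h
  have : Mono (closedRes π 0 h) := sheafHom_mono _ fun U s hs => section_eq_zero _ _ fun x hx => by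
    obtain ⟨V, hV, ω, hVa, hxV, e, e0⟩ := exists_toSection_of_sheafRestrict_eq_zero
      (closedFunctor 0) (thickMap π h) (thickMap_surjective π hm _) (exists_preimage_eq π _) s hs x hx
    obtain ⟨R, _, ⟨T⟩⟩ := exists_truncData_section π (hm.trans h) hVa
    obtain ⟨-, h0⟩ | ⟨p, η, hp, e1⟩ := exists_eq_extD_of_mapDeg T (natUnits_thick π n V) hm
      h (thickMap_app_surjective π _ hVa) (ker_thickMap_app π _ hVa) ω.1 ω.2 (congrArg Subtype.val e0)
    · refine ⟨V, hV, hxV, e.symm.trans ((congrArg _ (Subtype.ext h0)).trans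
        (toSection_zero (closedFunctor 0) _ _))⟩
    · omega
  exact isIso_of_mono_of_epi _

end main

end

end MilnorDlog

theorem proposition2p3 {k : Type u} [Field k] [CharZero k] {X : Scheme.{u}} (π : X ⟶ BaseS k)
    [Smooth π] [IsSeparated π] [LocallyOfFiniteType π] [QuasiCompact π] :
    (∀ (r n : ℕ) (hn : 1 ≤ n),
      IsPullback (milnorRes π r hn) (dlogSheaf r (thick π n))
        (dlogPush π r hn) (closedRes π r hn)) ∧
    (∀ (r n : ℕ) (hn : 2 ≤ n),
      ∃ (b : (pushSheaf (thickMap π (one_le_two.trans hn))).obj (formsSheaf r (thick π 1)) ⟶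
            milnorSheaf (r + 1) (thick π n))
        (a : (pushSheaf (thickMap π (one_le_two.trans hn))).obj (formsSheaf r (thick π 1)) ⟶
            closedSheaf (r + 1) (thick π n))
        (hb : b ≫ milnorRes π (r + 1) (Nat.sub_le n 1) = 0)
        (ha : a ≫ closedRes π (r + 1) (Nat.sub_le n 1) = 0),
        IsSymbolMap π (one_le_two.trans hn) b ∧ IsFormMap π (one_le_two.trans hn) a ∧
        (ShortComplex.mk b _ hb).ShortExact ∧ (ShortComplex.mk a _ ha).ShortExact ∧
        ∃ φ : ShortComplex.mk b _ hb ⟶ ShortComplex.mk a _ ha,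
          φ.τ₁ = 𝟙 _ ∧ φ.τ₂ = dlogSheaf (r + 1) (thick π n) ∧
            φ.τ₃ = dlogPush π (r + 1) (Nat.sub_le n 1)) ∧
    (∀ (n : ℕ), 2 ≤ n →
      IsIso (milnorRes π 0 (Nat.sub_le n 1)) ∧ IsIso (closedRes π 0 (Nat.sub_le n 1))) := by
  refine ⟨fun r n hn => isPullback_milnor π r le_rfl hn, exists_shortExact π, fun n hn => ?_⟩
  have hm : 1 ≤ n - 1 := by omega
  have := isIso_closedRes_zero π hm (Nat.sub_le n 1)
  -- In degree 0 the restriction of symbols is a base change of the restriction of closed functions.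
  exact ⟨(isPullback_milnor π 0 hm (Nat.sub_le n 1)).isIso_fst_of_isIso, this⟩
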